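/- Let $K$ be an algebraically closed field, and let $\Gamma$ be the quiver with vertices $e_0,e_1,e_2,e_3$ (indices modulo $4$) and two arrows $a_{0,m},a_{1,m}$ from $e_m$ to $e_{m+1}$ for each $m$ modulo $4$. In the path algebra $K\Gamma$ (paths written from left to right) put $x_l=\sum_{m=0}^{3}a_{l,m}$, with $l$ modulo $2$. Let $T\ge 0$ be an integer and $q_0,q_1,q_2,q_3\in K^\times$ (indices modulo $4$), and let $$A=A_T(q_0,q_1,q_2,q_3)=K\Gamma\big/\big\langle x_lx_{l+1},\ e_i(q_ix_i^{4T+2}+x_{i+1}^{4T+2})\ \big|\ l=0,1;\ 0\le i\le 3\big\rangle .$$ Put $S_{u,v}=\prod_{t=0}^{u-1}q_{t+v}$ for $u\ge0$ and $v$ modulo $4$ (so $S_{0,v}=1$). Define $g^n_{i,j}\in K\Gamma$ for $n\ge0$, $i$ modulo $4$ and $0\le j\le n$ by $g^0_{i,0}=e_i$, $$g_{i,j}^{2m+1}=\begin{cases} g_{i,0}^{2m}x_{i} & j=0\\ S_{2m-j+1,i+j-1}\,g_{i,j-1}^{2m}x_{i+1}^{4T+1}+g_{i,j}^{2m}x_{i}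 & 1\le j\le m\\ S_{2m-j+1,i+j-1}\,g_{i,j-1}^{2m}x_{i+1}+g_{i,j}^{2m}x_{i}^{4T+1} & m+1\le j\le 2m\\ g_{i,2m}^{2m}x_{i+1} & j=2m+1 \end{cases}\qquad(m\ge0),$$ $$g_{i,j}^{2m}=\begin{cases} g_{i,0}^{2m-1}x_{i+1} & j=0\\ S_{2m-j,i+j-1}\,g_{i,j-1}^{2m-1}x_{i}^{4T+1}+g_{i,j}^{2m-1}x_{i+1} & 1\le j\le m-1\\ S_{m,i+m-1}\,g_{i,m-1}^{2m-1}x_{i}^{4T+1}+g_{i,m}^{2m-1}x_{i+1}^{4T+1} & j=m\\ S_{2m-j,i+j-1}\,g_{i,j-1}^{2m-1}x_{i}+g_{i,j}^{2m-1}x_{i+1}^{4T+1} & m+1\le j\le 2m-1\\ g_{i,2m-1}^{2m-1}x_{i} & j=2m \end{cases}\qquad(m\ge1),$$ and let $\mathcal G^n=\{g^n_{i,j}\mid 0\le i\le3,\ 0\le j\le n\}$. Then, for each $n$, the elements $g^n_{i,j}$ are nonzero and pairwise distinct, and $g^n_{i,j}=e_i\,g^n_{i,j}\,e_{i+n}$,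 that is, $g^n_{i,j}$ is uniform with origin $\mathfrak o(g^n_{i,j})=e_i$ and terminus $\mathfrak t(g^n_{i,j})=e_{i+n}$. Let $R^n=\bigoplus_{g\in\mathcal G^n}A\,\mathfrak o(g)\otimes_K\mathfrak t(g)A=\bigoplus_{i=0}^{3}\bigoplus_{j=0}^{n}Ae_i\otimes_K e_{i+n}A$, with generators $\mathfrak p^n_{i,j}=e_i\otimes e_{i+n}$ in the summand of $g^n_{i,j}$ ($i$ modulo $4$). Let $\partial^0:R^0\to A$ be the multiplication map, and for $n\ge1$ let $\partial^n:R^n\to R^{n-1}$ be the $A$-$A$-bimodule homomorphism given, for $m\ge0$, by $$\partial^{2m+1}(\mathfrak p_{i,j}^{2m+1})=\begin{cases} \mathfrak p_{i,0}^{2m}x_i-x_i\mathfrak p_{i+1,0}^{2m} & j=0\\ S_{2m-j+1,i+j-1}\mathfrak p_{i,j-1}^{2m}x_{i+1}^{4T+1}+\mathfrak p_{i,j}^{2m}x_i-S_{j,i}x_i\mathfrak p_{i+1,j}^{2m}-x_{i+1}^{4T+1}\mathfrak p_{i+1,j-1}^{2m} & 1\le j<m+1\\ S_{2m-j+1,i+j-1}\mathfrak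 p_{i,j-1}^{2m}x_{i+1}+\mathfrak p_{i,j}^{2m}x_i^{4T+1}-S_{j,i}x_i^{4T+1}\mathfrak p_{i+1,j}^{2m}-x_{i+1}\mathfrak p_{i+1,j-1}^{2m} & m+1\le j<2m+1\\ \mathfrak p_{i,2m}^{2m}x_{i+1}-x_{i+1}\mathfrak p_{i+1,2m}^{2m} & j=2m+1 \end{cases}$$ and, for $m\ge1$, by $\partial^{2m}(\mathfrak p_{i,j}^{2m})=$ $$\begin{cases} \mathfrak p_{i,0}^{2m-1}x_{i+1}+x_i\mathfrak p_{i+1,0}^{2m-1} & j=0\\ S_{2m-j,i+j-1}\mathfrak p_{i,j-1}^{2m-1}x_i^{4T+1}+\mathfrak p_{i,j}^{2m-1}x_{i+1}+S_{j,i}x_i\mathfrak p_{i+1,j}^{2m-1}+x_{i+1}^{4T+1}\mathfrak p_{i+1,j-1}^{2m-1} & 1\le j<m\\ \begin{aligned} &\textstyle\sum_{k=0}^{T}\big[x_i^{4k}\big(S_{m,i+m-1}\mathfrak p_{i,m-1}^{2m-1}x_i+S_{m,i}x_i\mathfrak p_{i+1,m}^{2m-1}\big)x_i^{4T-4k}\\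 &\quad+x_{i+1}^{4k}\big(\mathfrak p_{i,m}^{2m-1}x_{i+1}+x_{i+1}\mathfrak p_{i+1,m-1}^{2m-1}\big)x_{i+1}^{4T-4k}\big]\\ &\textstyle+\sum_{k=0}^{T-1}\big[x_i^{4k+2}\big(S_{m,i}\mathfrak p_{i+2,m-1}^{2m-1}x_i+S_{m,i+m-1}x_i\mathfrak p_{i+3,m}^{2m-1}\big)x_i^{4T-4k-2}\\ &\quad+S_{m,i+3}^{-1}S_{m,i+m+2}\,x_{i+1}^{4k+2}\big(\mathfrak p_{i+2,m}^{2m-1}x_{i+1}+x_{i+1}\mathfrak p_{i+3,m-1}^{2m-1}\big)x_{i+1}^{4T-4k-2}\big] \end{aligned} & j=m\\ S_{2m-j,i+j-1}\mathfrak p_{i,j-1}^{2m-1}x_i+\mathfrak p_{i,j}^{2m-1}x_{i+1}^{4T+1}+S_{j,i}x_i^{4T+1}\mathfrak p_{i+1,j}^{2m-1}+x_{i+1}\mathfrak p_{i+1,j-1}^{2m-1} & m+1\le j<2m\\ \mathfrak p_{i,2m-1}^{2m-1}x_i+x_{i+1}\mathfrak p_{i+1,2m-1}^{2m-1} & j=2m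 . \end{cases}$$ Then $\cdots\to R^2\xrightarrow{\partial^2}R^1\xrightarrow{\partial^1}R^0\xrightarrow{\partial^0}A\to0$ is a minimal projective bimodule resolution of $A$: the sequence is exact, every $R^n$ is a projective $A$-$A$-bimodule, and every $R^n$ ($n\ge0$) is a projective cover of the image of $\partial^n$, that is, $\operatorname{Ker}\partial^n$ is a superfluous sub-bimodule of $R^n$. -/

import Mathlib

open scoped TensorProduct
open MulOpposite

noncomputable section

universe u v w

/-! ### Path algebras of finite quivers -/

/-- The path algebra of a quiver with finitely many vertices: the free `K`-module on all paths,
written as the family of its components "paths from `a` to `b`". -/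
def PathAlgebra (K : Type u) (V : Type v) [Field K] [Quiver.{w} V] : Type (max u v w) :=
  (a b : V) → Quiver.Path a b →₀ K

namespace PathAlgebra

variable {K : Type u} {V : Type v} [Field K] [Quiver.{w} V]

instance : AddCommGroup (PathAlgebra K V) :=
  inferInstanceAs (AddCommGroup ((a b : V) → Quiver.Path a b →₀ K))

instance : Module K (PathAlgebra K V) :=
  inferInstanceAs (Module K ((a b : V) → Quiver.Path a b →₀ K))

/-- The bilinear extension of the concatenation of paths. -/
def comp (a b c : V) :
    (Quiver.Path a b →₀ K) →ₗ[K] (Quiver.Path b c →₀ K) →ₗ[K] (Quiver.Path a c →₀ K) :=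
  Finsupp.lift _ K _ fun p => Finsupp.lmapDomain K K fun r => p.comp r

theorem comp_single (a b c : V) (p : Quiver.Path a b) (r : Quiver.Path b c) (s t : K) :
    comp a b c (Finsupp.single p s) (Finsupp.single r t) = Finsupp.single (p.comp r) (s * t) := by
  simp [comp]

theorem comp_assoc {a b c d : V} (f : Quiver.Path a b →₀ K) (g : Quiver.Path b c →₀ K)
    (h : Quiver.Path c d →₀ K) :
    comp a c d (comp a b c f g) h = comp a b d f (comp b c d g h) := by
  induction f using Finsupp.induction_linear with
  | zero => simp
  | add f₁ f₂ h₁ h₂ => simp [h₁, h₂]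
  | single p s =>
    induction g using Finsupp.induction_linear with
    | zero => simp
    | add f₁ f₂ h₁ h₂ => simp [h₁, h₂]
    | single r t =>
      induction h using Finsupp.induction_linear with
      | zero => simp
      | add f₁ f₂ h₁ h₂ => simp [h₁, h₂]
      | single w u => simp only [comp_single, mul_assoc, Quiver.Path.comp_assoc]

theorem nil_comp {a b : V} (f : Quiver.Path a b →₀ K) :
    comp a a b (Finsupp.single Quiver.Path.nil 1) f = f := by
  induction f using Finsupp.induction_linear with
  | zero => simp
  | add f₁ f₂ h₁ h₂ => simp [h₁, h₂]
  | single p s => simp [comp_single]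

theorem comp_nil {a b : V} (f : Quiver.Path a b →₀ K) :
    comp a b b f (Finsupp.single Quiver.Path.nil 1) = f := by
  induction f using Finsupp.induction_linear with
  | zero => simp
  | add f₁ f₂ h₁ h₂ => simp [h₁, h₂]
  | single p s => simp [comp_single]

theorem add_apply (f g : PathAlgebra K V) (a c : V) : (f + g) a c = f a c + g a c := rfl

theorem zero_apply (a c : V) : (0 : PathAlgebra K V) a c = 0 := rfl

theorem smul_apply (s : K) (f : PathAlgebra K V) (a c : V) : (s • f) a c = s • f a c := rfl

protected theorem ext {f g : PathAlgebra K V} (h : ∀ a c, f a c = g a c) : f = g :=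
  funext fun a => funext fun c => h a c

/-- Paths are multiplied from left to right; the product of two paths that cannot be concatenated
is zero. -/
instance [Fintype V] : Mul (PathAlgebra K V) :=
  ⟨fun f g a c => ∑ b, comp a b c (f a b) (g b c)⟩

/-- The unit is the sum of the trivial paths. -/
instance [DecidableEq V] : One (PathAlgebra K V) :=
  ⟨fun a => Pi.single a (Finsupp.single Quiver.Path.nil 1)⟩

theorem mul_apply [Fintype V] (f g : PathAlgebra K V) (a c : V) :
    (f * g) a c = ∑ b, comp a b c (f a b) (g b c) := rfl

theorem one_apply [DecidableEq V] (a : V) :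
    (1 : PathAlgebra K V) a = Pi.single a (Finsupp.single Quiver.Path.nil 1) := rfl

variable [Fintype V] [DecidableEq V]

instance : Ring (PathAlgebra K V) :=
  { (inferInstance : AddCommGroup (PathAlgebra K V)),
    (inferInstance : Mul (PathAlgebra K V)),
    (inferInstance : One (PathAlgebra K V)) with
    left_distrib := fun f g h => PathAlgebra.ext fun a c => by
      simp [mul_apply, add_apply, Finset.sum_add_distrib]
    right_distrib := fun f g h => PathAlgebra.ext fun a c => by
      simp [mul_apply, add_apply, Finset.sum_add_distrib]
    zero_mul := fun f => PathAlgebra.ext fun a c => by simp [mul_apply, zero_apply]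
    mul_zero := fun f => PathAlgebra.ext fun a c => by simp [mul_apply, zero_apply]
    mul_assoc := fun f g h => PathAlgebra.ext fun a d => by
      simp only [mul_apply, map_sum, LinearMap.sum_apply, comp_assoc]
      exact Finset.sum_comm
    one_mul := fun f => PathAlgebra.ext fun a c => by
      rw [mul_apply, Finset.sum_eq_single a]
      · simp [one_apply, nil_comp]
      · intro b _ hb
        simp [one_apply, Pi.single_eq_of_ne hb]
      · simp
    mul_one := fun f => PathAlgebra.ext fun a c => by
      rw [mul_apply, Finset.sum_eq_single c]
      · simp [one_apply, comp_nil]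
      · intro b _ hb
        simp [one_apply, Pi.single_eq_of_ne hb.symm]
      · simp }

instance : Algebra K (PathAlgebra K V) :=
  Algebra.ofModule
    (fun s f g => PathAlgebra.ext fun a c => by
      simp [mul_apply, smul_apply, Finset.smul_sum])
    (fun s f g => PathAlgebra.ext fun a c => by
      simp [mul_apply, smul_apply, Finset.smul_sum])

/-- A path as an element of the path algebra. -/
def ofPath {a b : V} (p : Quiver.Path a b) : PathAlgebra K V :=
  Pi.single a (Pi.single b (Finsupp.single p 1))

theorem ofPath_mul_ofPath {a b c : V} (p : Quiver.Path a b) (r : Quiver.Path b c) :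
    (ofPath p * ofPath r : PathAlgebra K V) = ofPath (p.comp r) := by
  refine PathAlgebra.ext fun u w => ?_
  rw [mul_apply, Finset.sum_eq_single b]
  · by_cases hu : u = a
    · subst hu
      by_cases hw : w = c
      · subst hw
        simp [ofPath, comp_single]
      · simp [ofPath, Pi.single_eq_of_ne hw]
    · simp [ofPath, Pi.single_eq_of_ne hu]
  · intro v _ hv
    simp [ofPath, Pi.single_eq_of_ne hv]
  · simp

theorem ofPath_mul_ofPath_of_ne {a b c d : V} (p : Quiver.Path a b) (r : Quiver.Path c d)
    (h : b ≠ c) : (ofPath p * ofPath r : PathAlgebra K V) = 0 := by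
  refine PathAlgebra.ext fun u w => ?_
  rw [mul_apply, zero_apply]
  refine Finset.sum_eq_zero fun v _ => ?_
  by_cases hv : v = c
  · subst hv
    by_cases hu : u = a
    · subst hu
      simp [ofPath, Pi.single_eq_of_ne h.symm]
    · simp [ofPath, Pi.single_eq_of_ne hu]
  · simp [ofPath, Pi.single_eq_of_ne hv]

end PathAlgebra

/-! ### The quiver and the algebra -/

namespace CyclicAlg

/-- The arrows of the quiver with vertices `e₀, …, e₃` (indexed modulo `4`): the arrow `a l m`,
with `l` modulo `2` and `m` modulo `4`, starts at `e_m` and ends at `e_{m+1}`. -/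
inductive Arrow : ZMod 4 → ZMod 4 → Type
  | a (l : ZMod 2) (m : ZMod 4) : Arrow m (m + 1)

instance : Quiver (ZMod 4) := ⟨Arrow⟩

variable (K : Type u) [Field K]

/-- The path algebra `KΓ`. -/
abbrev KΓ : Type u := PathAlgebra K (ZMod 4)

/-- The vertex `e_i` of `KΓ`. -/
def vertex (i : ZMod 4) : KΓ K := PathAlgebra.ofPath (Quiver.Path.nil : Quiver.Path i i)

/-- The arrow `a_{l,m}` of `KΓ`. -/
def arrow (l : ZMod 2) (m : ZMod 4) : KΓ K :=
  PathAlgebra.ofPath (Quiver.Hom.toPath (Arrow.a l m : m ⟶ m + 1))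

/-- `x_l = ∑_m a_{l,m}`. -/
def xPath (l : ZMod 2) : KΓ K := ∑ m, arrow K l m

/-- Reduction modulo `2` of an index modulo `4`, as in `x_i` for a vertex index `i`. -/
def par (i : ZMod 4) : ZMod 2 := ZMod.castHom (by decide : 2 ∣ 4) (ZMod 2) i

variable {K}

/-- The relations `x_l x_{l+1}` and `e_i (q_i x_i^{4T+2} + x_{i+1}^{4T+2})`. -/
def relations (T : ℕ) (q : ZMod 4 → K) : Set (KΓ K) :=
  (Set.range fun l : ZMod 2 => xPath K l * xPath K (l + 1)) ∪
    Set.range fun i : ZMod 4 =>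
      vertex K i * (q i • xPath K (par i) ^ (4 * T + 2) + xPath K (par (i + 1)) ^ (4 * T + 2))

/-- The two-sided ideal `I_T(q₀,q₁,q₂,q₃)` of `KΓ`. -/
def relIdeal (T : ℕ) (q : ZMod 4 → K) : TwoSidedIdeal (KΓ K) :=
  TwoSidedIdeal.span (relations T q)

/-- The algebra `A = A_T(q₀,q₁,q₂,q₃) = KΓ / I_T(q₀,q₁,q₂,q₃)`. -/
def Alg (T : ℕ) (q : ZMod 4 → K) : Type u := KΓ K ⧸ (relIdeal T q).asIdeal

variable (T : ℕ) (q : ZMod 4 → K)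

instance : Ring (Alg T q) := inferInstanceAs (Ring (KΓ K ⧸ (relIdeal T q).asIdeal))

instance : Algebra K (Alg T q) := inferInstanceAs (Algebra K (KΓ K ⧸ (relIdeal T q).asIdeal))

/-- The quotient map `KΓ → A`. -/
def proj : KΓ K →ₐ[K] Alg T q := Ideal.Quotient.mkₐ K (relIdeal T q).asIdeal

/-- The image of `e_i` in `A`. -/
def e (i : ZMod 4) : Alg T q := proj T q (vertex K i)

/-- The image of `x_l` in `A`. -/
def x (l : ZMod 2) : Alg T q := proj T q (xPath K l)

/-! ### The elements `g^n_{i,j}` -/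

/-- `S_{u,v} = ∏_{t=0}^{u-1} q_{t+v}`. -/
def S (u : ℕ) (v : ZMod 4) : K := ∏ t ∈ Finset.range u, q (t + v)

/-- The elements `g^n_{i,j}` of `KΓ`, for `0 ≤ j ≤ n`. -/
def g : ℕ → ZMod 4 → ℕ → KΓ K
  | 0, i, _ => vertex K i
  | n + 1, i, j =>
    if n % 2 = 0 then
      -- degree `n + 1 = 2m + 1`
      let m := n / 2
      if j = 0 then g n i 0 * xPath K (par i)
      else if j ≤ m then
        S q (2 * m + 1 - j) (i + j - 1) • (g n i (j - 1) * xPath K (par (i + 1)) ^ (4 * T + 1))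
          + g n i j * xPath K (par i)
      else if j ≤ 2 * m then
        S q (2 * m + 1 - j) (i + j - 1) • (g n i (j - 1) * xPath K (par (i + 1)))
          + g n i j * xPath K (par i) ^ (4 * T + 1)
      else g n i (2 * m) * xPath K (par (i + 1))
    else
      -- degree `n + 1 = 2m` with `m ≥ 1`
      let m := (n + 1) / 2
      if j = 0 then g n i 0 * xPath K (par (i + 1))
      else if j ≤ m - 1 then
        S q (2 * m - j) (i + j - 1) • (g n i (j - 1) * xPath K (par i) ^ (4 * T + 1))
          + g n i j * xPath K (par (i + 1))
      else if j = m then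
        S q m (i + m - 1) • (g n i (m - 1) * xPath K (par i) ^ (4 * T + 1))
          + g n i m * xPath K (par (i + 1)) ^ (4 * T + 1)
      else if j ≤ 2 * m - 1 then
        S q (2 * m - j) (i + j - 1) • (g n i (j - 1) * xPath K (par i))
          + g n i j * xPath K (par (i + 1)) ^ (4 * T + 1)
      else g n i (2 * m - 1) * xPath K (par i)

/-! ### Bimodules -/

/-- The enveloping algebra; its left modules are the `A`-`A`-bimodules with central action of `K`,
`(a ⊗ op b) • m = a m b`. -/
abbrev Env : Type u := Alg T q ⊗[K] (Alg T q)ᵐᵒᵖ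

/-- `A` as a bimodule over itself. -/
instance : Module (Env T q) (Alg T q) := TensorProduct.Algebra.module

theorem env_smul_def (a b c : Alg T q) :
    ((a ⊗ₜ[K] op b : Env T q) • c : Alg T q) = a * (c * b) := rfl

/-- The left ideal `A e_i`. -/
abbrev Ae (i : ZMod 4) : Submodule (Alg T q) (Alg T q) := Submodule.span (Alg T q) {e T q i}

/-- The right ideal `e_k A`. -/
abbrev eA (k : ZMod 4) : Submodule (Alg T q)ᵐᵒᵖ (Alg T q) :=
  Submodule.span (Alg T q)ᵐᵒᵖ {e T q k}

/-- The bimodule `A e_i ⊗_K e_k A`. -/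
def Bim (i k : ZMod 4) : Type u := Ae T q i ⊗[K] eA T q k

instance (i k : ZMod 4) : AddCommGroup (Bim T q i k) :=
  inferInstanceAs (AddCommGroup (Ae T q i ⊗[K] eA T q k))

/-- The action of `A ⊗ Aᵒᵖ` on `A e_i ⊗ e_k A`: `(a ⊗ op b) • (u ⊗ v) = a u ⊗ v b`. -/
def bimAction (i k : ZMod 4) : Env T q →ₐ[K] Module.End K (Ae T q i ⊗[K] eA T q k) :=
  Module.endTensorEndAlgHom.comp
    (Algebra.TensorProduct.map (Algebra.lsmul K K (Ae T q i)) (Algebra.lsmul K K (eA T q k)))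

instance (i k : ZMod 4) : Module (Env T q) (Bim T q i k) :=
  Module.compHom (Ae T q i ⊗[K] eA T q k) (bimAction T q i k).toRingHom

/-- The pure tensor `u ⊗ v` in `A e_i ⊗ e_k A`. -/
def Bim.tmul {i k : ZMod 4} (u : Ae T q i) (v : eA T q k) : Bim T q i k := u ⊗ₜ[K] v

theorem Bim.smul_tmul {i k : ZMod 4} (a b : Alg T q) (u : Ae T q i) (v : eA T q k) :
    (a ⊗ₜ[K] op b : Env T q) • Bim.tmul T q u v = Bim.tmul T q (a • u) (op b • v) := rfl

/-- The `K`-linear map `A e_i ⊗ e_k A → A ⊗ Aᵒᵖ` given by the inclusions, `u ⊗ v ↦ u ⊗ op v`. -/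
def inclLinear (i k : ZMod 4) : Ae T q i ⊗[K] eA T q k →ₗ[K] Env T q :=
  TensorProduct.map ((Ae T q i).subtype.restrictScalars K)
    ((opLinearEquiv K).toLinearMap ∘ₗ (eA T q k).subtype.restrictScalars K)

theorem inclLinear_action (i k : ZMod 4) (r : Env T q) (z : Ae T q i ⊗[K] eA T q k) :
    inclLinear T q i k (bimAction T q i k r z) = r * inclLinear T q i k z := by
  induction r using TensorProduct.induction_on with
  | zero => simp
  | add r s hr hs => rw [map_add, LinearMap.add_apply, map_add, hr, hs, add_mul]
  | tmul a b =>
    induction z using TensorProduct.induction_on with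
    | zero => simp
    | add z w hz hw => rw [map_add, map_add, map_add, hz, hw, mul_add]
    | tmul u v =>
      have h : bimAction T q i k (a ⊗ₜ[K] b) (u ⊗ₜ[K] v) = (a • u) ⊗ₜ[K] (b • v) := rfl
      rw [h, inclLinear, TensorProduct.map_tmul, TensorProduct.map_tmul,
        Algebra.TensorProduct.tmul_mul_tmul]
      rfl

/-- The inclusion `A e_i ⊗ e_k A → A ⊗ Aᵒᵖ` as a map of bimodules. -/
def Bim.incl (i k : ZMod 4) : Bim T q i k →ₗ[Env T q] Env T q where
  toFun := inclLinear T q i k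
  map_add' := map_add (inclLinear T q i k)
  map_smul' := inclLinear_action T q i k

/-- The bimodule map `A e_i ⊗ e_k A → M`, `u ⊗ v ↦ u m v`, for an element `m` of a bimodule `M`. -/
def Bim.lift {M : Type u} [AddCommGroup M] [Module (Env T q) M] (i k : ZMod 4) (m : M) :
    Bim T q i k →ₗ[Env T q] M :=
  (LinearMap.toSpanSingleton (Env T q) M m).comp (Bim.incl T q i k)

/-- The element `e_i ⊗ e_k` of `A e_i ⊗ e_k A`. -/
def Bim.gen (i k : ZMod 4) : Bim T q i k :=
  Bim.tmul T q ⟨e T q i, Submodule.mem_span_singleton_self _⟩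
    ⟨e T q k, Submodule.mem_span_singleton_self _⟩

/-- `R^n = ⨁_{i,j} A 𝔬(g^n_{i,j}) ⊗ 𝔱(g^n_{i,j}) A`, where `g^n_{i,j}` has origin `e_i` and
terminus `e_{i+n}`. -/
abbrev R (n : ℕ) : Type u :=
  DirectSum (ZMod 4 × Fin (n + 1)) fun ij => Bim T q ij.1 (ij.1 + n)

/-- The generator `𝔭^n_{i,j} = 𝔬(g^n_{i,j}) ⊗ 𝔱(g^n_{i,j})` of `R^n`, for `0 ≤ j ≤ n`. -/
def p (n : ℕ) (i : ZMod 4) (j : ℕ) : R T q n :=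
  if h : j < n + 1 then
    DirectSum.lof (Env T q) (ZMod 4 × Fin (n + 1)) (fun ij => Bim T q ij.1 (ij.1 + n)) (i, ⟨j, h⟩)
      (Bim.gen T q i (i + n))
  else 0

/-- The element `c a z b` of a bimodule, for `c ∈ K` and `a, b ∈ A`. -/
def act {M : Type u} [AddCommGroup M] [Module (Env T q) M] (c : K) (a : Alg T q) (z : M)
    (b : Alg T q) : M :=
  (c • (a ⊗ₜ[K] op b) : Env T q) • z

/-- The image of the generator `𝔭^{n+1}_{i,j}` under `∂^{n+1}`, for `0 ≤ j ≤ n + 1`. -/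
def dGen (n : ℕ) (i : ZMod 4) (j : ℕ) : R T q n :=
  -- `y` is `x_i` and `z` is `x_{i+1}`
  let y := x T q (par i)
  let z := x T q (par (i + 1))
  if n % 2 = 0 then
    -- degree `n + 1 = 2m + 1`
    let m := n / 2
    if j = 0 then
      act T q 1 1 (p T q n i 0) y - act T q 1 y (p T q n (i + 1) 0) 1
    else if j < m + 1 then
      act T q (S q (2 * m + 1 - j) (i + j - 1)) 1 (p T q n i (j - 1)) (z ^ (4 * T + 1))
        + act T q 1 1 (p T q n i j) y
        - act T q (S q j i) y (p T q n (i + 1) j) 1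
        - act T q 1 (z ^ (4 * T + 1)) (p T q n (i + 1) (j - 1)) 1
    else if j < 2 * m + 1 then
      act T q (S q (2 * m + 1 - j) (i + j - 1)) 1 (p T q n i (j - 1)) z
        + act T q 1 1 (p T q n i j) (y ^ (4 * T + 1))
        - act T q (S q j i) (y ^ (4 * T + 1)) (p T q n (i + 1) j) 1
        - act T q 1 z (p T q n (i + 1) (j - 1)) 1
    else
      act T q 1 1 (p T q n i (2 * m)) z - act T q 1 z (p T q n (i + 1) (2 * m)) 1
  else
    -- degree `n + 1 = 2m` with `m ≥ 1`
    let m := (n + 1) / 2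
    if j = 0 then
      act T q 1 1 (p T q n i 0) z + act T q 1 y (p T q n (i + 1) 0) 1
    else if j < m then
      act T q (S q (2 * m - j) (i + j - 1)) 1 (p T q n i (j - 1)) (y ^ (4 * T + 1))
        + act T q 1 1 (p T q n i j) z
        + act T q (S q j i) y (p T q n (i + 1) j) 1
        + act T q 1 (z ^ (4 * T + 1)) (p T q n (i + 1) (j - 1)) 1
    else if j = m then
      (∑ k ∈ Finset.range (T + 1),
        (act T q 1 (y ^ (4 * k))
            (act T q (S q m (i + m - 1)) 1 (p T q n i (m - 1)) y
              + act T q (S q m i) y (p T q n (i + 1) m) 1)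
            (y ^ (4 * T - 4 * k))
          + act T q 1 (z ^ (4 * k))
            (act T q 1 1 (p T q n i m) z + act T q 1 z (p T q n (i + 1) (m - 1)) 1)
            (z ^ (4 * T - 4 * k))))
      + (∑ k ∈ Finset.range T,
        (act T q 1 (y ^ (4 * k + 2))
            (act T q (S q m i) 1 (p T q n (i + 2) (m - 1)) y
              + act T q (S q m (i + m - 1)) y (p T q n (i + 3) m) 1)
            (y ^ (4 * T - 4 * k - 2))
          + act T q ((S q m (i + 3))⁻¹ * S q m (i + m + 2)) (z ^ (4 * k + 2))
            (act T q 1 1 (p T q n (i + 2) m) z + act T q 1 z (p T q n (i + 3) (m - 1)) 1)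
            (z ^ (4 * T - 4 * k - 2))))
    else if j < 2 * m then
      act T q (S q (2 * m - j) (i + j - 1)) 1 (p T q n i (j - 1)) y
        + act T q 1 1 (p T q n i j) (z ^ (4 * T + 1))
        + act T q (S q j i) (y ^ (4 * T + 1)) (p T q n (i + 1) j) 1
        + act T q 1 z (p T q n (i + 1) (j - 1)) 1
    else
      act T q 1 1 (p T q n i (2 * m - 1)) y + act T q 1 z (p T q n (i + 1) (2 * m - 1)) 1

/-- The differential `∂^{n+1} : R^{n+1} → R^n`, the bimodule homomorphism with
`𝔭^{n+1}_{i,j} ↦ dGen n i j` (see `d_p`). -/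
def d (n : ℕ) : R T q (n + 1) →ₗ[Env T q] R T q n :=
  DirectSum.toModule (Env T q) _ _ fun ij => Bim.lift T q _ _ (dGen T q n ij.1 ij.2)

/-- The multiplication map `∂^0 : R^0 → A`, `u ⊗ v ↦ u v`. -/
def aug : R T q 0 →ₗ[Env T q] Alg T q :=
  DirectSum.toModule (Env T q) _ _ fun _ => Bim.lift T q _ _ 1

theorem aug_tmul (ij : ZMod 4 × Fin 1) (u : Ae T q ij.1) (v : eA T q (ij.1 + (0 : ℕ))) :
    aug T q (DirectSum.lof (Env T q) _ (fun ij => Bim T q ij.1 (ij.1 + (0 : ℕ))) ij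
      (Bim.tmul T q u v)) = (u * v : Alg T q) := by
  rw [aug, DirectSum.toModule_lof]
  change (u : Alg T q) * (1 * (v : Alg T q)) = _
  rw [one_mul]

/-! ### The differential takes the prescribed values on the generators -/

theorem vertex_mul_xPath (i : ZMod 4) (l : ZMod 2) : vertex K i * xPath K l = arrow K l i := by
  rw [xPath, Finset.mul_sum, Finset.sum_eq_single i]
  · exact (PathAlgebra.ofPath_mul_ofPath _ _).trans (by rw [Quiver.Path.nil_comp]; rfl)
  · intro m _ hm
    exact PathAlgebra.ofPath_mul_ofPath_of_ne _ _ hm.symm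
  · simp

theorem xPath_mul_vertex (i : ZMod 4) (l : ZMod 2) :
    xPath K l * vertex K (i + 1) = arrow K l i := by
  rw [xPath, Finset.sum_mul, Finset.sum_eq_single i]
  · simp [vertex, arrow, PathAlgebra.ofPath_mul_ofPath]
  · intro m _ hm
    exact PathAlgebra.ofPath_mul_ofPath_of_ne _ _ fun h => hm (add_right_cancel h)
  · simp

theorem e_mul_x_pow (i : ZMod 4) (l : ZMod 2) (k : ℕ) :
    e T q i * x T q l ^ k = x T q l ^ k * e T q (i + k) := by
  induction k generalizing i with
  | zero => simp
  | succ k ih =>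
    have h : ∀ i, e T q i * x T q l = x T q l * e T q (i + 1) := fun i => by
      simp only [e, x, ← map_mul, vertex_mul_xPath, xPath_mul_vertex]
    rw [pow_succ, ← mul_assoc, ih, mul_assoc, h, ← mul_assoc]
    push_cast
    rw [add_assoc]

theorem e_mul_self (i : ZMod 4) : e T q i * e T q i = e T q i := by
  simp only [e, vertex, ← map_mul, PathAlgebra.ofPath_mul_ofPath, Quiver.Path.nil_comp]

/-- `e_i z e_k = z`. -/
def Fix {M : Type u} [AddCommGroup M] [Module (Env T q) M] (i k : ZMod 4) (z : M) : Prop :=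
  (e T q i ⊗ₜ[K] op (e T q k) : Env T q) • z = z

section
variable {T q} {M : Type u} [AddCommGroup M] [Module (Env T q) M] {i k : ZMod 4} {z w : M}

theorem Fix.add (hz : Fix T q i k z) (hw : Fix T q i k w) : Fix T q i k (z + w) := by
  rw [Fix, smul_add, hz, hw]

theorem Fix.sub (hz : Fix T q i k z) (hw : Fix T q i k w) : Fix T q i k (z - w) := by
  rw [Fix, smul_sub, hz, hw]

theorem Fix.sum {ι : Type} {s : Finset ι} {f : ι → M} (h : ∀ t ∈ s, Fix T q i k (f t)) :
    Fix T q i k (∑ t ∈ s, f t) := by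
  rw [Fix, Finset.smul_sum]
  exact Finset.sum_congr rfl h

theorem Fix.act {i' k' : ZMod 4} (c : K) (l l' : ZMod 2) (s t : ℕ) (hz : Fix T q i' k' z)
    (hi : i + s = i') (hk : k' + t = k) :
    Fix T q i k (act T q c (x T q l ^ s) z (x T q l' ^ t)) := by
  subst hi hk
  unfold Fix CyclicAlg.act at *
  conv_rhs => rw [← hz]
  simp only [smul_smul, mul_smul_comm, smul_mul_assoc, Algebra.TensorProduct.tmul_mul_tmul,
    ← op_mul, e_mul_x_pow]

theorem Fix.act_left {i' : ZMod 4} (c : K) (l : ZMod 2) (s : ℕ) (hz : Fix T q i' k z)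
    (hi : i + s = i') : Fix T q i k (CyclicAlg.act T q c (x T q l ^ s) z 1) := by
  simpa using Fix.act c l 0 s 0 hz hi (by simp)

theorem Fix.act_right {k' : ZMod 4} (c : K) (l : ZMod 2) (t : ℕ) (hz : Fix T q i k' z)
    (hk : k' + t = k) : Fix T q i k (CyclicAlg.act T q c 1 z (x T q l ^ t)) := by
  simpa using Fix.act c 0 l 0 t hz (by simp) hk

theorem Fix.act_left' {i' : ZMod 4} (c : K) (l : ZMod 2) (hz : Fix T q i' k z)
    (hi : i + 1 = i') : Fix T q i k (CyclicAlg.act T q c (x T q l) z 1) := by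
  simpa using Fix.act_left c l 1 hz (by simpa using hi)

theorem Fix.act_right' {k' : ZMod 4} (c : K) (l : ZMod 2) (hz : Fix T q i k' z)
    (hk : k' + 1 = k) : Fix T q i k (CyclicAlg.act T q c 1 z (x T q l)) := by
  simpa using Fix.act_right c l 1 hz (by simpa using hk)

end

theorem fix_p (n : ℕ) (i : ZMod 4) (j : ℕ) : Fix T q i (i + n) (p T q n i j) := by
  unfold Fix p
  split_ifs with h
  · rw [← map_smul, Bim.gen, Bim.smul_tmul]
    congr 2
    · exact Subtype.ext (e_mul_self T q i)
    · exact Subtype.ext (e_mul_self T q (i + n))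
  · exact smul_zero _

theorem fix_dGen (n : ℕ) (i : ZMod 4) (j : ℕ) :
    Fix T q i (i + (n + 1 : ℕ)) (dGen T q n i j) := by
  have h4 : (4 : ZMod 4) = 0 := by decide
  have hp : ∀ i' : ZMod 4, ∀ j' k', i' + n = k' → Fix T q i' k' (p T q n i' j') := by
    rintro i' j' k' rfl
    exact fix_p T q n i' j'
  have h0 : ∀ t : ℕ, ((4 * t : ℕ) : ZMod 4) = 0 := fun t => by
    push_cast
    rw [h4, zero_mul]
  have h1 : ((4 * T + 1 : ℕ) : ZMod 4) = 1 := by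
    rw [Nat.cast_add, h0, zero_add, Nat.cast_one]
  have hl : ∀ (i i' k : ZMod 4) (c : K) (l : ZMod 2) (j' : ℕ), i + 1 = i' → i' + n = k →
      Fix T q i k (act T q c (x T q l) (p T q n i' j') 1) := fun i i' k c l j' h h' =>
    Fix.act_left' c l (hp i' j' k h') h
  have hr : ∀ (i k : ZMod 4) (c : K) (l : ZMod 2) (j' : ℕ), i + n + 1 = k →
      Fix T q i k (act T q c 1 (p T q n i j') (x T q l)) := fun i k c l j' h =>
    Fix.act_right' c l (hp i j' _ rfl) h
  have hl' : ∀ (i i' k : ZMod 4) (c : K) (l : ZMod 2) (j' : ℕ), i + 1 = i' → i' + n = k →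
      Fix T q i k (act T q c (x T q l ^ (4 * T + 1)) (p T q n i' j') 1) :=
    fun i i' k c l j' h h' => Fix.act_left c l _ (hp i' j' k h') (by rw [h1, h])
  have hr' : ∀ (i k : ZMod 4) (c : K) (l : ZMod 2) (j' : ℕ), i + n + 1 = k →
      Fix T q i k (act T q c 1 (p T q n i j') (x T q l ^ (4 * T + 1))) := fun i k c l j' h =>
    Fix.act_right c l _ (hp i j' _ rfl) (by rw [h1, h])
  have hA : ∀ (c : K) (l : ZMod 2) (k : ℕ) (z : R T q n), k ∈ Finset.range (T + 1) →
      Fix T q i (i + (n + 1 : ℕ)) z →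
      Fix T q i (i + (n + 1 : ℕ))
        (act T q c (x T q l ^ (4 * k)) z (x T q l ^ (4 * T - 4 * k))) :=
    fun c l k z _ hz => Fix.act c l l _ _ hz (by rw [h0, add_zero])
      (by rw [← Nat.mul_sub, h0, add_zero])
  have hB : ∀ (c : K) (l : ZMod 2) (k : ℕ) (z : R T q n), k ∈ Finset.range T →
      Fix T q (i + 2) (i + 2 + (n + 1 : ℕ)) z →
      Fix T q i (i + (n + 1 : ℕ))
        (act T q c (x T q l ^ (4 * k + 2)) z (x T q l ^ (4 * T - 4 * k - 2))) :=
    fun c l k z hk hz => Fix.act c l l _ _ hz (by rw [Nat.cast_add, h0]; push_cast; ring) (by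
      have hk' := Finset.mem_range.mp hk
      have : 4 * T - 4 * k - 2 = 4 * (T - k - 1) + 2 := by omega
      rw [this, Nat.cast_add (4 * (T - k - 1)) 2, h0]
      push_cast
      linear_combination h4)
  unfold dGen
  dsimp only
  split_ifs
  all_goals
    repeat' first
      | (with_reducible refine hl _ _ _ _ _ _ ?_ ?_)
      | (with_reducible refine hr _ _ _ _ _ ?_)
      | (with_reducible refine hl' _ _ _ _ _ _ ?_ ?_)
      | (with_reducible refine hr' _ _ _ _ _ ?_)
      | (with_reducible refine Fix.add ?_ ?_)
      | (with_reducible refine Fix.sub ?_ ?_)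
      | (with_reducible refine Fix.sum fun k hk => ?_)
      | (with_reducible refine hA _ _ _ _ (by assumption) ?_)
      | (with_reducible refine hB _ _ _ _ (by assumption) ?_)
  all_goals
    push_cast
    ring

/-- The value of `∂^{n+1}` on the generator `𝔭^{n+1}_{i,j}`. -/
theorem d_p (n : ℕ) (i : ZMod 4) (j : ℕ) (hj : j ≤ n + 1) :
    d T q n (p T q (n + 1) i j) = dGen T q n i j := by
  rw [p, dif_pos (Nat.lt_succ_of_le hj), d, DirectSum.toModule_lof]
  exact fix_dGen T q n i j

end CyclicAlg

/-! ### Minimal projective resolutions -/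

/-- A submodule `N` of `M` is superfluous (small) if `L + N = M` implies `L = M`. -/
def Submodule.IsSuperfluous {S M : Type*} [Ring S] [AddCommGroup M] [Module S M]
    (N : Submodule S M) : Prop :=
  ∀ L : Submodule S M, L ⊔ N = ⊤ → L = ⊤

/-- The sequence `⋯ → P 2 → P 1 → P 0 → M → 0`, with maps `d n : P (n + 1) → P n` and
`ε : P 0 → M`, is a minimal projective resolution of `M`: it is exact, every `P n` is projective,
and every `P n` is a projective cover of its image, that is, the kernels of `ε` and of all `d n`
are superfluous. -/
structure IsMinimalProjectiveResolution {S M : Type*} [Ring S] [AddCommGroup M] [Module S M]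
    (P : ℕ → Type*) [∀ n, AddCommGroup (P n)] [∀ n, Module S (P n)]
    (ε : P 0 →ₗ[S] M) (d : ∀ n, P (n + 1) →ₗ[S] P n) : Prop where
  projective : ∀ n, Module.Projective S (P n)
  surjective : Function.Surjective ε
  exact_zero : Function.Exact (d 0) ε
  exact_succ : ∀ n, Function.Exact (d (n + 1)) (d n)
  minimal_zero : (LinearMap.ker ε).IsSuperfluous
  minimal_succ : ∀ n, (LinearMap.ker (d n)).IsSuperfluous

end

/-! The relations kill every path in which both letters occur. They make `e_k x_0^{4T+2}` and `e_k
x_1^{4T+2}` nonzero multiples of each other, which forces `x_l^{4T+3} = 0`. So `A` is spanned by the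
monomials `e_k x_l^t` with `t ≤ 4T+2` (`Alg.induction`, `x_pow_eq_zero`). Coordinates of these
monomials come from representing `KΓ` by matrices over `K[X]`, one representation for each letter
(`relIdeal_le_coordIdeal`).

The square of the differential vanishes for three reasons. Products of different letters are zero;
the products `x^{4T+1} x` and `x x^{4T+1}` on one side of a generator cancel in pairs by the socle
relation; and terms with factors on both sides cancel because the scalars `S` agree. In an even
degree the middle generator has a sum over `k` as its value. That sum telescopes, and its scalars
match because of `S_mul_S_add_two`. The cases are collected in `d_d_pz`.

For exactness, filter `R^n` by the power of a letter standing on the left of the generator. Modulo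
positive filtration degree the differential becomes one-sided: it sends `𝔭_{i,j}` to `c 𝔭_{i,j-1}
x_{k+1}^a + 𝔭_{i,j} x_k^b`, where `k` is the parity of `i+n` (`d_sub_mem`). This one-sided complex
has a contracting homotopy that strips the first letter from the right factor (`homotopy`). The
homotopy is left `A`-linear, so `id - ds - sd` raises the filtration degree of every element as soon
as it sends the right multiples of the generators into degree one (`mem_leftFiltration_succ`); this
is checked monomial by monomial in `defect_generator`. The filtration stops at degree `4T+3`, so
every cycle is corrected to a boundary in finitely many steps (`exact_of_filtered_homotopy`). At
`R^0` a left linear section of the multiplication map takes over the role of the next homotopy.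

Each `A e_i ⊗ e_k A` is a direct summand of the enveloping algebra, hence projective. The
differential takes values in the part of positive total degree, which is nilpotent, so the kernels
are superfluous by Nakayama's argument (`isSuperfluous_of_le`).

The statements on the `g^n_{i,j}` concern the path algebra alone. Removing a final arrow undoes
right multiplication by a letter, and nonvanishing and distinctness follow by induction on `n`. -/

noncomputable section

universe u v w

/-! ### Elements of a path algebra as linear combinations of paths -/

namespace PathAlgebra

variable {K : Type u} {V : Type v} [Field K] [Quiver.{w} V]

theorem sum_apply {ι : Type*} (s : Finset ι) (F : ι → PathAlgebra K V) (u w : V) :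
    (∑ a ∈ s, F a) u w = ∑ a ∈ s, F a u w := by
  classical
  induction s using Finset.induction_on with
  | empty => rfl
  | insert a s ha ih => rw [Finset.sum_insert ha, Finset.sum_insert ha, add_apply, ih]

variable [DecidableEq V]

/-- The element of the path algebra with the single component `h` at `(a, b)`. -/
def component (a b : V) (h : Quiver.Path a b →₀ K) : PathAlgebra K V :=
  Pi.single a (Pi.single b h)

theorem component_self (a b : V) (h : Quiver.Path a b →₀ K) : component a b h a b = h := by
  simp [component]

theorem component_of_ne {a b u w : V} (h : Quiver.Path a b →₀ K) (hne : u ≠ a ∨ w ≠ b) :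
    component a b h u w = 0 := by
  by_cases hu : u = a
  · subst hu
    have hw : w ≠ b := by simpa using hne
    simp [component, Pi.single_eq_of_ne hw]
  · simp [component, Pi.single_eq_of_ne hu]

variable [Fintype V]

/-- Every element of a path algebra is a linear combination of paths. -/
theorem induction_ofPath {motive : PathAlgebra K V → Prop} (f : PathAlgebra K V)
    (zero : motive 0) (add : ∀ f g, motive f → motive g → motive (f + g))
    (path : ∀ (c : K) (a b : V) (r : Quiver.Path a b), motive (c • ofPath r)) : motive f := by
  have hsum : ∀ (s : Finset V) (F : V → PathAlgebra K V), (∀ a, motive (F a)) →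
      motive (∑ a ∈ s, F a) := by
    intro s F hF
    induction s using Finset.induction_on with
    | empty => simpa using zero
    | insert a s ha ih => rw [Finset.sum_insert ha]; exact add _ _ (hF a) ih
  have hf : f = ∑ a, ∑ b, component a b (f a b) := by
    refine PathAlgebra.ext fun u w => ?_
    simp only [sum_apply]
    rw [Finset.sum_eq_single u, Finset.sum_eq_single w, component_self]
    · exact fun b _ hb => component_of_ne _ (Or.inr hb.symm)
    · simp
    · exact fun a _ ha => Finset.sum_eq_zero fun b _ => component_of_ne _ (Or.inl ha.symm)
    · simp
  rw [hf]
  refine hsum _ _ fun a => hsum _ _ fun b => ?_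
  generalize f a b = h
  induction h using Finsupp.induction_linear with
  | zero =>
    have h0 : component a b (0 : Quiver.Path a b →₀ K) = 0 := by
      simp only [component, Pi.single_zero]
      rfl
    rw [h0]
    exact zero
  | add h₁ h₂ ih₁ ih₂ =>
    have h0 : component a b (h₁ + h₂) = component a b h₁ + component a b h₂ := by
      simp only [component, Pi.single_add]
      rfl
    rw [h0]
    exact add _ _ ih₁ ih₂
  | single r s =>
    have h0 : component a b (Finsupp.single r s) = s • ofPath r := by
      refine PathAlgebra.ext fun u w => ?_
      rw [smul_apply]
      change _ = s • component a b (Finsupp.single r 1) u w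
      by_cases h : u ≠ a ∨ w ≠ b
      · rw [component_of_ne _ h, component_of_ne _ h, smul_zero]
      · push Not at h
        obtain ⟨rfl, rfl⟩ := h
        rw [component_self, component_self, Finsupp.smul_single, smul_eq_mul, mul_one]
    rw [h0]
    exact path s a b r

end PathAlgebra

namespace CyclicAlg

/-! ### Monomials of the algebra -/

theorem par_add (i j : ZMod 4) : par (i + j) = par i + par j := map_add _ i j

theorem par_one : par 1 = 1 := map_one _

theorem par_add_one (i : ZMod 4) : par (i + 1) = par i + 1 := by rw [par_add, par_one]

theorem par_add_two (i : ZMod 4) : par (i + 2) = par i := by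
  revert i; decide

theorem add_one_add_one (l : ZMod 2) : l + 1 + 1 = l := by
  revert l; decide

theorem eq_or_eq_add_one (l l' : ZMod 2) : l' = l ∨ l' = l + 1 := by
  revert l l'; decide

theorem eq_add_one_of_ne {l l' : ZMod 2} (h : l ≠ l') : l' = l + 1 := by
  revert l l'; decide

theorem add_one_ne (l : ZMod 2) : l + 1 ≠ l := by
  revert l; decide

theorem cast_four_mul (t : ℕ) : ((4 * t : ℕ) : ZMod 4) = 0 := by
  have h4 : (4 : ZMod 4) = 0 := by decide
  push_cast
  rw [h4, zero_mul]

variable {K : Type u} [Field K]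

theorem vertex_mul_vertex (i k : ZMod 4) :
    vertex K i * vertex K k = if i = k then vertex K i else 0 := by
  split_ifs with h
  · subst h
    simp [vertex, PathAlgebra.ofPath_mul_ofPath]
  · exact PathAlgebra.ofPath_mul_ofPath_of_ne _ _ h

theorem sum_vertex : ∑ i, vertex K i = 1 := by
  refine PathAlgebra.ext fun u w => ?_
  rw [PathAlgebra.sum_apply, Finset.sum_eq_single u]
  · simp [vertex, PathAlgebra.ofPath, PathAlgebra.one_apply]
  · intro b _ hb
    simp [vertex, PathAlgebra.ofPath, Pi.single_eq_of_ne hb.symm]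
  · simp

variable (T : ℕ) (q : ZMod 4 → K)

theorem e_mul_e (i k : ZMod 4) : e T q i * e T q k = if i = k then e T q i else 0 := by
  rw [e, e, ← map_mul, vertex_mul_vertex]
  split_ifs <;> simp

theorem sum_e : ∑ i, e T q i = 1 := by
  simp only [e, ← map_sum, sum_vertex, map_one]

theorem proj_eq_zero_of_mem {f : KΓ K} (h : f ∈ relations T q) : proj T q f = 0 :=
  Ideal.Quotient.eq_zero_iff_mem.mpr
    (TwoSidedIdeal.mem_asIdeal.mpr (TwoSidedIdeal.subset_span h))

theorem proj_surjective : Function.Surjective (proj T q) := Ideal.Quotient.mk_surjective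

theorem x_mul_x (l : ZMod 2) : x T q l * x T q (l + 1) = 0 := by
  rw [x, x, ← map_mul]
  exact proj_eq_zero_of_mem T q (Or.inl ⟨l, rfl⟩)

theorem x_pow_mul_x_pow {l l' : ZMod 2} (h : l ≠ l') {s t : ℕ} (hs : s ≠ 0) (ht : t ≠ 0) :
    x T q l ^ s * x T q l' ^ t = 0 := by
  obtain ⟨s, rfl⟩ := Nat.exists_eq_succ_of_ne_zero hs
  obtain ⟨t, rfl⟩ := Nat.exists_eq_succ_of_ne_zero ht
  rw [eq_add_one_of_ne h, pow_succ, pow_succ', mul_assoc, ← mul_assoc (x T q l), x_mul_x,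
    zero_mul, mul_zero]

theorem e_mul_socle (i : ZMod 4) :
    e T q i * x T q (par i + 1) ^ (4 * T + 2) =
      -(q i • (e T q i * x T q (par i) ^ (4 * T + 2))) := by
  have h := proj_eq_zero_of_mem T q (Or.inr ⟨i, rfl⟩)
  rw [map_mul, map_add, map_smul, map_pow, map_pow, mul_add, mul_smul_comm, par_add_one] at h
  exact eq_neg_of_add_eq_zero_right h

theorem e_mul_socle' (hq : ∀ i, q i ≠ 0) (i : ZMod 4) :
    e T q i * x T q (par i) ^ (4 * T + 2) =
      -((q i)⁻¹ • (e T q i * x T q (par i + 1) ^ (4 * T + 2))) := by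
  rw [e_mul_socle, smul_neg, neg_neg, smul_smul, inv_mul_cancel₀ (hq i), one_smul]

theorem e_mul_socle_swap (i : ZMod 4) :
    q i • (e T q i * x T q (par i) ^ (4 * T + 2)) +
      e T q i * x T q (par i + 1) ^ (4 * T + 2) = 0 := by
  rw [e_mul_socle, add_neg_cancel]

/-- At each vertex, `x_l^{4T+2}` is a multiple of the same power of the other letter, and one more
factor `x_l` kills that power. -/
theorem x_pow_eq_zero (hq : ∀ i, q i ≠ 0) (l : ZMod 2) {t : ℕ} (ht : 4 * T + 3 ≤ t) :
    x T q l ^ t = 0 := by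
  have h : x T q l ^ (4 * T + 3) = 0 := by
    rw [← one_mul (x T q l ^ (4 * T + 3)), ← sum_e T q, Finset.sum_mul]
    refine Finset.sum_eq_zero fun i _ => ?_
    have key : ∀ k, e T q k * x T q l ^ (4 * T + 2) =
        if par k = l then -((q k)⁻¹ • (e T q k * x T q (l + 1) ^ (4 * T + 2)))
        else -(q k • (e T q k * x T q (l + 1) ^ (4 * T + 2))) := by
      intro k
      split_ifs with hk
      · subst hk
        exact e_mul_socle' T q hq k
      · have hl : l = par k + 1 := eq_add_one_of_ne hk
        rw [hl, add_one_add_one]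
        exact e_mul_socle T q k
    have h0 : x T q (l + 1) ^ (4 * T + 2) * x T q l = 0 := by
      simpa using
        x_pow_mul_x_pow T q (add_one_ne l) (s := 4 * T + 2) (t := 1) (by omega) one_ne_zero
    rw [pow_succ, ← mul_assoc, key]
    split_ifs <;>
      rw [neg_mul, smul_mul_assoc, mul_assoc, h0, mul_zero, smul_zero, neg_zero]
  rw [← Nat.add_sub_cancel' ht, pow_add, h, zero_mul]

theorem ofPath_mul_xPath {a b : ZMod 4} (r : Quiver.Path a b) (l : ZMod 2) :
    (PathAlgebra.ofPath r * xPath K l : KΓ K) = PathAlgebra.ofPath (r.cons (Arrow.a l b)) := by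
  have h1 : (PathAlgebra.ofPath r : KΓ K) = PathAlgebra.ofPath r * vertex K b := by
    simp [vertex, PathAlgebra.ofPath_mul_ofPath]
  rw [h1, mul_assoc, vertex_mul_xPath, arrow, PathAlgebra.ofPath_mul_ofPath]
  rfl

/-- Appending an arrow either prolongs a power of the same letter or changes the letter; in the
second case the product is zero and the scalar `0` absorbs it. -/
theorem exists_proj_ofPath {a b : ZMod 4} (r : Quiver.Path a b) :
    ∃ (c : K) (l : ZMod 2) (t : ℕ),
      proj T q (PathAlgebra.ofPath r) = c • (e T q a * x T q l ^ t) := by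
  induction r with
  | nil => exact ⟨1, 0, 0, by simp [e, vertex]⟩
  | @cons b' c' r f ih =>
    obtain ⟨c, l, t, h⟩ := ih
    obtain ⟨l', m⟩ := f
    rw [← ofPath_mul_xPath, map_mul, h]
    change ∃ c' l'' t', c • (e T q a * x T q l ^ t) * x T q l' = _
    rcases Nat.eq_zero_or_pos t with rfl | ht
    · exact ⟨c, l', 1, by simp⟩
    · by_cases hl : l = l'
      · subst hl
        exact ⟨c, l, t + 1, by rw [smul_mul_assoc, mul_assoc, pow_succ]⟩
      · refine ⟨0, 0, 0, ?_⟩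
        have := x_pow_mul_x_pow T q hl (s := t) (t := 1) (by omega) one_ne_zero
        rw [pow_one] at this
        rw [smul_mul_assoc, mul_assoc, this, mul_zero, smul_zero, zero_smul]

/-- `A` is spanned by the elements `e_k x_l^t`. -/
theorem Alg.induction {motive : Alg T q → Prop} (a : Alg T q) (zero : motive 0)
    (add : ∀ a b, motive a → motive b → motive (a + b))
    (mono : ∀ (c : K) (k : ZMod 4) (l : ZMod 2) (t : ℕ), motive (c • (e T q k * x T q l ^ t))) :
    motive a := by
  obtain ⟨f, rfl⟩ := proj_surjective T q a
  induction f using PathAlgebra.induction_ofPath with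
  | zero => simpa using zero
  | add f g hf hg => rw [map_add]; exact add _ _ hf hg
  | path c a b r =>
    obtain ⟨c', l, t, h⟩ := exists_proj_ofPath T q r
    rw [map_smul, h, smul_smul]
    exact mono _ _ _ _

end CyclicAlg

namespace CyclicAlg

/-! ### Coordinates on the algebra -/

open Polynomial

variable {K : Type u} [Field K]

/-- The weight of an arrow `a_{l',m}` for the letter `l`: `X` if `l' = l`, and `0` otherwise. -/
def arrowWeight (K : Type u) [Field K] (l : ZMod 2) {a b : ZMod 4} : Arrow a b → K[X]
  | .a l' _ => if l' = l then X else 0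

/-- The weight of a path for the letter `l`: `X ^ t` for a path of length `t` all of whose arrows
carry the letter `l`, and `0` for all other paths. -/
def pathWeight (K : Type u) [Field K] (l : ZMod 2) {a : ZMod 4} :
    {b : ZMod 4} → Quiver.Path a b → K[X]
  | _, .nil => 1
  | _, .cons r f => pathWeight K l r * arrowWeight K l f

theorem pathWeight_comp (l : ZMod 2) {a b c : ZMod 4} (r : Quiver.Path a b)
    (s : Quiver.Path b c) : pathWeight K l (r.comp s) = pathWeight K l r * pathWeight K l s := by
  induction s with
  | nil => simp [pathWeight]
  | cons s f ih => simp [pathWeight, ih, mul_assoc]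

/-- The representation of `KΓ` by matrices of polynomials that only sees the letter `l`. -/
def letterMatrix (l : ZMod 2) : KΓ K →ₗ[K] Matrix (ZMod 4) (ZMod 4) K[X] where
  toFun f := Matrix.of fun a b => Finsupp.linearCombination K (pathWeight K l) (f a b)
  map_add' f g := by
    ext1 a b
    simp [PathAlgebra.add_apply]
  map_smul' c f := by
    ext1 a b
    simp [PathAlgebra.smul_apply]

theorem letterMatrix_apply (l : ZMod 2) (f : KΓ K) (a b : ZMod 4) :
    letterMatrix l f a b = Finsupp.linearCombination K (pathWeight K l) (f a b) := rfl

theorem letterMatrix_mul (l : ZMod 2) (f g : KΓ K) :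
    letterMatrix l (f * g) = letterMatrix l f * letterMatrix l g := by
  ext1 a c
  rw [Matrix.mul_apply, letterMatrix_apply, PathAlgebra.mul_apply, map_sum]
  refine Finset.sum_congr rfl fun b _ => ?_
  rw [letterMatrix_apply, letterMatrix_apply]
  generalize f a b = f'
  generalize g b c = g'
  induction f' using Finsupp.induction_linear with
  | zero => simp
  | add f₁ f₂ h₁ h₂ => simp [h₁, h₂, add_mul]
  | single r s =>
    induction g' using Finsupp.induction_linear with
    | zero => simp
    | add f₁ f₂ h₁ h₂ => simp [h₁, h₂, mul_add]
    | single r' s' =>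
      simp only [PathAlgebra.comp_single, Finsupp.linearCombination_single, pathWeight_comp,
        smul_mul_smul_comm]

theorem letterMatrix_ofPath (l : ZMod 2) {a b : ZMod 4} (r : Quiver.Path a b) :
    letterMatrix l (PathAlgebra.ofPath r : KΓ K) = Matrix.single a b (pathWeight K l r) := by
  ext1 u w
  rw [letterMatrix_apply]
  change Finsupp.linearCombination K _ (PathAlgebra.component a b (Finsupp.single r 1) u w) = _
  by_cases h : u ≠ a ∨ w ≠ b
  · rw [PathAlgebra.component_of_ne _ h, map_zero, Matrix.single_apply, if_neg]
    rintro ⟨rfl, rfl⟩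
    simp at h
  · push Not at h
    obtain ⟨rfl, rfl⟩ := h
    rw [PathAlgebra.component_self, Finsupp.linearCombination_single, one_smul,
      Matrix.single_apply_same]

theorem letterMatrix_arrow (l l' : ZMod 2) (m : ZMod 4) :
    letterMatrix l (arrow K l' m) = Matrix.single m (m + 1) (if l' = l then X else 0) := by
  rw [arrow, letterMatrix_ofPath]
  congr 1
  exact one_mul _

theorem letterMatrix_vertex_mul_pow (l l' : ZMod 2) (k : ZMod 4) (t : ℕ) :
    letterMatrix l (vertex K k * xPath K l' ^ t) =
      Matrix.single k (k + t) (if t = 0 ∨ l' = l then X ^ t else 0) := by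
  induction t with
  | zero =>
    rw [pow_zero, mul_one, vertex, letterMatrix_ofPath, if_pos (Or.inl rfl)]
    simp [pathWeight]
  | succ t ih =>
    rw [pow_succ, ← mul_assoc, letterMatrix_mul, ih, xPath, map_sum, Finset.mul_sum,
      Finset.sum_eq_single (k + (t : ZMod 4))]
    · rw [letterMatrix_arrow, Matrix.single_mul_single_same]
      push_cast
      rw [add_assoc]
      congr 1
      by_cases h : l' = l
      · simp [h, pow_succ]
      · simp [h]
    · intro m _ hm
      rw [letterMatrix_arrow]
      exact Matrix.single_mul_single_of_ne _ _ _ _ (Ne.symm hm) _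
    · simp

theorem coeff_zero_pathWeight_of_ne (l : ZMod 2) {a b : ZMod 4} (h : a ≠ b)
    (r : Quiver.Path a b) : (pathWeight K l r).coeff 0 = 0 := by
  cases r with
  | nil => exact absurd rfl h
  | cons r f =>
    obtain ⟨l', m⟩ := f
    simp only [pathWeight, arrowWeight, mul_coeff_zero]
    split_ifs <;> simp

theorem coeff_zero_pathWeight (l l' : ZMod 2) {a b : ZMod 4} (r : Quiver.Path a b) :
    (pathWeight K l r).coeff 0 = (pathWeight K l' r).coeff 0 := by
  cases r with
  | nil => rfl
  | cons r f =>
    obtain ⟨l', m⟩ := f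
    simp only [pathWeight, arrowWeight, mul_coeff_zero]
    split_ifs <;> simp

theorem coeff_zero_letterMatrix_of_ne (l : ZMod 2) {a b : ZMod 4} (h : a ≠ b) (f : KΓ K) :
    (letterMatrix l f a b).coeff 0 = 0 := by
  rw [letterMatrix_apply]
  generalize f a b = f'
  induction f' using Finsupp.induction_linear with
  | zero => simp
  | add f₁ f₂ h₁ h₂ => simp [h₁, h₂]
  | single r s => simp [coeff_zero_pathWeight_of_ne l h]

/-- Constant terms only see trivial paths, which carry no letter. This makes the socle coordinate,
which mixes both letters, compatible with multiplication. -/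
theorem coeff_zero_letterMatrix (l l' : ZMod 2) (a b : ZMod 4) (f : KΓ K) :
    (letterMatrix l f a b).coeff 0 = (letterMatrix l' f a b).coeff 0 := by
  rw [letterMatrix_apply, letterMatrix_apply]
  generalize f a b = f'
  induction f' using Finsupp.induction_linear with
  | zero => simp
  | add f₁ f₂ h₁ h₂ => simp [h₁, h₂]
  | single r s => simp [coeff_zero_pathWeight l l']

variable (T : ℕ) (q : ZMod 4 → K)

/-- The coefficient of `e_a x_a^{4T+2} e_b`, once `e_a x_{a+1}^{4T+2}` is written as
`-q_a e_a x_a^{4T+2}`. -/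
def socleEntry (a b : ZMod 4) : KΓ K →ₗ[K] K where
  toFun f := (letterMatrix (par a) f a b).coeff (4 * T + 2)
    - q a * (letterMatrix (par a + 1) f a b).coeff (4 * T + 2)
  map_add' f g := by simp; ring
  map_smul' c f := by simp; ring

theorem socleEntry_apply (a b : ZMod 4) (f : KΓ K) :
    socleEntry T q a b f = (letterMatrix (par a) f a b).coeff (4 * T + 2)
      - q a * (letterMatrix (par a + 1) f a b).coeff (4 * T + 2) := rfl

theorem coeff_letterMatrix_mul (l : ZMod 2) (f g : KΓ K) (a b : ZMod 4) (t : ℕ) :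
    (letterMatrix l (f * g) a b).coeff t = ∑ c, ∑ s ∈ Finset.HasAntidiagonal.antidiagonal t,
      (letterMatrix l f a c).coeff s.1 * (letterMatrix l g c b).coeff s.2 := by
  rw [letterMatrix_mul, Matrix.mul_apply, finsetSum_coeff]
  simp only [coeff_mul]

/-- The vanishing of all coordinates describes a two-sided ideal of `KΓ`. -/
def coordIdeal : TwoSidedIdeal (KΓ K) :=
  TwoSidedIdeal.mk'
    {f | (∀ l a b, ∀ t < 4 * T + 2, (letterMatrix l f a b).coeff t = 0) ∧
      ∀ a b, socleEntry T q a b f = 0}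
    ⟨by simp, by simp⟩
    (by
      rintro f g ⟨hf, hf'⟩ ⟨hg, hg'⟩
      exact ⟨fun l a b t ht => by simp [hf l a b t ht, hg l a b t ht],
        fun a b => by rw [map_add, hf', hg', add_zero]⟩)
    (by
      rintro f ⟨hf, hf'⟩
      exact ⟨fun l a b t ht => by simp [hf l a b t ht], fun a b => by rw [map_neg, hf', neg_zero]⟩)
    (by
      rintro g f ⟨hf, hf'⟩
      refine ⟨fun l a b t ht => ?_, fun a b => ?_⟩
      · rw [coeff_letterMatrix_mul]
        refine Finset.sum_eq_zero fun c _ => Finset.sum_eq_zero fun s hs => ?_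
        have hs' := Finset.HasAntidiagonal.mem_antidiagonal.mp hs
        rw [hf l c b s.2 (by omega), mul_zero]
      -- All coefficients of `f` below degree `4T+2` vanish, so in this degree only the constant
      -- term of `g` contributes. That term is diagonal and independent of `l`, so both halves of
      -- the socle coordinate are scaled by the same factor.
      · have key : ∀ l, (letterMatrix l (g * f) a b).coeff (4 * T + 2) =
            (letterMatrix 0 g a a).coeff 0 * (letterMatrix l f a b).coeff (4 * T + 2) := by
          intro l
          rw [coeff_letterMatrix_mul, Finset.sum_eq_single a, Finset.sum_eq_single (0, 4 * T + 2),
            coeff_zero_letterMatrix l 0]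
          · intro s hs hne
            have h := Finset.HasAntidiagonal.mem_antidiagonal.mp hs
            rw [hf l a b s.2, mul_zero]
            by_contra h'
            exact hne (Prod.ext (by simp; omega) (by simp; omega))
          · simp
          · intro c _ hc
            refine Finset.sum_eq_zero fun s hs => ?_
            have h := Finset.HasAntidiagonal.mem_antidiagonal.mp hs
            rcases Nat.eq_zero_or_pos s.1 with h0 | h0
            · rw [h0, coeff_zero_letterMatrix_of_ne l hc.symm, zero_mul]
            · rw [hf l c b s.2 (by omega), mul_zero]
          · simp
        have h := hf' a b
        rw [socleEntry_apply] at h ⊢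
        rw [key, key]
        linear_combination (letterMatrix 0 g a a).coeff 0 * h)
    (by
      rintro f g ⟨hf, hf'⟩
      refine ⟨fun l a b t ht => ?_, fun a b => ?_⟩
      · rw [coeff_letterMatrix_mul]
        refine Finset.sum_eq_zero fun c _ => Finset.sum_eq_zero fun s hs => ?_
        have hs' := Finset.HasAntidiagonal.mem_antidiagonal.mp hs
        rw [hf l a c s.1 (by omega), zero_mul]
      -- The mirror image: the constant term of `g` at the vertex `b` is the common factor.
      · have key : ∀ l, (letterMatrix l (f * g) a b).coeff (4 * T + 2) =
            (letterMatrix l f a b).coeff (4 * T + 2) * (letterMatrix 0 g b b).coeff 0 := by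
          intro l
          rw [coeff_letterMatrix_mul, Finset.sum_eq_single b, Finset.sum_eq_single (4 * T + 2, 0),
            coeff_zero_letterMatrix l 0]
          · intro s hs hne
            have h := Finset.HasAntidiagonal.mem_antidiagonal.mp hs
            rw [hf l a b s.1, zero_mul]
            by_contra h'
            exact hne (Prod.ext (by simp; omega) (by simp; omega))
          · simp
          · intro c _ hc
            refine Finset.sum_eq_zero fun s hs => ?_
            have h := Finset.HasAntidiagonal.mem_antidiagonal.mp hs
            rcases Nat.eq_zero_or_pos s.2 with h0 | h0
            · rw [h0, coeff_zero_letterMatrix_of_ne l hc, mul_zero]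
            · rw [hf l a c s.1 (by omega), zero_mul]
          · simp
        have h := hf' a b
        rw [socleEntry_apply] at h ⊢
        rw [key, key]
        linear_combination (letterMatrix 0 g b b).coeff 0 * h)

theorem mem_coordIdeal {f : KΓ K} : f ∈ coordIdeal T q ↔
    (∀ l a b, ∀ t < 4 * T + 2, (letterMatrix l f a b).coeff t = 0) ∧
      ∀ a b, socleEntry T q a b f = 0 := by
  rw [coordIdeal, TwoSidedIdeal.mem_mk']
  rfl

theorem coeff_letterMatrix_vertex_mul_pow (l l' : ZMod 2) (k a b : ZMod 4) (s t : ℕ) :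
    (letterMatrix l (vertex K k * xPath K l' ^ t) a b).coeff s =
      if a = k ∧ b = k + t ∧ s = t ∧ (t = 0 ∨ l' = l) then 1 else 0 := by
  rw [letterMatrix_vertex_mul_pow, Matrix.single_apply]
  by_cases h : k = a ∧ k + (t : ZMod 4) = b
  · obtain ⟨rfl, rfl⟩ := h
    by_cases h' : t = 0 ∨ l' = l
    · simp [h', coeff_X_pow]
    · simp [h']
  · rw [if_neg h, coeff_zero, if_neg]
    rintro ⟨rfl, rfl, -, -⟩
    exact h ⟨rfl, rfl⟩

/-- Each letter representation kills one factor of `x_l x_{l+1}`. The other relation lives in degree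
`4T+2` only, with coefficient `q_i` for the letter of `i` and `1` for the other letter, and the
socle coordinate is the combination that cancels these. -/
theorem relIdeal_le_coordIdeal : relIdeal T q ≤ coordIdeal T q := by
  rw [relIdeal, TwoSidedIdeal.span_le]
  rintro f (⟨l, rfl⟩ | ⟨i, rfl⟩)
  · have h : ∀ l', letterMatrix l' (xPath K l * xPath K (l + 1)) = 0 := by
      intro l'
      rw [letterMatrix_mul]
      have h0 : ∀ m, m ≠ l' → letterMatrix l' (xPath K m) = 0 := by
        intro m hm
        rw [xPath, map_sum]
        refine Finset.sum_eq_zero fun a _ => ?_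
        rw [letterMatrix_arrow, if_neg hm, Matrix.single_zero]
      by_cases hl : l = l'
      · rw [h0 (l + 1) (by subst hl; exact add_one_ne l), mul_zero]
      · rw [h0 l hl, zero_mul]
    refine (mem_coordIdeal T q).mpr ⟨fun l' a b t _ => ?_, fun a b => ?_⟩
    · simp [h]
    · simp [socleEntry_apply, h]
  · refine (mem_coordIdeal T q).mpr ⟨fun l' a b t ht => ?_, fun a b => ?_⟩ <;> beta_reduce
    · rw [mul_add, mul_smul_comm, map_add, map_smul, Matrix.add_apply, Matrix.smul_apply,
        coeff_add, coeff_smul, coeff_letterMatrix_vertex_mul_pow,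
        coeff_letterMatrix_vertex_mul_pow, if_neg (by omega), if_neg (by omega)]
      simp
    · rw [mul_add, mul_smul_comm, map_add, map_smul, socleEntry_apply, socleEntry_apply]
      simp only [coeff_letterMatrix_vertex_mul_pow, par_add_one]
      by_cases h : a = i ∧ b = i + ((4 * T + 2 : ℕ) : ZMod 4)
      · obtain ⟨rfl, rfl⟩ := h
        simp [(add_one_ne _).symm]
      · rw [if_neg (fun h' => h ⟨h'.1, h'.2.1⟩), if_neg (fun h' => h ⟨h'.1, h'.2.1⟩),
          if_neg (fun h' => h ⟨h'.1, h'.2.1⟩), if_neg (fun h' => h ⟨h'.1, h'.2.1⟩)]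
        simp

end CyclicAlg

namespace CyclicAlg

/-! ### Stripping letters -/

variable {K : Type u} [Field K] (T : ℕ) (q : ZMod 4 → K)

/-- A linear map on `KΓ` that vanishes on the relations descends to `A`. -/
theorem exists_descend {M : Type*} [AddCommGroup M] [Module K M] (F : KΓ K →ₗ[K] M)
    (hF : ∀ f ∈ coordIdeal T q, F f = 0) :
    ∃ G : Alg T q →ₗ[K] M, ∀ f, G (proj T q f) = F f := by
  -- Any linear section serves: two lifts of one element differ by a member of the ideal, on which
  -- `F` vanishes.
  obtain ⟨σ, hσ⟩ := (proj T q).toLinearMap.exists_rightInverse_of_surjective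
    (LinearMap.range_eq_top.mpr (proj_surjective T q))
  refine ⟨F ∘ₗ σ, fun f => ?_⟩
  have h1 : proj T q (σ (proj T q f)) = proj T q f := LinearMap.congr_fun hσ (proj T q f)
  have h2 : σ (proj T q f) - f ∈ relIdeal T q := by
    refine TwoSidedIdeal.mem_asIdeal.mp (Ideal.Quotient.eq_zero_iff_mem.mp ?_)
    change proj T q (σ (proj T q f) - f) = 0
    rw [map_sub, h1, sub_self]
  have h3 := hF _ (relIdeal_le_coordIdeal T q h2)
  rw [map_sub, sub_eq_zero] at h3
  exact h3

/-- The coefficient of `e_a x_l^t` in elements of `KΓ`. -/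
def pathCoeff (l : ZMod 2) (a : ZMod 4) (t : ℕ) : KΓ K →ₗ[K] K :=
  ∑ b, (Polynomial.lcoeff K t) ∘ₗ (LinearMap.proj b ∘ₗ LinearMap.proj a ∘ₗ
    (letterMatrix l : KΓ K →ₗ[K] ZMod 4 → ZMod 4 → Polynomial K))

theorem pathCoeff_apply (l : ZMod 2) (a : ZMod 4) (t : ℕ) (f : KΓ K) :
    pathCoeff l a t f = ∑ b, (letterMatrix l f a b).coeff t := by
  rw [pathCoeff, LinearMap.sum_apply]
  rfl

theorem pathCoeff_vertex_mul_pow (l l' : ZMod 2) (k a : ZMod 4) (s t : ℕ) :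
    pathCoeff l a s (vertex K k * xPath K l' ^ t) =
      if a = k ∧ s = t ∧ (t = 0 ∨ l' = l) then 1 else 0 := by
  rw [pathCoeff_apply]
  simp only [coeff_letterMatrix_vertex_mul_pow]
  by_cases h : a = k ∧ s = t ∧ (t = 0 ∨ l' = l)
  · simp [h]
  · rw [if_neg h]
    refine Finset.sum_eq_zero fun b _ => if_neg fun h' => h ⟨h'.1, h'.2.2⟩

theorem exists_coeff {l : ZMod 2} {a : ZMod 4} {t : ℕ} (ht : t < 4 * T + 2) :
    ∃ G : Alg T q →ₗ[K] K, ∀ f, G (proj T q f) = pathCoeff l a t f :=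
  exists_descend T q _ fun f hf => by
    rw [pathCoeff_apply]
    exact Finset.sum_eq_zero fun b _ => ((mem_coordIdeal T q).mp hf).1 l a b t ht

theorem exists_socleCoeff (a : ZMod 4) :
    ∃ G : Alg T q →ₗ[K] K, ∀ f, G (proj T q f) = (∑ b, socleEntry T q a b) f :=
  exists_descend T q _ fun f hf => by
    rw [LinearMap.sum_apply]
    exact Finset.sum_eq_zero fun b _ => ((mem_coordIdeal T q).mp hf).2 a b

/-- The coefficient of `e_a x_l^t` in elements of `A`, for `t ≤ 4T+1`. -/
def coeff (l : ZMod 2) (a : ZMod 4) (t : ℕ) : Alg T q →ₗ[K] K :=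
  if ht : t < 4 * T + 2 then (exists_coeff T q (l := l) (a := a) ht).choose else 0

/-- The coefficient of `e_a x_a^{4T+2}` in elements of `A`. -/
def socleCoeff (a : ZMod 4) : Alg T q →ₗ[K] K := (exists_socleCoeff T q a).choose

theorem e_mul_x_pow_eq_proj (k : ZMod 4) (l : ZMod 2) (t : ℕ) :
    e T q k * x T q l ^ t = proj T q (vertex K k * xPath K l ^ t) := by
  rw [map_mul, map_pow]
  rfl

theorem coeff_mono (l l' : ZMod 2) (k a : ZMod 4) {s : ℕ} (hs : s < 4 * T + 2) (t : ℕ) :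
    coeff T q l a s (e T q k * x T q l' ^ t) =
      if a = k ∧ s = t ∧ (t = 0 ∨ l' = l) then 1 else 0 := by
  rw [e_mul_x_pow_eq_proj, coeff, dif_pos hs, (exists_coeff T q hs).choose_spec,
    pathCoeff_vertex_mul_pow]

theorem socleCoeff_mono_of_ne (l : ZMod 2) (k a : ZMod 4) {t : ℕ} (ht : t ≠ 4 * T + 2) :
    socleCoeff T q a (e T q k * x T q l ^ t) = 0 := by
  rw [e_mul_x_pow_eq_proj, socleCoeff, (exists_socleCoeff T q a).choose_spec,
    LinearMap.sum_apply]
  refine Finset.sum_eq_zero fun b _ => ?_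
  rw [socleEntry_apply, coeff_letterMatrix_vertex_mul_pow, coeff_letterMatrix_vertex_mul_pow,
    if_neg fun h => ht h.2.2.1.symm, if_neg fun h => ht h.2.2.1.symm]
  simp

theorem socleCoeff_mono (k a : ZMod 4) :
    socleCoeff T q a (e T q k * x T q (par k) ^ (4 * T + 2)) = if a = k then 1 else 0 := by
  rw [e_mul_x_pow_eq_proj, socleCoeff, (exists_socleCoeff T q a).choose_spec,
    LinearMap.sum_apply]
  simp only [socleEntry_apply, coeff_letterMatrix_vertex_mul_pow]
  split_ifs with h
  · subst h
    simp [(add_one_ne _).symm]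
  · simp [h]

/-- The linear map that strips the first letter `l`: `e_k x_l^t ↦ e_{k+1} x_l^{t-1}` for
`1 ≤ t ≤ 4T+1`, with the factor `θ` for `t = 4T+2`; all other monomials go to `0`. -/
def strip (l : ZMod 2) (θ : K) : Alg T q →ₗ[K] Alg T q :=
  (∑ a, ∑ t ∈ Finset.range (4 * T + 1),
      (coeff T q l a (t + 1)).smulRight (e T q (a + 1) * x T q l ^ t)) +
    θ • ∑ a, (if par a = l then 1 else -(q a)⁻¹ : K) •
      (socleCoeff T q a).smulRight (e T q (a + 1) * x T q l ^ (4 * T + 1))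

theorem strip_apply (l : ZMod 2) (θ : K) (v : Alg T q) : strip T q l θ v =
    (∑ a, ∑ t ∈ Finset.range (4 * T + 1),
      coeff T q l a (t + 1) v • (e T q (a + 1) * x T q l ^ t)) +
    θ • ∑ a, (if par a = l then 1 else -(q a)⁻¹ : K) •
      (socleCoeff T q a v • (e T q (a + 1) * x T q l ^ (4 * T + 1))) := by
  simp only [strip, LinearMap.add_apply, LinearMap.smul_apply, LinearMap.sum_apply,
    LinearMap.smulRight_apply]

theorem strip_mono_of_le (l l' : ZMod 2) (θ : K) (k : ZMod 4) {t : ℕ} (ht : t < 4 * T + 2) :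
    strip T q l θ (e T q k * x T q l' ^ t) =
      if t ≠ 0 ∧ l' = l then e T q (k + 1) * x T q l ^ (t - 1) else 0 := by
  have h1 : ∀ a, socleCoeff T q a (e T q k * x T q l' ^ t) = 0 := fun a =>
    socleCoeff_mono_of_ne T q l' k a (by omega)
  have h2 : ∀ a, ∀ s ∈ Finset.range (4 * T + 1), coeff T q l a (s + 1) (e T q k * x T q l' ^ t) =
      if a = k ∧ s + 1 = t ∧ (t = 0 ∨ l' = l) then 1 else 0 := fun a s hs =>
    coeff_mono T q l l' k a (by have := Finset.mem_range.mp hs; omega) t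
  rw [strip_apply]
  simp only [h1, zero_smul, smul_zero, Finset.sum_const_zero, add_zero]
  rw [Finset.sum_congr rfl fun a _ => Finset.sum_congr rfl fun s hs => by rw [h2 a s hs]]
  split_ifs with h
  · obtain ⟨h0, rfl⟩ := h
    rw [Finset.sum_eq_single k, Finset.sum_eq_single (t - 1)]
    · rw [if_pos ⟨rfl, by omega, Or.inr rfl⟩, one_smul]
    · intro s _ hs
      rw [if_neg (by rintro ⟨-, h, -⟩; omega), zero_smul]
    · intro hs
      exact absurd (Finset.mem_range.mpr (by omega)) hs
    · intro a _ ha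
      exact Finset.sum_eq_zero fun s _ => by rw [if_neg (fun h => ha h.1), zero_smul]
    · simp
  · refine Finset.sum_eq_zero fun a _ => Finset.sum_eq_zero fun s _ => ?_
    rw [if_neg, zero_smul]
    rintro ⟨-, rfl, h'⟩
    exact h ⟨by omega, h'.resolve_left (by omega)⟩

theorem strip_socle_par (l : ZMod 2) (θ : K) (k : ZMod 4) :
    strip T q l θ (e T q k * x T q (par k) ^ (4 * T + 2)) =
      (if par k = l then θ else -(θ * (q k)⁻¹)) • (e T q (k + 1) * x T q l ^ (4 * T + 1)) := by
  have h2 : ∀ a, ∀ s ∈ Finset.range (4 * T + 1),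
      coeff T q l a (s + 1) (e T q k * x T q (par k) ^ (4 * T + 2)) = 0 := fun a s hs => by
    have := Finset.mem_range.mp hs
    rw [coeff_mono T q l (par k) k a (by omega), if_neg (by rintro ⟨-, h, -⟩; omega)]
  rw [strip_apply, Finset.sum_eq_zero fun a _ => Finset.sum_eq_zero fun s hs => by
    rw [h2 a s hs, zero_smul], zero_add, Finset.sum_eq_single k]
  · rw [socleCoeff_mono, if_pos rfl, one_smul, smul_smul]
    congr 1
    split_ifs <;> ring
  · intro a _ ha
    rw [socleCoeff_mono, if_neg ha, zero_smul, smul_zero]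
  · simp

/-- The socle coordinate refers to the letter of the vertex. The weight `-(q a)⁻¹` in `strip`
converts it to the other letter, so that stripping has the same form for both. -/
theorem strip_socle (hq : ∀ i, q i ≠ 0) (l : ZMod 2) (θ : K) (k : ZMod 4) :
    strip T q l θ (e T q k * x T q l ^ (4 * T + 2)) =
      θ • (e T q (k + 1) * x T q l ^ (4 * T + 1)) := by
  by_cases h : par k = l
  · subst h
    rw [strip_socle_par, if_pos rfl]
  · have hl : l = par k + 1 := eq_add_one_of_ne h
    have := e_mul_socle T q k
    rw [← hl] at this
    rw [this, map_neg, map_smul, strip_socle_par, if_neg h, smul_smul, ← neg_smul]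
    congr 1
    field_simp [hq k]

theorem strip_zero_socle (l l' : ZMod 2) (k : ZMod 4) :
    strip T q l 0 (e T q k * x T q l' ^ (4 * T + 2)) = 0 := by
  have h0 : strip T q l 0 (e T q k * x T q (par k) ^ (4 * T + 2)) = 0 := by
    rw [strip_socle_par]
    split_ifs <;> simp
  rcases eq_or_eq_add_one (par k) l' with rfl | rfl
  · exact h0
  · rw [e_mul_socle, map_neg, map_smul, h0, smul_zero, neg_zero]

/-- The sum of the coefficients of the monomials `e_a x_l^{4T+1}`, as a multiple of `1`. -/
def lastCoeff (l : ZMod 2) : Alg T q →ₗ[K] Alg T q :=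
  (∑ a, coeff T q l a (4 * T + 1)).smulRight 1

theorem lastCoeff_mono (l l' : ZMod 2) (k : ZMod 4) (t : ℕ) :
    lastCoeff T q l (e T q k * x T q l' ^ t) =
      if t = 4 * T + 1 ∧ l' = l then 1 else 0 := by
  rw [lastCoeff, LinearMap.smulRight_apply, LinearMap.sum_apply]
  simp only [coeff_mono T q l l' k _ (show 4 * T + 1 < 4 * T + 2 by omega) t]
  split_ifs with h
  · obtain ⟨rfl, rfl⟩ := h
    simp
  · rw [Finset.sum_eq_zero, zero_smul]
    intro a _
    rw [if_neg]
    rintro ⟨-, rfl, h'⟩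
    exact h ⟨rfl, h'.resolve_left (by omega)⟩

end CyclicAlg

namespace CyclicAlg

/-! ### Scalars, bimodule elements and the differential -/

variable {K : Type u} [Field K]

section Scalars

variable (q : ZMod 4 → K)

theorem S_zero (v : ZMod 4) : S q 0 v = 1 := by simp [S]

theorem S_add (u w : ℕ) (v : ZMod 4) : S q (u + w) v = S q u v * S q w (v + u) := by
  rw [S, Finset.prod_range_add, S, S]
  congr 1
  refine Finset.prod_congr rfl fun t _ => ?_
  congr 1
  push_cast
  ring

theorem S_one (v : ZMod 4) : S q 1 v = q v := by simp [S]

theorem S_succ (u : ℕ) (v : ZMod 4) : S q (u + 1) v = S q u v * q (v + u) := by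
  rw [S_add, S_one]

theorem S_succ' (u : ℕ) (v : ZMod 4) : S q (u + 1) v = q v * S q u (v + 1) := by
  rw [add_comm, S_add, S_one, Nat.cast_one]

variable {q} in
theorem S_ne_zero (hq : ∀ i, q i ≠ 0) (u : ℕ) (v : ZMod 4) : S q u v ≠ 0 :=
  Finset.prod_ne_zero_iff.mpr fun _ _ => hq _

theorem add_four (i : ZMod 4) : i + 4 = i := by revert i; decide

-- The product `S_{u,v} S_{u,v+2}` is unchanged when `v` moves by 2, since indices are modulo 4 and
-- the factors only swap. This settles even `m`. For odd `m` the length `u = m+1` is even, and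
-- moving `v` by 1 trades `q_v q_{v+2}` for `q_{v+u} q_{v+u+2}`, the same product. The identity
-- reconciles the scalars of the middle generators.
variable {q} in
theorem S_mul_S_add_two (hq : ∀ i, q i ≠ 0) (m : ℕ) (i : ZMod 4) :
    S q (m + 1) i * S q (m + 1) (i + 2) = S q (m + 1) (i + m) * S q (m + 1) (i + m + 2) := by
  have per : ∀ (m : ℕ) (i : ZMod 4), S q m (i + 2) * S q m (i + 2 + 2) =
      S q m i * S q m (i + 2) := by
    intro m i
    have : i + 2 + 2 = i := by rw [add_assoc]; exact add_four i
    rw [this, mul_comm]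
  have par2 : ∀ (m : ℕ) (i : ZMod 4) (s : ℕ),
      S q m (i + (2 * s : ℕ)) * S q m (i + (2 * s : ℕ) + 2) =
      S q m i * S q m (i + 2) := by
    intro m i s
    induction s with
    | zero => simp
    | succ s ih =>
      have : i + ((2 * (s + 1) : ℕ) : ZMod 4) = i + ((2 * s : ℕ) : ZMod 4) + 2 := by
        push_cast; ring
      rw [this, per, ih]
  rcases Nat.even_or_odd' m with ⟨s, rfl | rfl⟩
  · rw [par2]
  · have h1 : i + ((2 * s + 1 : ℕ) : ZMod 4) = i + 1 + ((2 * s : ℕ) : ZMod 4) := by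
      push_cast; ring
    rw [h1, par2]
    have a1 := S_succ q (2 * s + 1 + 1) i
    have a2 := S_succ q (2 * s + 1 + 1) (i + 2)
    have b1 := S_succ' q (2 * s + 1 + 1) i
    have b2 := S_succ' q (2 * s + 1 + 1) (i + 2)
    -- The shift `2s+2` is even, so the pair of indices `i`, `i+2` is permuted.
    have r : q (i + ((2 * s + 1 + 1 : ℕ) : ZMod 4)) * q (i + 2 + ((2 * s + 1 + 1 : ℕ) : ZMod 4)) =
        q i * q (i + 2) := by
      have h2 := par2 1 i (s + 1)
      simp only [S_one] at h2
      rw [← h2]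
      congr 2
      push_cast
      ring
    have h3 : i + 1 + 2 = i + 2 + 1 := by ring
    rw [h3]
    have e1 : (S q (2 * s + 1 + 1) i * S q (2 * s + 1 + 1) (i + 2)) * (q i * q (i + 2)) =
        (S q (2 * s + 1 + 1) (i + 1) * S q (2 * s + 1 + 1) (i + 2 + 1)) * (q i * q (i + 2)) := by
      rw [← r]
      rw [r]
      calc _ = (S q (2 * s + 1 + 1) i * q (i + ((2 * s + 1 + 1 : ℕ) : ZMod 4))) *
            (S q (2 * s + 1 + 1) (i + 2) * q (i + 2 + ((2 * s + 1 + 1 : ℕ) : ZMod 4))) := by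
            rw [← r]; ring
        _ = (q i * S q (2 * s + 1 + 1) (i + 1)) *
            (q (i + 2) * S q (2 * s + 1 + 1) (i + 2 + 1)) := by
            rw [← a1, ← a2, b1, b2]
        _ = _ := by ring
    exact mul_right_cancel₀ (mul_ne_zero (hq _) (hq _)) e1

end Scalars

variable (T : ℕ) (q : ZMod 4 → K)

/-! ### Calculus of the two-sided action on a bimodule -/

section Act

variable {T q} {M : Type u} [AddCommGroup M] [Module (Env T q) M]

theorem act_def (c : K) (a : Alg T q) (z : M) (b : Alg T q) :
    act T q c a z b = (c • (a ⊗ₜ[K] op b) : Env T q) • z := rfl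

theorem act_add (c : K) (a : Alg T q) (z w : M) (b : Alg T q) :
    act T q c a (z + w) b = act T q c a z b + act T q c a w b := smul_add _ _ _

theorem act_sub (c : K) (a : Alg T q) (z w : M) (b : Alg T q) :
    act T q c a (z - w) b = act T q c a z b - act T q c a w b := smul_sub _ _ _

theorem act_neg (c : K) (a : Alg T q) (z : M) (b : Alg T q) :
    act T q c a (-z) b = -act T q c a z b := smul_neg _ _

theorem act_zero (c : K) (a b : Alg T q) : act T q c a (0 : M) b = 0 := smul_zero _

theorem act_sum {ι : Type*} (s : Finset ι) (F : ι → M) (c : K) (a b : Alg T q) :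
    act T q c a (∑ k ∈ s, F k) b = ∑ k ∈ s, act T q c a (F k) b := Finset.smul_sum

theorem act_act (c c' : K) (a a' : Alg T q) (z : M) (b b' : Alg T q) :
    act T q c a (act T q c' a' z b') b = act T q (c * c') (a * a') z (b' * b) := by
  rw [act, act, act, smul_smul, smul_mul_smul_comm, Algebra.TensorProduct.tmul_mul_tmul, op_mul]

theorem act_one (z : M) : act T q 1 1 z 1 = z := by
  rw [act, one_smul, op_one, ← Algebra.TensorProduct.one_def, one_smul]

theorem act_zero_left (c : K) (z : M) (b : Alg T q) : act T q c 0 z b = 0 := by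
  rw [act, TensorProduct.zero_tmul, smul_zero]
  exact zero_smul (Env T q) z

theorem act_zero_right (c : K) (a : Alg T q) (z : M) : act T q c a z 0 = 0 := by
  rw [act, op_zero, TensorProduct.tmul_zero, smul_zero]
  exact zero_smul (Env T q) z

theorem act_zero_scalar (a : Alg T q) (z : M) (b : Alg T q) : act T q 0 a z b = 0 := by
  rw [act, zero_smul]
  exact zero_smul (Env T q) z

theorem act_add_left (c : K) (a a' : Alg T q) (z : M) (b : Alg T q) :
    act T q c (a + a') z b = act T q c a z b + act T q c a' z b := by
  rw [act, TensorProduct.add_tmul, smul_add, add_smul]; rfl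

theorem act_add_right (c : K) (a : Alg T q) (z : M) (b b' : Alg T q) :
    act T q c a z (b + b') = act T q c a z b + act T q c a z b' := by
  rw [act, op_add, TensorProduct.tmul_add, smul_add, add_smul]; rfl

theorem act_add_scalar (c c' : K) (a : Alg T q) (z : M) (b : Alg T q) :
    act T q (c + c') a z b = act T q c a z b + act T q c' a z b := by
  rw [act, add_smul, add_smul]; rfl

theorem act_neg_scalar (c : K) (a : Alg T q) (z : M) (b : Alg T q) :
    act T q (-c) a z b = -act T q c a z b := by
  refine eq_neg_of_add_eq_zero_left ?_
  rw [← act_add_scalar, neg_add_cancel, act_zero_scalar]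

theorem act_smul_left (c k : K) (a : Alg T q) (z : M) (b : Alg T q) :
    act T q c (k • a) z b = act T q (c * k) a z b := by
  rw [act, ← TensorProduct.smul_tmul', smul_smul]; rfl

theorem act_smul_right (c k : K) (a : Alg T q) (z : M) (b : Alg T q) :
    act T q c a z (k • b) = act T q (c * k) a z b := by
  rw [act, op_smul, TensorProduct.tmul_smul, smul_smul]; rfl

theorem map_act {M' : Type u} [AddCommGroup M'] [Module (Env T q) M'] (f : M →ₗ[Env T q] M')
    (c : K) (a : Alg T q) (z : M) (b : Alg T q) :
    f (act T q c a z b) = act T q c a (f z) b := map_smul f _ _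

/-- Idempotents matching the ends of `z` can be inserted or dropped freely. This is how relations
that hold only after multiplication by a vertex become applicable next to a generator. -/
theorem Fix.act_e {i k : ZMod 4} {z : M} (hz : Fix T q i k z) (c : K) (a b : Alg T q) :
    CyclicAlg.act T q c (a * e T q i) z (e T q k * b) = CyclicAlg.act T q c a z b := by
  conv_rhs => rw [← hz]
  have := act_act c 1 a (e T q i) z b (e T q k)
  rw [mul_one] at this
  rw [← this, act_def 1, one_smul]

theorem Fix.act_e_left {i k : ZMod 4} {z : M} (hz : Fix T q i k z) (c : K) (a b : Alg T q) :
    CyclicAlg.act T q c (a * e T q i) z b = CyclicAlg.act T q c a z b := by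
  rw [← hz.act_e c (a * e T q i), mul_assoc, e_mul_self, hz.act_e]

theorem Fix.act_e_right {i k : ZMod 4} {z : M} (hz : Fix T q i k z) (c : K) (a b : Alg T q) :
    CyclicAlg.act T q c a z (e T q k * b) = CyclicAlg.act T q c a z b := by
  rw [← hz.act_e c a (e T q k * b), ← mul_assoc, e_mul_self, hz.act_e]

end Act

/-- The generators `𝔭^n_{i,j}` with the convention that they vanish unless `0 ≤ j ≤ n`. -/
def pz (n : ℕ) (i : ZMod 4) (j : ℤ) : R T q n := if 0 ≤ j then p T q n i j.toNat else 0

theorem pz_natCast (n : ℕ) (i : ZMod 4) (j : ℕ) : pz T q n i j = p T q n i j := by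
  rw [pz, if_pos (Int.natCast_nonneg j), Int.toNat_natCast]

theorem p_eq_zero {n j : ℕ} (h : n < j) (i : ZMod 4) : p T q n i j = 0 := by
  rw [p, dif_neg (by omega)]

theorem pz_of_neg (n : ℕ) (i : ZMod 4) {j : ℤ} (h : j < 0) : pz T q n i j = 0 :=
  if_neg (by omega)

theorem pz_of_gt {n : ℕ} (i : ZMod 4) {j : ℤ} (h : n < j) : pz T q n i j = 0 := by
  rw [pz, if_pos (by omega), p_eq_zero T q (by omega)]

theorem fix_pz (n : ℕ) (i : ZMod 4) (j : ℤ) : Fix T q i (i + n) (pz T q n i j) := by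
  rw [pz]
  split_ifs
  · exact fix_p T q n i _
  · exact smul_zero _

/-- The sign of the left terms of `∂^{n+1}`. -/
def sign (K : Type u) [Field K] (n : ℕ) : K := (-1) ^ (n + 1)

theorem sign_succ (n : ℕ) : sign K (n + 1) = -sign K n := by
  rw [sign, pow_succ, sign]; ring

theorem par_add_even (i : ZMod 4) (m : ℕ) : par (i + (2 * m : ℕ)) = par i := by
  induction m with
  | zero => simp
  | succ m ih =>
    have : i + ((2 * (m + 1) : ℕ) : ZMod 4) = i + ((2 * m : ℕ) : ZMod 4) + 2 := by push_cast; ring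
    rw [this, par_add_two, ih]

/-- With generators set to zero outside `0 ≤ j ≤ n`, the boundary cases of the definition merge with
the inner ones, and only the middle index `2j = n+1` stays apart. The parities of the degree differ
by the sign and by the letter of `i+n`. Indices enter through equations so that later rewriting can
choose their normal form. -/
theorem d_pz {n : ℕ} {i i' v : ZMod 4} {j j' u : ℤ} {a b : ℕ} {l k : ZMod 2}
    (hab : (2 * j < n + 1 ∧ a = 4 * T + 1 ∧ b = 1) ∨ (n + 1 < 2 * j ∧ a = 1 ∧ b = 4 * T + 1))
    (hl : par i = l) (hk : par (i + n) = k) (hi : i + 1 = i') (hv : i + j - 1 = v)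
    (hj : j - 1 = j') (hu : n + 1 - j = u) :
    d T q n (pz T q (n + 1) i j) =
      act T q (S q u.toNat v) 1 (pz T q n i j') (x T q (k + 1) ^ a)
        + act T q 1 1 (pz T q n i j) (x T q k ^ b)
        + act T q (sign K n * S q j.toNat i) (x T q l ^ b) (pz T q n i' j) 1
        + act T q (sign K n) (x T q (l + 1) ^ a) (pz T q n i' j') 1 := by
  rcases lt_or_ge j 0 with h0 | h0
  · simp only [pz_of_neg T q _ _ h0, pz_of_neg T q _ _ (show j' < 0 by omega), act_zero, map_zero,
      add_zero]
  rcases lt_or_ge (n + 1 : ℤ) j with h1 | h1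
  · have h1' : ((n + 1 : ℕ) : ℤ) < j := by push_cast; omega
    simp only [pz_of_gt T q i h1', pz_of_gt T q _ (show (n : ℤ) < j by omega),
      pz_of_gt T q _ (show (n : ℤ) < j' by omega), act_zero, map_zero, add_zero]
  lift j to ℕ using h0
  subst hl hk hi hv hj hu
  rw [pz_natCast, d_p T q n i j (by omega)]
  have hu : ((n : ℤ) + 1 - j).toNat = n + 1 - j := by omega
  have hjj : (((j : ℕ) : ℤ) : ZMod 4) = (j : ZMod 4) := by simp
  rw [hu, Int.toNat_natCast, pz_natCast, pz_natCast, hjj]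
  have hj1 : j ≠ 0 → ∀ i, pz T q n i ((j : ℤ) - 1) = p T q n i (j - 1) := by
    intro h i
    rw [← pz_natCast]
    congr 1
    omega
  have hj0 : j = 0 → ∀ i, pz T q n i ((j : ℤ) - 1) = 0 := fun h i =>
    pz_of_neg T q n i (by omega)
  rcases Nat.even_or_odd' n with ⟨m, rfl | rfl⟩
  · have hs : sign K (2 * m) = -1 := by rw [sign, pow_succ, pow_mul]; simp
    have hm : 2 * m / 2 = m := by omega
    simp only [par_add_even, dGen, par_add_one, hs, hm, Nat.mul_mod_right, if_true, neg_mul,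
      one_mul, act_neg_scalar]
    rcases Nat.eq_zero_or_pos j with rfl | hj
    · rw [hj0 rfl, hj0 rfl, if_pos rfl, act_zero, act_zero, S_zero]
      obtain ⟨-, -, rfl⟩ : 2 * ((0 : ℕ) : ℤ) < (2 * m : ℕ) + 1 ∧ a = 4 * T + 1 ∧ b = 1 := by
        rcases hab with h | h
        · exact h
        · omega
      simp only [pow_one]
      abel
    · rw [if_neg (by omega), hj1 (by omega), hj1 (by omega)]
      rcases hab with ⟨h, rfl, rfl⟩ | ⟨h, rfl, rfl⟩
      · rw [if_pos (by omega), pow_one]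
        abel
      · rw [if_neg (by omega), pow_one]
        by_cases h2 : j < 2 * m + 1
        · rw [if_pos h2]
          abel
        · have hj2 : j = 2 * m + 1 := by omega
          subst hj2
          rw [if_neg h2, p_eq_zero T q (show 2 * m < 2 * m + 1 by omega),
            p_eq_zero T q (show 2 * m < 2 * m + 1 by omega)]
          simp only [Nat.add_sub_cancel, Nat.sub_self, S_zero, act_zero]
          abel
  · have hs : sign K (2 * m + 1) = 1 := by
      rw [sign, show 2 * m + 1 + 1 = 2 * (m + 1) by ring, pow_mul]; simp
    have hm : (2 * m + 1 + 1) / 2 = m + 1 := by omega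
    have hmod : ¬ (2 * m + 1) % 2 = 0 := by omega
    have hpar : par (i + ((2 * m + 1 : ℕ) : ZMod 4)) = par i + 1 := by
      rw [show i + ((2 * m + 1 : ℕ) : ZMod 4) = i + ((2 * m : ℕ) : ZMod 4) + 1 by push_cast; ring,
        par_add_one, par_add_even]
    simp only [hpar, add_one_add_one, dGen, par_add_one, hs, hm, if_neg hmod, one_mul]
    have hm2 : 2 * (m + 1) = 2 * m + 1 + 1 := by ring
    rw [hm2]
    rcases Nat.eq_zero_or_pos j with rfl | hj
    · rw [hj0 rfl, hj0 rfl, if_pos rfl, act_zero, act_zero, S_zero]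
      obtain ⟨-, -, rfl⟩ : 2 * ((0 : ℕ) : ℤ) < (2 * m + 1 : ℕ) + 1 ∧ a = 4 * T + 1 ∧ b = 1 := by
        rcases hab with h | h
        · exact h
        · omega
      simp only [pow_one]
      abel
    · rw [if_neg (by omega), hj1 (by omega), hj1 (by omega)]
      rcases hab with ⟨h, rfl, rfl⟩ | ⟨h, rfl, rfl⟩
      · rw [if_pos (by omega), pow_one, pow_one]
      · rw [if_neg (by omega), if_neg (by omega), pow_one, pow_one]
        by_cases h2 : j < 2 * m + 1 + 1
        · rw [if_pos h2]
        · have hj2 : j = 2 * m + 1 + 1 := by omega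
          subst hj2
          rw [if_neg h2, p_eq_zero T q (show 2 * m + 1 < 2 * m + 1 + 1 by omega),
            p_eq_zero T q (show 2 * m + 1 < 2 * m + 1 + 1 by omega)]
          simp only [Nat.add_sub_cancel, Nat.sub_self, S_zero, act_zero]
          abel

end CyclicAlg

namespace CyclicAlg

/-! ### The middle values of the differential -/

variable {K : Type u} [Field K] (T : ℕ) (q : ZMod 4 → K)

section Sandwich

variable {M : Type u} [AddCommGroup M] [Module (Env T q) M]

/-- The element `∑_k x_l^{4k} A x_l^{4T-4k} + ∑_k x_l^{4k+2} B x_l^{4T-4k-2}` of a bimodule. -/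
def sandwich (l : ZMod 2) (A B : M) : M :=
  (∑ k ∈ Finset.range (T + 1), act T q 1 (x T q l ^ (4 * k)) A (x T q l ^ (4 * T - 4 * k)))
    + ∑ k ∈ Finset.range T, act T q 1 (x T q l ^ (4 * k + 2)) B (x T q l ^ (4 * T - 4 * k - 2))

theorem sandwich_add (l : ZMod 2) (A A' B B' : M) :
    sandwich T q l (A + A') (B + B') = sandwich T q l A B + sandwich T q l A' B' := by
  simp only [sandwich, act_add, Finset.sum_add_distrib]
  abel

theorem sandwich_sub (l : ZMod 2) (A A' B B' : M) :
    sandwich T q l (A - A') (B - B') = sandwich T q l A B - sandwich T q l A' B' := by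
  simp only [sandwich, act_sub, Finset.sum_sub_distrib]
  abel

theorem map_sandwich {M' : Type u} [AddCommGroup M'] [Module (Env T q) M']
    (f : M →ₗ[Env T q] M') (l : ZMod 2) (A B : M) :
    f (sandwich T q l A B) = sandwich T q l (f A) (f B) := by
  simp only [sandwich, map_add, map_sum, map_act]

theorem act_sandwich_right (c : K) (l : ZMod 2) (A B : M) :
    act T q c 1 (sandwich T q l A B) (x T q l) =
      sandwich T q l (act T q c 1 A (x T q l)) (act T q c 1 B (x T q l)) := by
  simp only [sandwich, act_add, act_sum, act_act, one_mul, mul_one, ← pow_succ, ← pow_succ']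

theorem act_sandwich_left (c : K) (l : ZMod 2) (A B : M) :
    act T q c (x T q l) (sandwich T q l A B) 1 =
      sandwich T q l (act T q c (x T q l) A 1) (act T q c (x T q l) B 1) := by
  simp only [sandwich, act_add, act_sum, act_act, one_mul, mul_one, ← pow_succ, ← pow_succ']

/-- The foreign letter annihilates every summand that ends in a positive power of `x_l`. The
exponents `4T-4k-2` with `k < T` are all positive, so only `k = T` of the first sum survives. -/
theorem act_sandwich_right_of_ne (c : K) {l l' : ZMod 2} (h : l ≠ l') (A B : M) :
    act T q c 1 (sandwich T q l A B) (x T q l') =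
      act T q c (x T q l ^ (4 * T)) A (x T q l') := by
  have h0 : ∀ t, t ≠ 0 → x T q l ^ t * x T q l' = 0 := fun t ht => by
    simpa using x_pow_mul_x_pow T q h ht one_ne_zero
  rw [sandwich, act_add, act_sum, act_sum, Finset.sum_range_succ, Finset.sum_eq_zero,
    Finset.sum_eq_zero, zero_add, add_zero, act_act, Nat.sub_self, pow_zero, mul_one, one_mul,
    one_mul]
  · intro k hk
    have := Finset.mem_range.mp hk
    rw [act_act, h0 _ (by omega), act_zero_right]
  · intro k hk
    have := Finset.mem_range.mp hk
    rw [act_act, h0 _ (by omega), act_zero_right]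

theorem act_sandwich_left_of_ne (c : K) {l l' : ZMod 2} (h : l' ≠ l) (A B : M) :
    act T q c (x T q l') (sandwich T q l A B) 1 =
      act T q c (x T q l') A (x T q l ^ (4 * T)) := by
  have h0 : ∀ t, t ≠ 0 → x T q l' * x T q l ^ t = 0 := fun t ht => by
    simpa using x_pow_mul_x_pow T q h one_ne_zero ht
  rw [sandwich, act_add, act_sum, act_sum, Finset.sum_range_succ', Finset.sum_eq_zero,
    Finset.sum_eq_zero, zero_add, add_zero, act_act, mul_zero, pow_zero, mul_one, mul_one, mul_one,
    Nat.sub_zero]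
  · intro k _
    rw [act_act, h0 _ (by omega), act_zero_left]
  · intro k _
    rw [act_act, h0 _ (by omega), act_zero_left]

/-- Since `c` and `c'` are interchanged between the two arguments, the summands are `P k - Q k` and
`Q k - P (k + 1)`. Everything cancels except `P 0` and `Q T`. -/
theorem sandwich_telescope (l : ZMod 2) (c c' : K) (z z' : M) :
    sandwich T q l (act T q c 1 z (x T q l ^ 2) - act T q c' (x T q l ^ 2) z' 1)
      (act T q c' 1 z' (x T q l ^ 2) - act T q c (x T q l ^ 2) z 1) =
    act T q c 1 z (x T q l ^ (4 * T + 2)) - act T q c' (x T q l ^ (4 * T + 2)) z' 1 := by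
  set P : ℕ → M := fun k => act T q c (x T q l ^ (4 * k)) z (x T q l ^ (4 * T + 2 - 4 * k))
  set Q : ℕ → M := fun k => act T q c' (x T q l ^ (4 * k + 2)) z' (x T q l ^ (4 * T - 4 * k))
  have h1 : ∀ k ∈ Finset.range (T + 1), act T q 1 (x T q l ^ (4 * k))
      (act T q c 1 z (x T q l ^ 2) - act T q c' (x T q l ^ 2) z' 1) (x T q l ^ (4 * T - 4 * k)) =
      P k - Q k := by
    intro k hk
    have := Finset.mem_range.mp hk
    simp only [act_sub, act_act, one_mul, mul_one, ← pow_add, P, Q]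
    congr 3
    omega
  have h2 : ∀ k ∈ Finset.range T, act T q 1 (x T q l ^ (4 * k + 2))
      (act T q c' 1 z' (x T q l ^ 2) - act T q c (x T q l ^ 2) z 1)
        (x T q l ^ (4 * T - 4 * k - 2)) = Q k - P (k + 1) := by
    intro k hk
    have := Finset.mem_range.mp hk
    have e1 : 2 + (4 * T - 4 * k - 2) = 4 * T - 4 * k := by omega
    have e2 : 4 * T - 4 * k - 2 = 4 * T + 2 - 4 * (k + 1) := by omega
    simp only [act_sub, act_act, one_mul, mul_one, ← pow_add, P, Q, e1]
    rw [e2, show 4 * k + 2 + 2 = 4 * (k + 1) by ring]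
  rw [sandwich, Finset.sum_congr rfl h1, Finset.sum_congr rfl h2, Finset.sum_sub_distrib,
    Finset.sum_sub_distrib, Finset.sum_range_succ', Finset.sum_range_succ]
  have h3 : P 0 = act T q c 1 z (x T q l ^ (4 * T + 2)) := by simp [P]
  have h4 : Q T = act T q c' (x T q l ^ (4 * T + 2)) z' 1 := by simp [Q]
  rw [h3, h4]
  abel

/-- The right factor already ends in the foreign letter, so no power of `x_l` may follow it; this
leaves the summand `k = T`. -/
theorem sandwich_last {l l' : ZMod 2} (h : l' ≠ l) (c c' : K) (z z' : M) {t : ℕ} (ht : t ≠ 0) :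
    sandwich T q l (act T q c (x T q l) z (x T q l' ^ t))
      (act T q c' (x T q l) z' (x T q l' ^ t)) =
    act T q c (x T q l ^ (4 * T + 1)) z (x T q l' ^ t) := by
  rw [sandwich, Finset.sum_range_succ, Finset.sum_eq_zero, Finset.sum_eq_zero, zero_add, add_zero,
    act_act, Nat.sub_self, pow_zero, mul_one, one_mul, ← pow_succ]
  · intro k hk
    have := Finset.mem_range.mp hk
    rw [act_act, x_pow_mul_x_pow T q h ht (by omega), act_zero_right]
  · intro k hk
    have := Finset.mem_range.mp hk
    rw [act_act, x_pow_mul_x_pow T q h ht (by omega), act_zero_right]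

theorem sandwich_first {l l' : ZMod 2} (h : l ≠ l') (c c' : K) (z z' : M) {t : ℕ} (ht : t ≠ 0) :
    sandwich T q l (act T q c (x T q l' ^ t) z (x T q l))
      (act T q c' (x T q l' ^ t) z' (x T q l)) =
    act T q c (x T q l' ^ t) z (x T q l ^ (4 * T + 1)) := by
  rw [sandwich, Finset.sum_range_succ', Finset.sum_eq_zero, Finset.sum_eq_zero, zero_add, add_zero,
    act_act, mul_zero, pow_zero, one_mul, one_mul, Nat.sub_zero, ← pow_succ']
  · intro k _
    rw [act_act, x_pow_mul_x_pow T q h (by omega) ht, act_zero_left]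
  · intro k _
    rw [act_act, x_pow_mul_x_pow T q h (by omega) ht, act_zero_left]

theorem act_socle_right {i k : ZMod 4} {z : M} (hz : Fix T q i k z) (c : K) (a : Alg T q) :
    act T q (c * q k) a z (x T q (par k) ^ (4 * T + 2))
      + act T q c a z (x T q (par k + 1) ^ (4 * T + 2)) = 0 := by
  rw [← hz.act_e_right, ← hz.act_e_right c, ← act_smul_right, ← act_add_right, e_mul_socle_swap,
    act_zero_right]

/-- The idempotent `e_{i+2}` in front of `z` moves across `x^{4T+2}` and becomes `e_i`, because
`4T+2` is `2` modulo 4. So the relation at `e_i` is the one that applies. -/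
theorem act_socle_left {i k : ZMod 4} {z : M} (hz : Fix T q (i + 2) k z) (c : K) (b : Alg T q) :
    act T q (c * q i) (x T q (par i) ^ (4 * T + 2)) z b
      + act T q c (x T q (par i + 1) ^ (4 * T + 2)) z b = 0 := by
  have h2 : ((4 * T + 2 : ℕ) : ZMod 4) = 2 := by
    rw [Nat.cast_add, cast_four_mul]; simp
  have h := e_mul_x_pow T q i
  rw [← hz.act_e_left, ← hz.act_e_left c, ← act_smul_left, ← act_add_left, ← h2, ← h, ← h,
    e_mul_socle_swap, act_zero_left]

end Sandwich

/-- Separating the letters turns the defining double sum into one sandwich for each letter, the form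
in which telescoping applies. -/
theorem d_pz_middle {m : ℕ} {i i₁ i₂ i₃ v : ZMod 4} {l : ZMod 2}
    (hl : par i = l) (h₁ : i + 1 = i₁) (h₂ : i + 2 = i₂) (h₃ : i + 3 = i₃) (hv : i + m = v) :
    d T q (2 * m + 1) (pz T q (2 * m + 2) i (m + 1)) =
      sandwich T q l
        (act T q (S q (m + 1) v) 1 (pz T q (2 * m + 1) i m) (x T q l)
          + act T q (S q (m + 1) i) (x T q l) (pz T q (2 * m + 1) i₁ (m + 1)) 1)
        (act T q (S q (m + 1) i) 1 (pz T q (2 * m + 1) i₂ m) (x T q l)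
          + act T q (S q (m + 1) v) (x T q l) (pz T q (2 * m + 1) i₃ (m + 1)) 1)
      + sandwich T q (l + 1)
        (act T q 1 1 (pz T q (2 * m + 1) i (m + 1)) (x T q (l + 1))
          + act T q 1 (x T q (l + 1)) (pz T q (2 * m + 1) i₁ m) 1)
        (act T q ((S q (m + 1) i₃)⁻¹ * S q (m + 1) (v + 3)) 1
            (pz T q (2 * m + 1) i₂ (m + 1)) (x T q (l + 1))
          + act T q ((S q (m + 1) i₃)⁻¹ * S q (m + 1) (v + 3)) (x T q (l + 1))
            (pz T q (2 * m + 1) i₃ m) 1) := by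
  subst hl h₁ h₂ h₃ hv
  have hp : ∀ n i, pz T q n i ((m : ℤ) + 1) = p T q n i (m + 1) := fun n i => by
    rw [← pz_natCast]; push_cast; rfl
  simp only [hp, pz_natCast]
  rw [d_p T q (2 * m + 1) i (m + 1) (by omega)]
  have hm : (2 * m + 1 + 1) / 2 = m + 1 := by omega
  have hmod : ¬ (2 * m + 1) % 2 = 0 := by omega
  have e1 : i + ((m + 1 : ℕ) : ZMod 4) - 1 = i + m := by push_cast; ring
  have e2 : i + ((m + 1 : ℕ) : ZMod 4) + 2 = i + m + 3 := by push_cast; ring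
  simp only [dGen, hm, if_neg hmod, if_neg (Nat.succ_ne_zero m), lt_irrefl, if_true, if_false, e1,
    e2, par_add_one, Nat.add_sub_cancel, sandwich, Finset.sum_add_distrib, act_add, act_act,
    one_mul, mul_one]
  abel

end CyclicAlg

/-! ### The square of the differential away from the middle -/

namespace CyclicAlg

variable {K : Type u} [Field K] (T : ℕ) (q : ZMod 4 → K)

/-- The bounds on `j` ensure that both differentials use the same exponents `a` and `b`, for `j` as
well as for `j-1`. The equal exponents `a`, `a` or `b`, `b` on one side belong to different letters
and give zero. The mixed ones add up to `a + b = 4T+2` and cancel by the socle relation. -/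
theorem d_d_pz_generic {n : ℕ} {i : ZMod 4} {j : ℤ} {a b : ℕ}
    (hab : (2 * j < n + 1 ∧ a = 4 * T + 1 ∧ b = 1) ∨
      (n + 3 < 2 * j ∧ a = 1 ∧ b = 4 * T + 1)) :
    d T q n (d T q (n + 1) (pz T q (n + 2) i j)) = 0 := by
  have ha : a ≠ 0 := by omega
  have hb : b ≠ 0 := by omega
  have hs : a + b = 4 * T + 2 := by omega
  have hs' : b + a = 4 * T + 2 := by omega
  obtain ⟨l, hl⟩ : ∃ l, par i = l := ⟨_, rfl⟩
  obtain ⟨k, hk⟩ : ∃ k, par (i + n) = k := ⟨_, rfl⟩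
  have hl1 : par (i + 1) = l + 1 := by rw [par_add_one, hl]
  have hk1 : par (i + (n + 1 : ℕ)) = k + 1 := by
    rw [Nat.cast_succ, ← add_assoc, par_add_one, hk]
  have hk1' : par (i + 1 + n) = k + 1 := by
    rw [add_right_comm, par_add_one, hk]
  have i2 : i + 1 + 1 = i + 2 := by ring
  rw [d_pz T q (n := n + 1) (a := a) (b := b) (by push_cast; omega) hl hk1 rfl rfl rfl rfl]
  simp only [map_add, map_act]
  rw [d_pz T q (n := n) (i := i) (j := j - 1) (a := a) (b := b) (by omega) hl hk rfl rfl rfl rfl,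
    d_pz T q (n := n) (i := i) (j := j) (a := a) (b := b) (by omega) hl hk rfl rfl rfl rfl,
    d_pz T q (n := n) (i := i + 1) (j := j - 1) (a := a) (b := b) (by omega) hl1 hk1' i2 rfl
      rfl rfl,
    d_pz T q (n := n) (i := i + 1) (j := j) (a := a) (b := b) (by omega) hl1 hk1' i2 rfl rfl rfl]
  have z1 : ∀ {s t : ℕ} (l : ZMod 2), s ≠ 0 → t ≠ 0 → x T q l ^ s * x T q (l + 1) ^ t = 0 :=
    fun l hs ht => x_pow_mul_x_pow T q (add_one_ne l).symm hs ht
  have z2 : ∀ {s t : ℕ} (l : ZMod 2), s ≠ 0 → t ≠ 0 → x T q (l + 1) ^ s * x T q l ^ t = 0 :=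
    fun l hs ht => x_pow_mul_x_pow T q (add_one_ne l) hs ht
  simp only [act_add, act_act, one_mul, mul_one, add_one_add_one, z1 _ hb hb,
    z2 _ ha ha, act_zero_left, act_zero_right, zero_add, add_zero, ← pow_add, hs, hs',
    sign_succ, neg_mul, act_neg_scalar]
  have e1 : i + 1 + ((j - 1 : ℤ) : ZMod 4) - 1 = i + (j : ZMod 4) - 1 := by push_cast; ring
  have e2 : (n : ℤ) + 1 - (j - 1) = ((n + 1 : ℕ) : ℤ) + 1 - j := by push_cast; ring
  rw [e1, e2]
  have m2 : act T q (S q (((n + 1 : ℕ) : ℤ) + 1 - j).toNat (i + (j : ZMod 4) - 1) * sign K n)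
      (x T q (l + 1) ^ a) (pz T q n (i + 1) (j - 1 - 1)) (x T q k ^ a) =
      act T q (sign K n * S q (((n + 1 : ℕ) : ℤ) + 1 - j).toNat (i + (j : ZMod 4) - 1))
      (x T q (l + 1) ^ a) (pz T q n (i + 1) (j - 1 - 1)) (x T q k ^ a) := by rw [mul_comm]
  rw [m2]
  -- This is the range in which `𝔭^n_{i,j-1}` exists. Writing `j = s+1` and `n = s+r` turns
  -- truncated subtractions into plain sums; outside the range all terms with index `j-1` are zero.
  by_cases hj : 1 ≤ j ∧ j ≤ n + 1
  · obtain ⟨s, rfl⟩ : ∃ s : ℕ, j = s + 1 := ⟨(j - 1).toNat, by omega⟩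
    obtain ⟨r, rfl⟩ : ∃ r : ℕ, n = s + r := ⟨n - s, by omega⟩
    have t1 : (((s + r + 1 : ℕ) : ℤ) + 1 - (s + 1)).toNat = r + 1 := by omega
    have t2 : (((s + r : ℕ) : ℤ) + 1 - (s + 1)).toNat = r := by omega
    have t3 : ((s : ℤ) + 1 - 1).toNat = s := by omega
    have t4 : ((s : ℤ) + 1).toNat = s + 1 := by omega
    have c1 : i + (((s : ℤ) + 1 : ℤ) : ZMod 4) - 1 = i + s := by push_cast; ring
    have c2 : i + 1 + (((s : ℤ) + 1 : ℤ) : ZMod 4) - 1 = i + (s + 1 : ℕ) := by push_cast; ring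
    rw [t1, t2, t3, t4, c1, c2]
    -- Both sides contain `S_{s+r+1,i}`, split after `s` or after `s+1` factors.
    have m1 : S q (r + 1) (i + s) * (sign K (s + r) * S q s i) =
        sign K (s + r) * S q (s + 1) i * S q r (i + (s + 1 : ℕ)) := by
      have := S_add q s (r + 1) i
      have h2 := S_add q (s + 1) r i
      rw [show s + 1 + r = s + (r + 1) by ring] at h2
      linear_combination sign K (s + r) * (h2 - this)
    have rr := act_socle_right T q (fix_pz T q (s + r) i ((s : ℤ) + 1 - 1)) (S q r (i + s)) 1
    rw [hk] at rr
    have hr : S q (r + 1) (i + s) = S q r (i + s) * q (i + (s + r : ℕ)) := by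
      rw [S_succ]; push_cast; rw [add_assoc]
    rw [← hr] at rr
    have ll := act_socle_left T q (fix_pz T q (s + r) (i + 2) ((s : ℤ) + 1 - 1))
      (sign K (s + r) * (sign K (s + r) * S q s (i + 1))) 1
    rw [hl] at ll
    have hll : sign K (s + r) * (sign K (s + r) * S q s (i + 1)) * q i =
        sign K (s + r) * S q (s + 1) i * sign K (s + r) := by
      rw [S_succ']; ring
    rw [hll] at ll
    rw [m1, eq_neg_of_add_eq_zero_left rr, eq_neg_of_add_eq_zero_left ll]
    abel
  · have h0 : ∀ i, pz T q n i (j - 1) = 0 := fun i => by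
      rcases lt_or_ge j 1 with h | h
      · exact pz_of_neg T q n i (by omega)
      · exact pz_of_gt T q i (by omega)
    simp only [h0, act_zero]
    abel

end CyclicAlg

/-! ### The square of the differential at the middle generator of an even degree -/

namespace CyclicAlg

variable {K : Type u} [Field K] (T : ℕ) (q : ZMod 4 → K)

theorem sign_even (m : ℕ) : sign K (2 * m) = -1 := by
  rw [sign, pow_succ, pow_mul]; simp

theorem sign_odd (m : ℕ) : sign K (2 * m + 1) = 1 := by
  rw [sign_succ, sign_even, neg_neg]

theorem par_add_odd (i : ZMod 4) (m : ℕ) : par (i + (2 * m + 1 : ℕ)) = par i + 1 := by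
  rw [Nat.cast_succ, ← add_assoc, par_add_one, par_add_even]

theorem x_mul_x_pow_of_ne {l l' : ZMod 2} (h : l ≠ l') {t : ℕ} (ht : t ≠ 0) :
    x T q l * x T q l' ^ t = 0 := by
  simpa using x_pow_mul_x_pow T q h one_ne_zero ht

theorem x_pow_mul_x_of_ne {l l' : ZMod 2} (h : l ≠ l') {t : ℕ} (ht : t ≠ 0) :
    x T q l ^ t * x T q l' = 0 := by
  simpa using x_pow_mul_x_pow T q h ht one_ne_zero

theorem d_pz_odd_left {m : ℕ} {i i₁ : ZMod 4} {l : ZMod 2} (hl : par i = l) (h₁ : i + 1 = i₁) :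
    d T q (2 * m) (pz T q (2 * m + 1) i m) =
      act T q (S q (m + 1) (i + m - 1)) 1 (pz T q (2 * m) i (m - 1)) (x T q (l + 1) ^ (4 * T + 1))
        + act T q 1 1 (pz T q (2 * m) i m) (x T q l)
        - act T q (S q m i) (x T q l) (pz T q (2 * m) i₁ m) 1
        - act T q 1 (x T q (l + 1) ^ (4 * T + 1)) (pz T q (2 * m) i₁ (m - 1)) 1 := by
  have hu : (((2 * m : ℕ) : ℤ) + 1 - m).toNat = m + 1 := by omega
  rw [d_pz T q (n := 2 * m) (j := m) (a := 4 * T + 1) (b := 1)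
    (Or.inl ⟨by push_cast; omega, rfl, rfl⟩) hl
    ((par_add_even i m).trans hl) h₁ rfl rfl rfl, hu, Int.toNat_natCast, sign_even, pow_one,
    neg_one_mul, act_neg_scalar, act_neg_scalar, Int.cast_natCast]
  abel

theorem d_pz_odd_right {m : ℕ} {i i₁ : ZMod 4} {l : ZMod 2} (hl : par i = l) (h₁ : i + 1 = i₁) :
    d T q (2 * m) (pz T q (2 * m + 1) i (m + 1)) =
      act T q (S q m (i + m)) 1 (pz T q (2 * m) i m) (x T q (l + 1))
        + act T q 1 1 (pz T q (2 * m) i (m + 1)) (x T q l ^ (4 * T + 1))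
        - act T q (S q (m + 1) i) (x T q l ^ (4 * T + 1)) (pz T q (2 * m) i₁ (m + 1)) 1
        - act T q 1 (x T q (l + 1)) (pz T q (2 * m) i₁ m) 1 := by
  have hu : (((2 * m : ℕ) : ℤ) + 1 - (m + 1)).toNat = m := by omega
  have hv : i + (((m : ℤ) + 1 : ℤ) : ZMod 4) - 1 = i + m := by push_cast; ring
  have ht : ((m : ℤ) + 1).toNat = m + 1 := by omega
  rw [d_pz T q (n := 2 * m) (j := m + 1) (a := 1) (b := 4 * T + 1)
    (Or.inr ⟨by push_cast; omega, rfl, rfl⟩) hl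
    ((par_add_even i m).trans hl) h₁ hv (show (m : ℤ) + 1 - 1 = m by ring) rfl, hu, ht, sign_even,
    pow_one, neg_one_mul, act_neg_scalar, act_neg_scalar]
  abel

/-- The hypothesis `hc` says that the two occurrences of `x_l 𝔭 x_l` have opposite coefficients.
What remains is a telescoping pair and two terms with different letters on the two sides. -/
theorem d_middle_left {m : ℕ} {i i₁ i₂ : ZMod 4} {l : ZMod 2} (hl : par i = l) (h₁ : i + 1 = i₁)
    (h₂ : i + 2 = i₂) {c c' : K} (hc : c * S q m i = c' * S q m (i₁ + m)) :
    d T q (2 * m) (act T q c 1 (pz T q (2 * m + 1) i m) (x T q l)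
        + act T q c' (x T q l) (pz T q (2 * m + 1) i₁ (m + 1)) 1) =
      (act T q c 1 (pz T q (2 * m) i m) (x T q l ^ 2)
        - act T q c' (x T q l ^ 2) (pz T q (2 * m) i₂ m) 1)
      + (act T q c' (x T q l) (pz T q (2 * m) i₁ (m + 1)) (x T q (l + 1) ^ (4 * T + 1))
        - act T q c (x T q (l + 1) ^ (4 * T + 1)) (pz T q (2 * m) i₁ (m - 1)) (x T q l)) := by
  have hN : 4 * T + 1 ≠ 0 := by omega
  have hl₁ : par i₁ = l + 1 := by rw [← h₁, par_add_one, hl]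
  have h₁₂ : i₁ + 1 = i₂ := by rw [← h₁, ← h₂]; ring
  rw [map_add, map_act, map_act, d_pz_odd_left T q hl h₁, d_pz_odd_right T q hl₁ h₁₂]
  simp only [act_add, act_sub, act_act, one_mul, mul_one, add_one_add_one, ← pow_two, one_pow, hc,
    x_mul_x_pow_of_ne T q (add_one_ne l).symm hN,
    x_pow_mul_x_of_ne T q (add_one_ne l) hN, act_zero_left, act_zero_right]
  abel

theorem d_middle_right {m : ℕ} {i i₁ i₂ : ZMod 4} {l : ZMod 2} (hl : par i = l) (h₁ : i + 1 = i₁)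
    (h₂ : i + 2 = i₂) (c : K) :
    d T q (2 * m) (act T q c 1 (pz T q (2 * m + 1) i (m + 1)) (x T q (l + 1))
        + act T q c (x T q (l + 1)) (pz T q (2 * m + 1) i₁ m) 1) =
      (act T q (c * S q m (i + m)) 1 (pz T q (2 * m) i m) (x T q (l + 1) ^ 2)
        - act T q (c * S q m i₁) (x T q (l + 1) ^ 2) (pz T q (2 * m) i₂ m) 1)
      + (act T q (c * S q (m + 1) (i + m)) (x T q (l + 1)) (pz T q (2 * m) i₁ (m - 1))
          (x T q l ^ (4 * T + 1))
        - act T q (c * S q (m + 1) i) (x T q l ^ (4 * T + 1)) (pz T q (2 * m) i₁ (m + 1))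
          (x T q (l + 1))) := by
  have hN : 4 * T + 1 ≠ 0 := by omega
  have hl₁ : par i₁ = l + 1 := by rw [← h₁, par_add_one, hl]
  have h₁₂ : i₁ + 1 = i₂ := by rw [← h₁, ← h₂]; ring
  have hv : i₁ + (m : ZMod 4) - 1 = i + m := by rw [← h₁]; ring
  rw [map_add, map_act, map_act, d_pz_odd_right T q hl h₁, d_pz_odd_left T q hl₁ h₁₂, hv]
  simp only [act_add, act_sub, act_act, one_mul, mul_one, add_one_add_one, ← pow_two, one_pow,
    x_mul_x_pow_of_ne T q (add_one_ne l) hN,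
    x_pow_mul_x_of_ne T q (add_one_ne l).symm hN, act_zero_left, act_zero_right]
  abel

/-- Both sandwiches telescope to socle powers, which cancel between the letters by the socle
relation. The terms with different letters on the two sides collapse to exponent `4T+1` on each side
and cancel between the two sandwiches. -/
theorem d_d_pz_middle (hq : ∀ i, q i ≠ 0) (m : ℕ) (i : ZMod 4) :
    d T q (2 * m) (d T q (2 * m + 1) (pz T q (2 * m + 2) i (m + 1))) = 0 := by
  obtain ⟨l, hl⟩ : ∃ l, par i = l := ⟨_, rfl⟩
  have hN : 4 * T + 1 ≠ 0 := by omega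
  have hl2 : par (i + 2) = l := by rw [par_add_two, hl]
  have h23 : i + 2 + 1 = i + 3 := by ring
  have h24 : i + 2 + 2 = i := by rw [add_assoc]; exact add_four i
  have s1 := S_add q m (m + 1) i
  have s2 := S_add q (m + 1) m i
  rw [show m + 1 + m = m + (m + 1) by ring, s1] at s2
  have per := S_mul_S_add_two hq m i
  have e1 : S q (m + 1) (i + 2) = S q m (i + 2) * q (i + m + 2) := by
    rw [S_succ, add_right_comm]
  have e2 : S q (m + 1) (i + m + 2) = q (i + m + 2) * S q m (i + m + 3) := by
    rw [S_succ', show i + (m : ZMod 4) + 2 + 1 = i + m + 3 by ring]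
  have e3 : S q (m + 1) (i + 3) = S q m (i + 3) * q (i + m + 3) := by
    rw [S_succ, add_right_comm]
  have e4 : S q (m + 1) (i + m + 3) = q (i + m + 3) * S q m (i + m) := by
    rw [S_succ', show i + (m : ZMod 4) + 3 + 1 = i + m + 4 by ring, add_four]
  -- `c1` and `c2` are the hypotheses of `d_middle_left` at `i` and at `i+2`. `c3` and `c4` show
  -- that the factor with the inverse swaps the two coefficients at `i+2`, as the telescoping for
  -- the letter `l+1` demands.
  have c1 : S q (m + 1) (i + m) * S q m i = S q (m + 1) i * S q m (i + 1 + m) := by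
    rw [show i + 1 + (m : ZMod 4) = i + (m + 1 : ℕ) by push_cast; ring, ← s2, mul_comm]
  have c2 : S q (m + 1) i * S q m (i + 2) = S q (m + 1) (i + m) * S q m (i + 3 + m) := by
    rw [add_right_comm i 3]
    rw [e1, e2] at per
    exact mul_right_cancel₀ (hq (i + m + 2)) (by linear_combination per)
  have hS3 := S_ne_zero hq (m + 1) (i + 3)
  have c3 : (S q (m + 1) (i + 3))⁻¹ * S q (m + 1) (i + m + 3) * S q m (i + 3) = S q m (i + m) := by
    rw [inv_mul_eq_div, div_mul_eq_mul_div, div_eq_iff hS3, e3, e4]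
    ring
  have c4 : (S q (m + 1) (i + 3))⁻¹ * S q (m + 1) (i + m + 3) * S q m (i + 2 + m) =
      S q m (i + 1) := by
    rw [inv_mul_eq_div, div_mul_eq_mul_div, div_eq_iff hS3, e3, e4, add_right_comm i 2]
    rcases m with _ | m
    · simp [S_zero]
    have per' := S_mul_S_add_two hq m (i + 1)
    have p1 : i + 1 + (2 : ZMod 4) = i + 3 := by ring
    have p2 : i + 1 + (m : ZMod 4) = i + (m + 1 : ℕ) := by push_cast; ring
    rw [p1, p2] at per'
    linear_combination -q (i + (m + 1 : ℕ) + 3) * per'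
  rw [d_pz_middle T q hl rfl rfl rfl rfl, map_add, map_sandwich, map_sandwich,
    d_middle_left T q hl rfl rfl c1, d_middle_left T q hl2 h23 h24 c2,
    d_middle_right T q hl rfl rfl, d_middle_right T q hl2 h23 h24, c3, c4, sandwich_add,
    sandwich_add, one_mul, one_mul, one_mul, one_mul, sandwich_telescope, sandwich_telescope,
    sandwich_sub, sandwich_sub, sandwich_last T q (add_one_ne l) _ _ _ _ hN,
    sandwich_last T q (add_one_ne l).symm _ _ _ _ hN,
    sandwich_first T q (add_one_ne l) _ _ _ _ hN,
    sandwich_first T q (add_one_ne l).symm _ _ _ _ hN]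
  have rr := act_socle_right T q (fix_pz T q (2 * m) i m) (S q m (i + m)) 1
  rw [par_add_even, hl] at rr
  have hr : S q (m + 1) (i + m) = S q m (i + m) * q (i + (2 * m : ℕ)) := by
    rw [S_succ]; push_cast; rw [add_assoc, two_mul]
  rw [← hr] at rr
  have ll := act_socle_left T q (fix_pz T q (2 * m) (i + 2) m) (S q m (i + 1)) 1
  rw [mul_comm (S q m (i + 1)), ← S_succ', hl] at ll
  rw [eq_neg_of_add_eq_zero_left rr, eq_neg_of_add_eq_zero_left ll]
  abel

end CyclicAlg

namespace CyclicAlg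

/-! ### The differential squares to zero -/

variable {K : Type u} [Field K] (T : ℕ) (q : ZMod 4 → K)

/-- The two middle generators, at `i` and at `i+1`, are multiplied by `x_l` on the right and on the
left. Their sandwiches for the letter `l` share the terms `x_l 𝔭 x_l`, and their difference
telescopes. The sandwiches for `l+1` shrink to single terms that meet the contributions of index
`m`. -/
theorem d_d_pz_below_middle (hq : ∀ i, q i ≠ 0) (m : ℕ) (i : ZMod 4) :
    d T q (2 * m + 1) (d T q (2 * m + 2) (pz T q (2 * m + 3) i (m + 1))) = 0 := by
  obtain ⟨l, hl⟩ : ∃ l, par i = l := ⟨_, rfl⟩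
  have hN : 4 * T + 1 ≠ 0 := by omega
  have hl1 : par (i + 1) = l + 1 := by rw [par_add_one, hl]
  have h12 : i + 1 + 1 = i + 2 := by ring
  have h13 : i + 1 + 2 = i + 3 := by ring
  have h14 : i + 1 + 3 = i := by rw [add_assoc]; exact add_four i
  have hv1 : i + 1 + (m : ZMod 4) = i + (m + 1 : ℕ) := by push_cast; ring
  have hv3 : i + ((m + 1 : ℕ) : ZMod 4) + 3 = i + m := by
    rw [show i + ((m + 1 : ℕ) : ZMod 4) + 3 = i + m + 4 by push_cast; ring, add_four]
  have hpar : par (i + (2 * m + 2 : ℕ)) = l := by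
    rw [show 2 * m + 2 = 2 * (m + 1) by ring, par_add_even, hl]
  have hpar1 : par (i + (2 * m + 1 : ℕ)) = l + 1 := by rw [par_add_odd, hl]
  have hpar2 : par (i + 1 + (2 * m + 1 : ℕ)) = l := by
    rw [par_add_odd, hl1, add_one_add_one]
  have hsg : sign K (2 * m + 2) = -1 := by rw [show 2 * m + 2 = 2 * (m + 1) by ring, sign_even]
  have ht : ((m : ℤ) + 1).toNat = m + 1 := by omega
  have hu2 : (((2 * m + 2 : ℕ) : ℤ) + 1 - (m + 1)).toNat = m + 2 := by omega
  have hu1 : (((2 * m + 1 : ℕ) : ℤ) + 1 - m).toNat = m + 2 := by omega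
  have hvm : i + (((m : ℤ) + 1 : ℤ) : ZMod 4) - 1 = i + m := by push_cast; ring
  have hvm1 : i + 1 + (((m : ℤ) : ℤ) : ZMod 4) - 1 = i + m := by push_cast; ring
  have hSi := S_ne_zero hq (m + 1) i
  rw [d_pz T q (n := 2 * m + 2) (j := m + 1) (a := 4 * T + 1) (b := 1)
    (Or.inl ⟨by push_cast; omega, rfl, rfl⟩) hl hpar rfl hvm
    (show (m : ℤ) + 1 - 1 = m by ring) rfl, hu2, ht, hsg]
  simp only [map_add, map_act, pow_one]
  rw [d_pz_middle T q hl rfl rfl rfl rfl, d_pz_middle T q hl1 h12 h13 h14 hv1,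
    d_pz T q (n := 2 * m + 1) (i := i) (j := m) (a := 4 * T + 1) (b := 1)
      (Or.inl ⟨by push_cast; omega, rfl, rfl⟩) hl hpar1 rfl rfl rfl rfl,
    d_pz T q (n := 2 * m + 1) (i := i + 1) (j := m) (a := 4 * T + 1) (b := 1)
      (Or.inl ⟨by push_cast; omega, rfl, rfl⟩) hl1 hpar2 h12 hvm1 rfl rfl, hu1, sign_odd,
    Int.toNat_natCast, hv3]
  simp only [add_one_add_one, neg_mul, one_mul, act_neg_scalar, act_add (b := x T q l),
    act_add (a := x T q l) (b := 1)]
  rw [act_sandwich_right, act_sandwich_right_of_ne T q _ (add_one_ne l), act_sandwich_left,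
    act_sandwich_left_of_ne T q _ (add_one_ne l).symm]
  have z1 : x T q l * x T q (l + 1) = 0 := x_mul_x T q l
  have z2 : x T q (l + 1) * x T q l = 0 := by
    simpa [add_one_add_one] using x_mul_x T q (l + 1)
  have z3 := x_pow_mul_x_pow T q (add_one_ne l).symm hN hN
  have z6 := x_pow_mul_x_pow T q (add_one_ne l) hN hN
  simp only [act_add, act_act, one_mul, mul_one, pow_one, ← pow_two, ← pow_succ, ← pow_succ', z1,
    z2, z3, z6, act_zero_left, act_zero_right, zero_add, add_zero, one_pow]
  -- The inverse belonging to the base `i+1` is `S_{m+1,i+4}⁻¹`, which cancels the coefficient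
  -- `S_{m+1,i}` of the left term.
  rw [mul_inv_cancel_left₀ hSi, sandwich_add, sandwich_add]
  have tel := sandwich_telescope T q l (S q (m + 1) (i + m)) (S q (m + 1) i)
    (pz T q (2 * m + 1) i m) (pz T q (2 * m + 1) (i + 2) m)
  rw [sandwich_sub, sub_eq_iff_eq_add] at tel
  have hc : S q (m + 2) (i + m) * S q m i = S q (m + 1) i * S q (m + 1) (i + (m + 1 : ℕ)) := by
    rw [← S_add, mul_comm, ← S_add]
    congr 1
    ring
  have rr := act_socle_right T q (fix_pz T q (2 * m + 1) i m) (S q (m + 1) (i + m)) 1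
  rw [hpar1, add_one_add_one] at rr
  have hr : S q (m + 2) (i + m) = S q (m + 1) (i + m) * q (i + (2 * m + 1 : ℕ)) := by
    rw [S_succ]
    congr 2
    push_cast
    ring
  rw [← hr] at rr
  have ll := act_socle_left T q (fix_pz T q (2 * m + 1) (i + 2) m) (S q m (i + 1)) 1
  rw [mul_comm (S q m (i + 1)), ← S_succ', hl] at ll
  rw [tel, hc, eq_neg_of_add_eq_zero_left rr, eq_neg_of_add_eq_zero_left ll]
  abel

theorem d_d_pz_above_middle (hq : ∀ i, q i ≠ 0) (m : ℕ) (i : ZMod 4) :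
    d T q (2 * m + 1) (d T q (2 * m + 2) (pz T q (2 * m + 3) i (m + 2))) = 0 := by
  obtain ⟨l, hl⟩ : ∃ l, par i = l := ⟨_, rfl⟩
  have hN : 4 * T + 1 ≠ 0 := by omega
  have hl1 : par (i + 1) = l + 1 := by rw [par_add_one, hl]
  have h12 : i + 1 + 1 = i + 2 := by ring
  have h13 : i + 1 + 2 = i + 3 := by ring
  have h14 : i + 1 + 3 = i := by rw [add_assoc]; exact add_four i
  have hv1 : i + 1 + (m : ZMod 4) = i + (m + 1 : ℕ) := by push_cast; ring
  have hv3 : i + ((m + 1 : ℕ) : ZMod 4) + 3 = i + m := by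
    rw [show i + ((m + 1 : ℕ) : ZMod 4) + 3 = i + m + 4 by push_cast; ring, add_four]
  have hpar : par (i + (2 * m + 2 : ℕ)) = l := by
    rw [show 2 * m + 2 = 2 * (m + 1) by ring, par_add_even, hl]
  have hpar1 : par (i + (2 * m + 1 : ℕ)) = l + 1 := by rw [par_add_odd, hl]
  have hpar2 : par (i + 1 + (2 * m + 1 : ℕ)) = l := by
    rw [par_add_odd, hl1, add_one_add_one]
  have hsg : sign K (2 * m + 2) = -1 := by rw [show 2 * m + 2 = 2 * (m + 1) by ring, sign_even]
  have ht : ((m : ℤ) + 2).toNat = m + 2 := by omega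
  have hu2 : (((2 * m + 2 : ℕ) : ℤ) + 1 - (m + 2)).toNat = m + 1 := by omega
  have hu1 : (((2 * m + 1 : ℕ) : ℤ) + 1 - (m + 2)).toNat = m := by omega
  have hvm : i + (((m : ℤ) + 2 : ℤ) : ZMod 4) - 1 = i + (m + 1 : ℕ) := by push_cast; ring
  have hvm1 : i + 1 + (((m : ℤ) + 2 : ℤ) : ZMod 4) - 1 = i + (m + 2 : ℕ) := by push_cast; ring
  have hj1 : (m : ℤ) + 2 - 1 = m + 1 := by ring
  have hS3 := S_ne_zero hq (m + 1) (i + 3)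
  rw [d_pz T q (n := 2 * m + 2) (j := m + 2) (a := 1) (b := 4 * T + 1)
    (Or.inr ⟨by push_cast; omega, rfl, rfl⟩) hl hpar rfl hvm hj1 rfl, hu2, ht, hsg]
  simp only [map_add, map_act, pow_one]
  rw [d_pz_middle T q hl rfl rfl rfl rfl, d_pz_middle T q hl1 h12 h13 h14 hv1,
    d_pz T q (n := 2 * m + 1) (i := i) (j := m + 2) (a := 1) (b := 4 * T + 1)
      (Or.inr ⟨by push_cast; omega, rfl, rfl⟩) hl hpar1 rfl hvm hj1 rfl,
    d_pz T q (n := 2 * m + 1) (i := i + 1) (j := m + 2) (a := 1) (b := 4 * T + 1)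
      (Or.inr ⟨by push_cast; omega, rfl, rfl⟩) hl1 hpar2 h12 hvm1 hj1 rfl, hu1, ht, sign_odd, hv3]
  simp only [add_one_add_one, neg_mul, one_mul, act_neg_scalar, act_add (b := x T q (l + 1)),
    act_add (a := x T q (l + 1)) (b := 1)]
  rw [act_sandwich_right_of_ne T q _ (add_one_ne l).symm, act_sandwich_right,
    act_sandwich_left, act_sandwich_left_of_ne T q _ (add_one_ne l)]
  have z1 : x T q l * x T q (l + 1) = 0 := x_mul_x T q l
  have z2 : x T q (l + 1) * x T q l = 0 := by
    simpa [add_one_add_one] using x_mul_x T q (l + 1)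
  have z3 := x_pow_mul_x_pow T q (add_one_ne l).symm hN hN
  have z6 := x_pow_mul_x_pow T q (add_one_ne l) hN hN
  simp only [act_add, act_act, one_mul, mul_one, pow_one, ← pow_two, ← pow_succ, ← pow_succ', z1,
    z2, z3, z6, act_zero_left, act_zero_right, zero_add, add_zero, one_pow]
  -- Here the factor with the inverse sits in the sandwich at `i`, and the two-step identity for `S`
  -- at `i+1` makes its coefficients agree with those at `i+1`.
  have hρ : S q (m + 1) (i + (m + 1 : ℕ)) *
      ((S q (m + 1) (i + 3))⁻¹ * S q (m + 1) (i + m + 3)) = S q (m + 1) (i + 1) := by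
    have per := S_mul_S_add_two hq m (i + 1)
    rw [h13, hv1, show i + ((m + 1 : ℕ) : ZMod 4) + 2 = i + m + 3 by push_cast; ring] at per
    rw [inv_mul_eq_div, mul_div_assoc', div_eq_iff hS3, per]
  rw [hρ, sandwich_add, sandwich_add]
  have tel := sandwich_telescope T q (l + 1) (S q (m + 1) (i + (m + 1 : ℕ))) (S q (m + 1) (i + 1))
    (pz T q (2 * m + 1) i (m + 1)) (pz T q (2 * m + 1) (i + 2) (m + 1))
  rw [sandwich_sub, sub_eq_iff_eq_add] at tel
  have hc : S q (m + 1) (i + (m + 1 : ℕ)) * S q (m + 1) i =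
      S q (m + 2) i * S q m (i + (m + 2 : ℕ)) := by
    rw [← S_add, mul_comm, ← S_add]
    congr 1
    ring
  have rr := act_socle_right T q (fix_pz T q (2 * m + 1) i (m + 1)) (S q m (i + (m + 1 : ℕ))) 1
  rw [hpar1, add_one_add_one] at rr
  have hr : S q (m + 1) (i + (m + 1 : ℕ)) =
      S q m (i + (m + 1 : ℕ)) * q (i + (2 * m + 1 : ℕ)) := by
    rw [S_succ]
    congr 2
    push_cast
    ring
  rw [← hr] at rr
  have ll := act_socle_left T q (fix_pz T q (2 * m + 1) (i + 2) (m + 1)) (S q (m + 1) (i + 1)) 1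
  rw [mul_comm (S q (m + 1) (i + 1)), ← S_succ', hl] at ll
  rw [tel, hc, eq_neg_of_add_eq_zero_left rr, eq_neg_of_add_eq_zero_left ll]
  abel

theorem d_d_pz (hq : ∀ i, q i ≠ 0) (n : ℕ) (i : ZMod 4) (j : ℤ) :
    d T q n (d T q (n + 1) (pz T q (n + 2) i j)) = 0 := by
  by_cases h1 : 2 * j < n + 1
  · exact d_d_pz_generic T q (Or.inl ⟨h1, rfl, rfl⟩)
  by_cases h2 : n + 3 < 2 * j
  · exact d_d_pz_generic T q (Or.inr ⟨h2, rfl, rfl⟩)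
  rcases Nat.even_or_odd' n with ⟨m, rfl | rfl⟩
  · obtain rfl : j = m + 1 := by push_cast at h1 h2; omega
    exact d_d_pz_middle T q hq m i
  · have hj : j = m + 1 ∨ j = m + 2 := by push_cast at h1 h2; omega
    rcases hj with rfl | rfl
    · exact d_d_pz_below_middle T q hq m i
    · exact d_d_pz_above_middle T q hq m i

variable {T q} in
theorem Bim.induction {i k : ZMod 4} {motive : Bim T q i k → Prop} (z : Bim T q i k)
    (zero : motive 0) (add : ∀ z w, motive z → motive w → motive (z + w))
    (gen : ∀ a b : Alg T q, motive (act T q 1 a (Bim.gen T q i k) b)) : motive z := by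
  refine TensorProduct.induction_on (motive := motive) z zero ?_ add
  rintro ⟨u, hu⟩ ⟨v, hv⟩
  obtain ⟨a, rfl⟩ := Submodule.mem_span_singleton.mp hu
  obtain ⟨b, rfl⟩ := Submodule.mem_span_singleton.mp hv
  have h := gen a (unop b)
  rw [act, one_smul, op_unop] at h
  exact h

variable {T q} in
/-- Every element of `R^n` is a sum of elements `a 𝔭^n_{i,j} b`. -/
theorem R.induction {n : ℕ} {motive : R T q n → Prop} (r : R T q n) (zero : motive 0)
    (add : ∀ r s, motive r → motive s → motive (r + s))
    (gen : ∀ (a b : Alg T q) (i : ZMod 4) (j : ℕ), j ≤ n → motive (act T q 1 a (p T q n i j) b)) :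
    motive r := by
  induction r using DirectSum.induction_on with
  | zero => exact zero
  | add r s hr hs => exact add r s hr hs
  | of ij z =>
    obtain ⟨i, j⟩ := ij
    induction z using Bim.induction with
    | zero => rw [map_zero]; exact zero
    | add z w hz hw => rw [map_add]; exact add _ _ hz hw
    | gen a b =>
      have h := gen a b i j (by omega)
      rw [p, dif_pos j.2, ← map_act] at h
      exact h

theorem d_d (hq : ∀ i, q i ≠ 0) (n : ℕ) (r : R T q (n + 2)) : d T q n (d T q (n + 1) r) = 0 := by
  induction r using R.induction with
  | zero => simp
  | add r s hr hs => rw [map_add, map_add, hr, hs, add_zero]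
  | gen a b i j _ =>
    rw [map_act, map_act, ← pz_natCast, d_d_pz T q hq, act_zero]

end CyclicAlg

/-- A complex with a contracting homotopy up to terms of a separated filtration is exact. -/
theorem exact_of_filtered_homotopy {X Y Z : Type*} [AddCommGroup X] [AddCommGroup Y]
    [AddCommGroup Z] (f : X →+ Y) (g : Y →+ Z) (s : Y →+ X) (t : Z →+ Y) (hgf : ∀ x, g (f x) = 0)
    (F : ℕ → AddSubgroup Y) (h0 : F 0 = ⊤) (N : ℕ) (hN : F N = ⊥)
    (hF : ∀ k, ∀ y ∈ F k, y - f (s y) - t (g y) ∈ F (k + 1)) : Function.Exact f g := by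
  intro y
  refine ⟨fun hy => ?_, ?_⟩
  · have key : ∀ k, ∃ x, y - f x ∈ F k := by
      intro k
      induction k with
      | zero => exact ⟨0, by rw [h0]; trivial⟩
      | succ k ih =>
        obtain ⟨x, hx⟩ := ih
        refine ⟨x + s (y - f x), ?_⟩
        have h := hF k _ hx
        rw [map_sub g, hy, hgf, sub_zero, map_zero, sub_zero] at h
        rwa [map_add, ← sub_sub]
    obtain ⟨x, hx⟩ := key N
    rw [hN, AddSubgroup.mem_bot, sub_eq_zero] at hx
    exact ⟨x, hx.symm⟩
  · rintro ⟨x, rfl⟩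
    exact hgf x

namespace CyclicAlg

/-! ### Filtrations -/

variable {K : Type u} [Field K] (T : ℕ) (q : ZMod 4 → K)

section LeftFiltration

variable (M : Type u) [AddCommGroup M] [Module (Env T q) M]

/-- The filtration of a bimodule by left multiples of powers `x_l^a` with `k ≤ a`. -/
def leftFiltration (k : ℕ) : AddSubgroup M :=
  AddSubgroup.closure {z | ∃ (l : ZMod 2) (a : ℕ) (r : M), k ≤ a ∧ z = act T q 1 (x T q l ^ a) r 1}

theorem leftFiltration_zero : leftFiltration T q M 0 = ⊤ := by
  refine eq_top_iff.mpr fun z _ => AddSubgroup.subset_closure ⟨0, 0, z, le_rfl, ?_⟩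
  rw [pow_zero, act_one]

theorem leftFiltration_eq_bot (hq : ∀ i, q i ≠ 0) : leftFiltration T q M (4 * T + 3) = ⊥ := by
  rw [leftFiltration, AddSubgroup.closure_eq_bot_iff]
  rintro z ⟨l, a, r, ha, rfl⟩
  rw [x_pow_eq_zero T q hq l ha, act_zero_left]
  rfl

variable {M}

theorem act_mem_leftFiltration (c : K) (l : ZMod 2) {k a : ℕ} (h : k ≤ a) (r : M) (b : Alg T q) :
    act T q c (x T q l ^ a) r b ∈ leftFiltration T q M k := by
  refine AddSubgroup.subset_closure ⟨l, a, act T q c 1 r b, h, ?_⟩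
  rw [act_act, one_mul, mul_one, mul_one]

theorem act_mem_leftFiltration_one (c : K) (l : ZMod 2) (r : M) (b : Alg T q) :
    act T q c (x T q l) r b ∈ leftFiltration T q M 1 := by
  simpa using act_mem_leftFiltration T q c l (le_refl 1) r b

theorem act_right_mem {k : ℕ} {z : M} (hz : z ∈ leftFiltration T q M k) (c : K) (b : Alg T q) :
    act T q c 1 z b ∈ leftFiltration T q M k := by
  induction hz using AddSubgroup.closure_induction with
  | mem z hz =>
    obtain ⟨l, a, r, ha, rfl⟩ := hz
    rw [act_act, one_mul]
    exact act_mem_leftFiltration T q _ l ha r _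
  | zero => rw [act_zero]; exact zero_mem _
  | add z w _ _ hz hw => rw [act_add]; exact add_mem hz hw
  | neg z _ hz => rw [act_neg]; exact neg_mem hz

/-- A power of the same letter adds to the degree, and a power of the other letter gives zero, so
the degree rises in either case. -/
theorem act_left_mem {z : M} (hz : z ∈ leftFiltration T q M 1) (l : ZMod 2) (a : ℕ) :
    act T q 1 (x T q l ^ a) z 1 ∈ leftFiltration T q M (a + 1) := by
  induction hz using AddSubgroup.closure_induction with
  | mem z hz =>
    obtain ⟨l', b, r, hb, rfl⟩ := hz
    rw [act_act]
    simp only [mul_one]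
    rcases Nat.eq_zero_or_pos a with rfl | ha
    · rw [pow_zero, one_mul]
      exact act_mem_leftFiltration T q 1 l' (by omega) r 1
    by_cases h : l = l'
    · subst h
      rw [← pow_add]
      exact act_mem_leftFiltration T q 1 l (by omega) r 1
    · rw [x_pow_mul_x_pow T q h (by omega) (by omega), act_zero_left]
      exact zero_mem _
  | zero => rw [act_zero]; exact zero_mem _
  | add z w _ _ hz hw => rw [act_add]; exact add_mem hz hw
  | neg z _ hz => rw [act_neg]; exact neg_mem hz

theorem leftFiltration_anti {k k' : ℕ} (h : k ≤ k') :
    leftFiltration T q M k' ≤ leftFiltration T q M k := by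
  refine AddSubgroup.closure_mono ?_
  rintro z ⟨l, a, r, ha, rfl⟩
  exact ⟨l, a, r, h.trans ha, rfl⟩

/-- Only the summand `k = 0` of the first sum has no letter on its left. -/
theorem sandwich_sub_mem (l : ZMod 2) (A B : M) :
    sandwich T q l A B - act T q 1 1 A (x T q l ^ (4 * T)) ∈ leftFiltration T q M 1 := by
  rw [sandwich, Finset.sum_range_succ', mul_zero, pow_zero, Nat.sub_zero, add_sub_right_comm,
    add_sub_cancel_right]
  refine add_mem (sum_mem fun k _ => ?_) (sum_mem fun k _ => ?_)
  · exact act_mem_leftFiltration T q 1 l (by omega) _ _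
  · exact act_mem_leftFiltration T q 1 l (by omega) _ _

end LeftFiltration

/-- The part of the differential that does not involve left multiplication. -/
theorem d_sub_mem {n : ℕ} {i : ZMod 4} {j : ℤ} {a b : ℕ} {k : ZMod 2} (hk : par (i + n) = k)
    (hab : (2 * j < n + 1 ∧ a = 4 * T + 1 ∧ b = 1) ∨
      (2 * j = n + 1 ∧ a = 4 * T + 1 ∧ b = 4 * T + 1) ∨ (n + 1 < 2 * j ∧ a = 1 ∧ b = 4 * T + 1))
    (c : K) (w : Alg T q) :
    d T q n (act T q c 1 (pz T q (n + 1) i j) w)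
      - (act T q (c * S q (n + 1 - j).toNat (i + j - 1)) 1 (pz T q n i (j - 1))
          (x T q (k + 1) ^ a * w)
        + act T q c 1 (pz T q n i j) (x T q k ^ b * w)) ∈ leftFiltration T q (R T q n) 1 := by
  have reduce : d T q n (pz T q (n + 1) i j)
      - (act T q (S q (n + 1 - j).toNat (i + j - 1)) 1 (pz T q n i (j - 1)) (x T q (k + 1) ^ a)
        + act T q 1 1 (pz T q n i j) (x T q k ^ b)) ∈ leftFiltration T q (R T q n) 1 := by
    by_cases hm : 2 * j = n + 1
    · obtain ⟨rfl, rfl⟩ : a = 4 * T + 1 ∧ b = 4 * T + 1 := by omega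
      obtain ⟨m, rfl⟩ : ∃ m : ℕ, n = 2 * m + 1 := ⟨(j - 1).toNat, by omega⟩
      obtain rfl : j = m + 1 := by push_cast at hm; omega
      have hu : (((2 * m + 1 : ℕ) : ℤ) + 1 - (m + 1)).toNat = m + 1 := by omega
      have hv : i + (((m : ℤ) + 1 : ℤ) : ZMod 4) - 1 = i + m := by push_cast; ring
      have hl : par i = k + 1 := by rw [← hk, par_add_odd, add_one_add_one]
      rw [d_pz_middle T q hl rfl rfl rfl rfl, hu, hv, add_sub_cancel_right, add_one_add_one]
      have h1 := sandwich_sub_mem T q (k + 1)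
        (act T q (S q (m + 1) (i + m)) 1 (pz T q (2 * m + 1) i m) (x T q (k + 1))
          + act T q (S q (m + 1) i) (x T q (k + 1)) (pz T q (2 * m + 1) (i + 1) (m + 1)) 1)
        (act T q (S q (m + 1) i) 1 (pz T q (2 * m + 1) (i + 2) m) (x T q (k + 1))
          + act T q (S q (m + 1) (i + m)) (x T q (k + 1)) (pz T q (2 * m + 1) (i + 3) (m + 1)) 1)
      have h2 := sandwich_sub_mem T q k
        (act T q 1 1 (pz T q (2 * m + 1) i (m + 1)) (x T q k)
          + act T q 1 (x T q k) (pz T q (2 * m + 1) (i + 1) m) 1)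
        (act T q ((S q (m + 1) (i + 3))⁻¹ * S q (m + 1) (i + m + 3)) 1
            (pz T q (2 * m + 1) (i + 2) (m + 1)) (x T q k)
          + act T q ((S q (m + 1) (i + 3))⁻¹ * S q (m + 1) (i + m + 3)) (x T q k)
            (pz T q (2 * m + 1) (i + 3) m) 1)
      simp only [act_add, act_act, one_mul, ← pow_succ', ← sub_sub] at h1 h2
      have h1' := add_mem h1 (act_mem_leftFiltration_one T q (S q (m + 1) i) (k + 1)
        (pz T q (2 * m + 1) (i + 1) (m + 1)) (x T q (k + 1) ^ (4 * T)))
      have h2' := add_mem h2 (act_mem_leftFiltration_one T q 1 k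
        (pz T q (2 * m + 1) (i + 1) m) (x T q k ^ (4 * T)))
      rw [sub_add_cancel] at h1' h2'
      rw [add_sub_add_comm]
      exact add_mem h1' h2'
    · have hab' : (2 * j < n + 1 ∧ a = 4 * T + 1 ∧ b = 1) ∨
          (n + 1 < 2 * j ∧ a = 1 ∧ b = 4 * T + 1) := by omega
      have hb : 1 ≤ b := by omega
      have ha : 1 ≤ a := by omega
      rw [d_pz T q hab' rfl hk rfl rfl rfl rfl, add_assoc, add_sub_cancel_left]
      exact add_mem (act_mem_leftFiltration T q _ _ hb _ _) (act_mem_leftFiltration T q _ _ ha _ _)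
  have h := act_right_mem T q reduce c w
  rw [act_sub, act_add, act_act, act_act, one_mul, mul_one] at h
  rwa [map_act]

end CyclicAlg

namespace CyclicAlg

/-! ### The homotopy -/

variable {K : Type u} [Field K] (T : ℕ) (q : ZMod 4 → K)

/-- The map `a ⊗ b ↦ a ⊗ D b` on `A ⊗ Aᵒᵖ`. -/
def envMap (D : Alg T q →ₗ[K] Alg T q) : Env T q →ₗ[K] Env T q :=
  TensorProduct.map LinearMap.id
    ((opLinearEquiv K).toLinearMap ∘ₗ D ∘ₗ (opLinearEquiv K).symm.toLinearMap)

theorem envMap_tmul (D : Alg T q →ₗ[K] Alg T q) (a b : Alg T q) :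
    envMap T q D (a ⊗ₜ[K] op b) = a ⊗ₜ[K] op (D b) := rfl

section Component

variable {M : Type u} [AddCommGroup M] [Module (Env T q) M]

/-- The additive map `A e_i ⊗ e_k A → M`, `u ⊗ v ↦ u m D(v)`. -/
def stripComponent (D : Alg T q →ₗ[K] Alg T q) (m : M) (i k : ZMod 4) : Bim T q i k →+ M where
  toFun z := envMap T q D (Bim.incl T q i k z) • m
  map_zero' := by
    rw [map_zero]
    exact (congrArg (· • m) (map_zero (envMap T q D))).trans (zero_smul (Env T q) m)
  map_add' z w := by
    rw [map_add]
    exact (congrArg (· • m) (map_add (envMap T q D) _ _)).trans (add_smul (R := Env T q) _ _ m)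

theorem incl_act_gen (i k : ZMod 4) (a b : Alg T q) :
    Bim.incl T q i k (act T q 1 a (Bim.gen T q i k) b) =
      (a * e T q i) ⊗ₜ[K] op (e T q k * b) := by
  have h : Bim.incl T q i k (Bim.gen T q i k) = e T q i ⊗ₜ[K] op (e T q k) := rfl
  rw [map_act, act, one_smul, h, smul_eq_mul, Algebra.TensorProduct.tmul_mul_tmul, op_mul]

theorem stripComponent_act (D : Alg T q →ₗ[K] Alg T q) (m : M) (i k : ZMod 4) (a b : Alg T q) :
    stripComponent T q D m i k (act T q 1 a (Bim.gen T q i k) b) =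
      act T q 1 (a * e T q i) m (D (e T q k * b)) := by
  change envMap T q D (Bim.incl T q i k _) • m = _
  rw [incl_act_gen, envMap_tmul, act, one_smul]

end Component

/-- The homotopy `R^n → R^{n+1}`, a map of left `A`-modules; on the right it strips letters. -/
def homotopy (n : ℕ) : R T q n →+ R T q (n + 1) :=
  DirectSum.toAddMonoid fun ij =>
    -- Each clause inverts a leading term of the one-sided differential. For `2j ≤ n` it is `𝔭_{i,j}
    -- x_{i+n}`, from `𝔭^{n+1}_{i,j}`; for `n ≤ 2j` it is a multiple of `𝔭_{i,j} x_{i+n+1}`, from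
    -- `𝔭^{n+1}_{i,j+1}`. At `2j = n` both clauses apply, and the factor `0` keeps the common socle
    -- from being stripped twice. At `2j = n+1` the middle generator has the leading term `𝔭_{i,j}
    -- x_{i+n}^{4T+1}`, which `lastCoeff` detects.
    (if 2 * (ij.2 : ℕ) ≤ n then
      stripComponent T q (strip T q (par (ij.1 + n)) 1) (p T q (n + 1) ij.1 ij.2) _ _ else 0)
    + (if n ≤ 2 * (ij.2 : ℕ) then
      stripComponent T q (strip T q (par (ij.1 + n) + 1) (if 2 * (ij.2 : ℕ) = n then 0 else 1))
        (act T q (S q (n - ij.2) (ij.1 + (ij.2 : ℕ)))⁻¹ 1 (p T q (n + 1) ij.1 (ij.2 + 1)) 1) _ _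
      else 0)
    + (if 2 * (ij.2 : ℕ) = n + 1 then
      stripComponent T q (lastCoeff T q (par (ij.1 + n))) (p T q (n + 1) ij.1 ij.2) _ _ else 0)

theorem homotopy_act_p {n j : ℕ} (hj : j ≤ n) (i : ZMod 4) (a b : Alg T q) :
    homotopy T q n (act T q 1 a (p T q n i j) b) =
      (if 2 * j ≤ n then
        act T q 1 a (p T q (n + 1) i j) (strip T q (par (i + n)) 1 (e T q (i + n) * b)) else 0)
      + (if n ≤ 2 * j then
        act T q (S q (n - j) (i + j))⁻¹ a (p T q (n + 1) i (j + 1))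
          (strip T q (par (i + n) + 1) (if 2 * j = n then 0 else 1) (e T q (i + n) * b)) else 0)
      + (if 2 * j = n + 1 then
        act T q 1 a (p T q (n + 1) i j) (lastCoeff T q (par (i + n)) (e T q (i + n) * b))
        else 0) := by
  rw [p, dif_pos (by omega), ← map_act]
  erw [DirectSum.toAddMonoid_of]
  have hite : ∀ (P : Prop) [Decidable P] (f : Bim T q i (i + n) →+ R T q (n + 1))
      (z : Bim T q i (i + n)), (if P then f else 0) z = if P then f z else 0 := by
    intro P _ f z
    split_ifs <;> rfl
  simp only [AddMonoidHom.add_apply, hite, stripComponent_act]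
  simp only [(fix_p T q (n + 1) i _).act_e_left, act_act, one_mul, mul_one]

/-- Outside the range the formula must give zero. The generators `𝔭^{n+1}_{i,0}` for `j = -1` and
`𝔭^{n+1}_{i,n+1}` for `j = n+1` do exist, but the conditions on their clauses fail there. -/
theorem homotopy_act_pz (n : ℕ) (i : ZMod 4) (j : ℤ) (a b : Alg T q) :
    homotopy T q n (act T q 1 a (pz T q n i j) b) =
      (if 2 * j ≤ n then
        act T q 1 a (pz T q (n + 1) i j) (strip T q (par (i + n)) 1 (e T q (i + n) * b)) else 0)
      + (if n ≤ 2 * j then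
        act T q (S q (n - j).toNat (i + j))⁻¹ a (pz T q (n + 1) i (j + 1))
          (strip T q (par (i + n) + 1) (if 2 * j = n then 0 else 1) (e T q (i + n) * b)) else 0)
      + (if 2 * j = n + 1 then
        act T q 1 a (pz T q (n + 1) i j) (lastCoeff T q (par (i + n)) (e T q (i + n) * b))
        else 0) := by
  rcases lt_or_ge j 0 with h0 | h0
  · rw [pz_of_neg T q n i h0, pz_of_neg T q (n + 1) i h0, act_zero, map_zero,
      if_neg (c := n ≤ 2 * j) (by omega)]
    simp [act_zero]
  rcases lt_or_ge (n : ℤ) j with h1 | h1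
  · rw [pz_of_gt T q i h1, pz_of_gt T q (n := n + 1) i (j := j + 1) (by push_cast; omega), act_zero,
      map_zero, if_neg (by omega), if_neg (c := 2 * j = n + 1) (by omega)]
    simp [act_zero]
  lift j to ℕ using h0
  have e1 : ((n : ℤ) - j).toNat = n - j := by omega
  have e2 : pz T q (n + 1) i ((j : ℤ) + 1) = p T q (n + 1) i (j + 1) := by
    rw [← pz_natCast]; push_cast; rfl
  rw [pz_natCast, pz_natCast, homotopy_act_p T q (by omega), e1, e2, Int.cast_natCast]
  have c1 : (2 * (j : ℤ) ≤ n) = (2 * j ≤ n) := by apply propext; omega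
  have c2 : ((n : ℤ) ≤ 2 * j) = (n ≤ 2 * j) := by apply propext; omega
  have c3 : (2 * (j : ℤ) = n) = (2 * j = n) := by apply propext; omega
  have c4 : (2 * (j : ℤ) = n + 1) = (2 * j = n + 1) := by apply propext; omega
  simp only [c1, c2, c3, c4]

variable {T q} in
theorem act_eq_smul_left {M : Type u} [AddCommGroup M] [Module (Env T q) M] (c : K) (a : Alg T q)
    (z : M) (b : Alg T q) : act T q c a z b = act T q 1 (c • a) z b := by
  rw [act_smul_left, one_mul]

/-- Stripping affects only the right tensor factor. -/
theorem homotopy_act_left (n : ℕ) (c : K) (a : Alg T q) (r : R T q n) :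
    homotopy T q n (act T q c a r 1) = act T q c a (homotopy T q n r) 1 := by
  induction r using R.induction with
  | zero => rw [act_zero, map_zero, act_zero]
  | add r s hr hs => rw [act_add, map_add, hr, hs, map_add, act_add]
  | gen a' b i j hj =>
    have hite : ∀ (P : Prop) [Decidable P] (z : R T q (n + 1)),
        act T q 1 (c • a) (if P then z else 0) 1 = if P then act T q 1 (c • a) z 1 else 0 := by
      intro P _ z
      split_ifs
      · rfl
      · exact act_zero _ _ _
    rw [act_eq_smul_left c, act_eq_smul_left c, act_act, homotopy_act_p T q hj,
      mul_one, mul_one, homotopy_act_p T q hj]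
    simp only [act_add, hite, act_act, one_mul, mul_one]

theorem homotopy_mem (n : ℕ) {r : R T q n} (hr : r ∈ leftFiltration T q (R T q n) 1) :
    homotopy T q n r ∈ leftFiltration T q (R T q (n + 1)) 1 := by
  induction hr using AddSubgroup.closure_induction with
  | mem z hz =>
    obtain ⟨l, a, r, ha, rfl⟩ := hz
    rw [homotopy_act_left]
    exact act_mem_leftFiltration T q _ _ ha _ _
  | zero => rw [map_zero]; exact zero_mem _
  | add z w _ _ hz hw => rw [map_add]; exact add_mem hz hw
  | neg z _ hz => rw [map_neg]; exact neg_mem hz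

theorem act_e_mul_pz {n : ℕ} {i k : ZMod 4} (hk : i + n = k) (j : ℤ) (c : K) (a b : Alg T q) :
    act T q c a (pz T q n i j) (e T q k * b) = act T q c a (pz T q n i j) b := by
  subst hk
  exact (fix_pz T q n i j).act_e_right c a b

/-! ### Values of the homotopy on right multiples of the generators -/

section Values

variable {n : ℕ} {i : ZMod 4} {j : ℤ} {k : ZMod 2}

theorem homotopy_act_scalar (c : K) (b : Alg T q) :
    homotopy T q n (act T q c 1 (pz T q n i j) b) =
      act T q c 1 (homotopy T q n (act T q 1 1 (pz T q n i j) b)) 1 := by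
  rw [← homotopy_act_left, act_act, mul_one, one_mul, mul_one]

theorem homotopy_one (c : K) : homotopy T q n (act T q c 1 (pz T q n i j) 1) = 0 := by
  have h1 : ∀ l θ, strip T q l θ (e T q (i + n) * 1) = 0 := fun l θ => by
    have := strip_mono_of_le T q l 0 θ (i + n) (t := 0) (by omega)
    rwa [pow_zero, if_neg (by simp)] at this
  have h2 : ∀ l, lastCoeff T q l (e T q (i + n) * 1) = 0 := fun l => by
    have := lastCoeff_mono T q l 0 (i + n) 0
    rwa [pow_zero, if_neg (by omega)] at this
  rw [homotopy_act_scalar, homotopy_act_pz, h1, h1, h2, act_zero_right, act_zero_right]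
  simp only [ite_self, add_zero, act_zero]

/-- The near letter is that of the terminus `i+n`, the far letter is the other one. The range of `t`
includes the socle: even at `2j = n` the second clause adds nothing, as its socle factor is `0`. -/
theorem homotopy_near (hq : ∀ i, q i ≠ 0) (hk : par (i + n) = k) (hj : 2 * j ≤ n) (c : K) {t : ℕ}
    (ht : t ≤ 4 * T + 1) :
    homotopy T q n (act T q c 1 (pz T q n i j) (x T q k ^ (t + 1))) =
      act T q c 1 (pz T q (n + 1) i j) (x T q k ^ t) := by
  have h1 : strip T q k 1 (e T q (i + n) * x T q k ^ (t + 1)) =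
      e T q (i + n + 1) * x T q k ^ t := by
    rcases Nat.lt_or_ge t (4 * T + 1) with h | h
    · rw [strip_mono_of_le T q _ _ _ _ (by omega), if_pos ⟨by omega, rfl⟩, Nat.add_sub_cancel]
    · obtain rfl : t = 4 * T + 1 := by omega
      rw [strip_socle T q hq, one_smul]
  have h2 : strip T q (k + 1) 0 (e T q (i + n) * x T q k ^ (t + 1)) = 0 := by
    rcases Nat.lt_or_ge t (4 * T + 1) with h | h
    · rw [strip_mono_of_le T q _ _ _ _ (by omega), if_neg fun h => add_one_ne k h.2.symm]
    · obtain rfl : t = 4 * T + 1 := by omega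
      exact strip_zero_socle T q _ _ _
  rw [homotopy_act_scalar, homotopy_act_pz, hk, if_pos hj, if_neg (c := 2 * j = n + 1) (by omega),
    h1, act_e_mul_pz T q (by push_cast; ring), add_zero]
  have h3 : (if (n : ℤ) ≤ 2 * j then act T q (S q (n - j).toNat (i + j))⁻¹ 1
      (pz T q (n + 1) i (j + 1)) (strip T q (k + 1) (if 2 * j = n then 0 else 1)
        (e T q (i + n) * x T q k ^ (t + 1))) else 0) = 0 := by
    split_ifs with h h'
    · rw [h2, act_zero_right]
    · omega
    · rfl
  rw [h3, add_zero, act_act, mul_one, one_mul, mul_one]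

theorem homotopy_near_of_lt (hk : par (i + n) = k) (hj : n < 2 * j) (c : K) {t : ℕ}
    (ht : t ≤ 4 * T) :
    homotopy T q n (act T q c 1 (pz T q n i j) (x T q k ^ (t + 1))) =
      if t = 4 * T ∧ 2 * j = n + 1 then act T q c 1 (pz T q (n + 1) i j) 1 else 0 := by
  rw [homotopy_act_scalar, homotopy_act_pz, hk, if_neg (by omega), if_pos (by omega),
    strip_mono_of_le T q _ _ _ _ (by omega), if_neg fun h => add_one_ne k h.2.symm,
    act_zero_right, zero_add, zero_add, lastCoeff_mono]
  by_cases h : 2 * j = n + 1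
  · by_cases h' : t = 4 * T
    · rw [if_pos h, if_pos ⟨by omega, rfl⟩, if_pos ⟨h', h⟩, act_act, mul_one, one_mul]
    · rw [if_pos h, if_neg (by omega), if_neg (by omega), act_zero_right, act_zero]
  · rw [if_neg h, if_neg (by omega), act_zero]

theorem homotopy_far_of_lt (hk : par (i + n) = k) (hj : 2 * j < n) (c : K) {t : ℕ}
    (ht : t ≤ 4 * T) :
    homotopy T q n (act T q c 1 (pz T q n i j) (x T q (k + 1) ^ (t + 1))) = 0 := by
  rw [homotopy_act_scalar, homotopy_act_pz, hk, if_pos (by omega), if_neg (by omega),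
    if_neg (by omega), strip_mono_of_le T q _ _ _ _ (by omega), if_neg fun h => add_one_ne k h.2,
    act_zero_right, zero_add, zero_add, act_zero]

/-- The socle is allowed only for `n < 2j`; at `2j = n` it is stripped as a power of the near letter
instead. -/
theorem homotopy_far (hq : ∀ i, q i ≠ 0) (hk : par (i + n) = k) (hj : n ≤ 2 * j) (c : K) {t : ℕ}
    (ht : t ≤ 4 * T ∨ (t = 4 * T + 1 ∧ n < 2 * j)) :
    homotopy T q n (act T q c 1 (pz T q n i j) (x T q (k + 1) ^ (t + 1))) =
      act T q (c * (S q (n - j).toNat (i + j))⁻¹) 1 (pz T q (n + 1) i (j + 1))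
        (x T q (k + 1) ^ t) := by
  rw [homotopy_act_scalar, homotopy_act_pz, hk, if_pos hj, lastCoeff_mono,
    if_neg (c := _ ∧ _) fun h => add_one_ne k h.2, act_zero_right, ite_self, add_zero]
  have h1 : strip T q (k + 1) (if 2 * j = n then 0 else 1)
      (e T q (i + n) * x T q (k + 1) ^ (t + 1)) = e T q (i + n + 1) * x T q (k + 1) ^ t := by
    rcases ht with h | ⟨rfl, h⟩
    · rw [strip_mono_of_le T q _ _ _ _ (by omega), if_pos ⟨by omega, rfl⟩, Nat.add_sub_cancel]
    · rw [if_neg (by omega), strip_socle T q hq, one_smul]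
  have h2 : (if 2 * j ≤ (n : ℤ) then act T q 1 1 (pz T q (n + 1) i j)
      (strip T q k 1 (e T q (i + n) * x T q (k + 1) ^ (t + 1))) else 0) = 0 := by
    split_ifs with h
    · rw [strip_mono_of_le T q _ _ _ _ (by omega), if_neg fun h => add_one_ne k h.2,
        act_zero_right]
    · rfl
  rw [h1, h2, zero_add, act_e_mul_pz T q (by push_cast; ring), act_act, mul_one, mul_one]

theorem act_pz_socle (hk : par (i + n) = k) (c : K) :
    act T q c 1 (pz T q n i j) (x T q (k + 1) ^ (4 * T + 2)) =
      act T q (-(c * q (i + n))) 1 (pz T q n i j) (x T q k ^ (4 * T + 2)) := by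
  have h := act_socle_right T q (fix_pz T q n i j) c 1
  rw [hk] at h
  rw [eq_neg_of_add_eq_zero_right h, act_neg_scalar]

theorem act_pz_socle' (hq : ∀ i, q i ≠ 0) (hk : par (i + n) = k) (c : K) :
    act T q c 1 (pz T q n i j) (x T q k ^ (4 * T + 2)) =
      act T q (-(c * (q (i + n))⁻¹)) 1 (pz T q n i j) (x T q (k + 1) ^ (4 * T + 2)) := by
  rw [act_pz_socle T q hk]
  congr 1
  rw [neg_mul, neg_neg, inv_mul_cancel_right₀ (hq _)]

end Values

end CyclicAlg

namespace CyclicAlg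

/-! ### The deviation of the homotopy -/

variable {K : Type u} [Field K] (T : ℕ) (q : ZMod 4 → K)

theorem S_toNat_succ {u u' : ℤ} (hu : 0 ≤ u) (h : u + 1 = u') (v k : ZMod 4) (hk : v + u = k) :
    S q u'.toNat v = S q u.toNat v * q k := by
  lift u to ℕ using hu
  subst h hk
  rw [show ((u : ℤ) + 1).toNat = u + 1 by omega, Int.toNat_natCast, S_succ, Int.cast_natCast]

/-- The deviation of `homotopy` from a contracting homotopy in positive degrees. -/
def defect (n : ℕ) (y : R T q (n + 1)) : R T q (n + 1) :=
  y - d T q (n + 1) (homotopy T q (n + 1) y) - homotopy T q n (d T q n y)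

section Defect

variable {n : ℕ} {i : ZMod 4} {j : ℤ} {k : ZMod 2}

/-- The homotopy preserves positive filtration degree, so both differentials may be replaced by
their one-sided parts `A'` and `B`. -/
theorem defect_mem_of_eq {y A' : R T q (n + 1)} {A : R T q (n + 2)} {B : R T q n}
    (hA : homotopy T q (n + 1) y = A)
    (hA' : d T q (n + 1) A - A' ∈ leftFiltration T q (R T q (n + 1)) 1)
    (hB : d T q n y - B ∈ leftFiltration T q (R T q n) 1)
    (h : y = A' + homotopy T q n B) :
    defect T q n y ∈ leftFiltration T q (R T q (n + 1)) 1 := by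
  have h1 := homotopy_mem T q n hB
  rw [map_sub] at h1
  have h2 := neg_mem (add_mem hA' h1)
  rw [defect, hA]
  convert h2 using 1
  nth_rewrite 1 [h]
  abel

theorem par_succ (hk : par (i + n) = k) : par (i + (n + 1 : ℕ)) = k + 1 := by
  rw [Nat.cast_succ, ← add_assoc, par_add_one, hk]

theorem defect_one (hq : ∀ i, q i ≠ 0) (hk : par (i + n) = k) :
    defect T q n (act T q 1 1 (pz T q (n + 1) i j) 1) ∈ leftFiltration T q (R T q (n + 1)) 1 := by
  refine defect_mem_of_eq T q (homotopy_one T q 1) (A' := 0)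
    (by rw [map_zero, sub_zero]; exact zero_mem _)
    (d_sub_mem T q hk (j := j) (a := if 2 * j ≤ n + 1 then 4 * T + 1 else 1)
      (b := if 2 * j < n + 1 then 1 else 4 * T + 1) (by split_ifs <;> omega) 1 1) ?_
  rw [map_add, zero_add, mul_one, mul_one, one_mul]
  -- Exactly one of the two one-sided terms is the leading term inverted by the homotopy. Below the
  -- middle and at the middle it is the one with `𝔭_{i,j}`, above it the one with `𝔭_{i,j-1}`.
  rcases lt_trichotomy (2 * j) (n + 1) with h | h | h
  · rw [if_pos h.le, if_pos h, homotopy_far_of_lt T q hk (by omega) _ le_rfl, zero_add]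
    have := homotopy_near T q hq hk (j := j) (by omega) 1 (t := 0) (by omega)
    rw [pow_zero, zero_add] at this
    rw [this]
  · rw [if_pos h.le, if_neg (by omega), homotopy_far_of_lt T q hk (by omega) _ le_rfl, zero_add,
      homotopy_near_of_lt T q hk (by omega) 1 le_rfl, if_pos ⟨rfl, h⟩]
  · rw [if_neg (by omega), if_neg (by omega), homotopy_near_of_lt T q hk (by omega) 1 le_rfl,
      if_neg (by omega), add_zero]
    have := homotopy_far T q hq hk (j := j - 1) (by omega)
      (S q ((n : ℤ) + 1 - j).toNat (i + j - 1)) (t := 0) (Or.inl (by omega))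
    have e1 : (n : ℤ) - (j - 1) = n + 1 - j := by ring
    have e2 : i + ((j - 1 : ℤ) : ZMod 4) = i + j - 1 := by push_cast; ring
    rw [e1, e2, pow_zero, zero_add, sub_add_cancel, mul_inv_cancel₀ (S_ne_zero hq _ _)] at this
    rw [this]

theorem defect_near_left (hq : ∀ i, q i ≠ 0) (hk : par (i + n) = k) (hj : 2 * j ≤ n + 1) {t : ℕ}
    (ht : t ≤ 4 * T + 1) :
    defect T q n (act T q 1 1 (pz T q (n + 1) i j) (x T q (k + 1) ^ (t + 1))) ∈
      leftFiltration T q (R T q (n + 1)) 1 := by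
  refine defect_mem_of_eq T q
    (homotopy_near T q hq (par_succ hk) (by push_cast; omega) 1 ht)
    (d_sub_mem T q (par_succ hk) (j := j) (a := 4 * T + 1) (b := 1)
      (Or.inl ⟨by push_cast; omega, rfl, rfl⟩) 1 _)
    (d_sub_mem T q hk (j := j) (a := 4 * T + 1)
      (b := if 2 * j < n + 1 then 1 else 4 * T + 1) (by split_ifs <;> omega) 1 _) ?_
  rw [x_pow_mul_x_pow T q (add_one_ne k).symm (by split_ifs <;> omega) (Nat.succ_ne_zero t),
    act_zero_right, add_zero, ← pow_add, ← pow_add, add_one_add_one, one_mul, one_mul,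
    add_comm 1 t]
  -- For `t = 0` the unwanted term `𝔭_{i,j-1} x_k^{4T+1}` of `d s` is cancelled by `s d`: there a
  -- socle power of `x_{k+1}` appears, which is rewritten in `x_k` before it is stripped. For `t >
  -- 0` both vanish.
  rcases Nat.eq_zero_or_pos t with rfl | ht0
  · rw [pow_zero, mul_one, zero_add, act_pz_socle T q hk,
      homotopy_near T q hq hk (by omega) _ le_rfl]
    rcases lt_or_ge j 1 with h | h
    · rw [pz_of_neg T q (n + 1) i (j := j - 1) (by omega), act_zero, act_zero, zero_add, add_zero]
    · rw [← S_toNat_succ q (u := (n : ℤ) + 1 - j) (u' := ((n + 1 : ℕ) : ℤ) + 1 - j) (by omega)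
        (by push_cast; ring) (i + j - 1) (i + n) (by push_cast; ring), act_neg_scalar]
      abel
  · rw [x_pow_mul_x_pow T q (add_one_ne k).symm (by omega) (by omega), act_zero_right, zero_add,
      x_pow_eq_zero T q hq (k + 1) (show 4 * T + 3 ≤ 4 * T + 1 + (t + 1) by omega),
      act_zero_right, map_zero, add_zero]

theorem defect_far_left (hq : ∀ i, q i ≠ 0) (hk : par (i + n) = k) (hj : 2 * j < n + 1) {t : ℕ}
    (ht : t ≤ 4 * T) :
    defect T q n (act T q 1 1 (pz T q (n + 1) i j) (x T q k ^ (t + 1))) ∈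
      leftFiltration T q (R T q (n + 1)) 1 := by
  have hs : homotopy T q (n + 1) (act T q 1 1 (pz T q (n + 1) i j) (x T q k ^ (t + 1))) = 0 := by
    have := homotopy_far_of_lt T q (par_succ hk) (j := j) (by push_cast; omega) 1 ht
    rwa [add_one_add_one] at this
  refine defect_mem_of_eq T q hs (A' := 0) (by rw [map_zero, sub_zero]; exact zero_mem _)
    (d_sub_mem T q hk (j := j) (a := 4 * T + 1) (b := 1) (Or.inl ⟨hj, rfl, rfl⟩) 1 _) ?_
  rw [x_pow_mul_x_pow T q (add_one_ne k) (by omega) (by omega), act_zero_right, zero_add, zero_add,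
    ← pow_add, add_comm 1, homotopy_near T q hq hk (by omega) 1 (by omega)]

theorem defect_far (hq : ∀ i, q i ≠ 0) (hk : par (i + n) = k) (hj : n + 1 ≤ 2 * j)
    {t : ℕ} (ht : t ≤ 4 * T ∨ (t = 4 * T + 1 ∧ n + 1 < 2 * j)) :
    defect T q n (act T q 1 1 (pz T q (n + 1) i j) (x T q k ^ (t + 1))) ∈
      leftFiltration T q (R T q (n + 1)) 1 := by
  have hs := homotopy_far T q hq (par_succ hk) (j := j) (by push_cast; omega) 1
    (t := t) (by push_cast; omega)
  rw [add_one_add_one, one_mul] at hs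
  refine defect_mem_of_eq T q hs
    (d_sub_mem T q (par_succ hk) (j := j + 1) (a := 1) (b := 4 * T + 1)
      (Or.inr (Or.inr ⟨by push_cast; omega, rfl, rfl⟩)) _ _)
    (d_sub_mem T q hk (j := j) (a := if 2 * j = n + 1 then 4 * T + 1 else 1) (b := 4 * T + 1)
      (by split_ifs <;> omega) 1 _) ?_
  have e1 : ((n + 1 : ℕ) : ℤ) + 1 - (j + 1) = ((n + 1 : ℕ) : ℤ) - j := by ring
  have e2 : i + ((j + 1 : ℤ) : ZMod 4) - 1 = i + j := by push_cast; ring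
  rw [x_pow_mul_x_pow T q (add_one_ne k) (by split_ifs <;> omega) (Nat.succ_ne_zero t),
    act_zero_right, zero_add, e1, e2, inv_mul_cancel₀ (S_ne_zero hq _ _), add_one_add_one,
    add_sub_cancel_right, ← pow_add, ← pow_add, add_comm 1 t]
  -- As in the near case, with the letters interchanged: the unwanted term now has index `j+1`, and
  -- the socle power is rewritten in the far letter.
  rcases Nat.eq_zero_or_pos t with rfl | ht0
  · rw [pow_zero, mul_one, zero_add, act_pz_socle' T q hq hk,
      homotopy_far T q hq hk (by omega) _ (Or.inr ⟨rfl, by omega⟩), one_mul]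
    rcases lt_or_ge (n : ℤ) j with h | h
    · rw [pz_of_gt T q (n := n + 1) i (j := j + 1) (by push_cast; omega), act_zero, act_zero,
        add_zero, add_zero]
    · rw [S_toNat_succ q (u := (n : ℤ) - j) (u' := ((n + 1 : ℕ) : ℤ) - j) (by omega)
        (by push_cast; ring) (i + j) (i + n) (by push_cast; ring), neg_mul, act_neg_scalar,
        mul_inv, mul_comm (q (i + n))⁻¹]
      abel
  · rw [x_pow_mul_x_pow T q (add_one_ne k) (by omega) (by omega), act_zero_right, add_zero,
      x_pow_eq_zero T q hq k (show 4 * T + 3 ≤ 4 * T + 1 + (t + 1) by omega),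
      act_zero_right, map_zero, add_zero]

theorem defect_near_right (hq : ∀ i, q i ≠ 0) (hk : par (i + n) = k) (hj : n + 1 < 2 * j)
    {t : ℕ} (ht : t ≤ 4 * T) :
    defect T q n (act T q 1 1 (pz T q (n + 1) i j) (x T q (k + 1) ^ (t + 1))) ∈
      leftFiltration T q (R T q (n + 1)) 1 := by
  have hs := homotopy_near_of_lt T q (par_succ hk) (j := j) (by push_cast; omega) 1 ht
  have hB := d_sub_mem T q hk (j := j) (a := 1) (b := 4 * T + 1)
      (Or.inr (Or.inr ⟨hj, rfl, rfl⟩)) 1 (x T q (k + 1) ^ (t + 1))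
  rw [x_pow_mul_x_pow T q (add_one_ne k).symm (by omega) (Nat.succ_ne_zero t), act_zero_right,
    add_zero, ← pow_add, one_mul, add_comm 1] at hB
  have e1 : (n : ℤ) - (j - 1) = n + 1 - j := by ring
  have e2 : i + ((j - 1 : ℤ) : ZMod 4) = i + j - 1 := by push_cast; ring
  -- In this exceptional case `lastCoeff` acts on `y`. In the degree below, `2(j-1) = n`, so the
  -- socle power is stripped as a near one, which yields the compensating term with index `j-1`.
  by_cases h : t = 4 * T ∧ 2 * j = (n + 1 : ℕ) + 1
  · obtain ⟨rfl, hj2⟩ := h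
    rw [if_pos ⟨rfl, hj2⟩] at hs
    refine defect_mem_of_eq T q hs
      (d_sub_mem T q (par_succ hk) (j := j) (a := 4 * T + 1) (b := 4 * T + 1)
        (Or.inr (Or.inl ⟨hj2, rfl, rfl⟩)) 1 1) hB ?_
    rw [act_pz_socle T q hk, homotopy_near T q hq hk (by push_cast at hj2; omega) _ le_rfl, mul_one,
      mul_one, one_mul, add_one_add_one,
      ← S_toNat_succ q (u := (n : ℤ) + 1 - j) (u' := ((n + 1 : ℕ) : ℤ) + 1 - j)
        (by push_cast at hj2; omega) (by push_cast; ring) (i + j - 1) (i + n) (by push_cast; ring),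
      act_neg_scalar]
    abel
  · rw [if_neg h] at hs
    refine defect_mem_of_eq T q hs (A' := 0) (by rw [map_zero, sub_zero]; exact zero_mem _) hB ?_
    rw [homotopy_far T q hq hk (by omega) _ (by push_cast at h; omega), e1, e2,
      mul_inv_cancel₀ (S_ne_zero hq _ _), sub_add_cancel, zero_add]

end Defect

end CyclicAlg

namespace CyclicAlg

/-! ### Exactness -/

variable {K : Type u} [Field K] (T : ℕ) (q : ZMod 4 → K)

section Left

variable {M : Type u} [AddCommGroup M] [Module (Env T q) M]

theorem act_e_left_mem {s : ℕ} {z : M} (hz : z ∈ leftFiltration T q M s) (c : K) (k : ZMod 4) :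
    act T q c (e T q k) z 1 ∈ leftFiltration T q M s := by
  induction hz using AddSubgroup.closure_induction with
  | mem z hz =>
    obtain ⟨l, a, r, ha, rfl⟩ := hz
    refine AddSubgroup.subset_closure ⟨l, a, act T q c (e T q (k + a)) r 1, ha, ?_⟩
    rw [act_act, act_act, e_mul_x_pow, mul_one, one_mul, one_mul]
  | zero => rw [act_zero]; exact zero_mem _
  | add z w _ _ hz hw => rw [act_add]; exact add_mem hz hw
  | neg z _ hz => rw [act_neg]; exact neg_mem hz

theorem act_left_mem_one {z : M} (hz : z ∈ leftFiltration T q M 1) (a : Alg T q) :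
    act T q 1 a z 1 ∈ leftFiltration T q M 1 := by
  induction a using Alg.induction with
  | zero => rw [act_zero_left]; exact zero_mem _
  | add a b ha hb => rw [act_add_left]; exact add_mem ha hb
  | mono c k l t =>
    have h := act_e_left_mem T q
      (leftFiltration_anti T q (Nat.succ_le_succ t.zero_le) (act_left_mem T q hz l t)) c k
    rwa [act_act, mul_one, mul_one, act_eq_smul_left] at h

theorem Fix.act_of_ne {i k k' : ZMod 4} {z : M} (hz : Fix T q i k z) (h : k ≠ k') (c : K)
    (a b : Alg T q) : CyclicAlg.act T q c a z (e T q k' * b) = 0 := by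
  rw [← hz.act_e_right, ← mul_assoc, e_mul_e, if_neg h, zero_mul, act_zero_right]

/-- A left linear endomorphism of `R^n` that maps right multiples of the generators into the first
step of the left filtration raises the filtration degree. -/
theorem mem_leftFiltration_succ {n : ℕ} (D : R T q n →+ R T q n)
    (hD : ∀ a r, D (act T q 1 a r 1) = act T q 1 a (D r) 1)
    (h : ∀ i j l t, j ≤ n →
      D (act T q 1 1 (p T q n i j) (x T q l ^ t)) ∈ leftFiltration T q (R T q n) 1)
    {s : ℕ} {y : R T q n} (hy : y ∈ leftFiltration T q (R T q n) s) :
    D y ∈ leftFiltration T q (R T q n) (s + 1) := by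
  -- By left linearity and the spanning monomials only the right factors `e_k x_l^t` matter; if
  -- `e_k` is not the terminus of the generator, the product is zero.
  have one : ∀ r, D r ∈ leftFiltration T q (R T q n) 1 := by
    intro r
    induction r using R.induction with
    | zero => rw [map_zero]; exact zero_mem _
    | add r s hr hs => rw [map_add]; exact add_mem hr hs
    | gen a b i j hj =>
      have e1 : act T q 1 a (p T q n i j) b = act T q 1 a (act T q 1 1 (p T q n i j) b) 1 := by
        rw [act_act, mul_one, mul_one, mul_one]
      rw [e1, hD]
      refine act_left_mem_one T q ?_ a
      induction b using Alg.induction with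
      | zero => rw [act_zero_right, map_zero]; exact zero_mem _
      | add a b ha hb =>
        rw [act_add_right, map_add]
        refine add_mem (ha ?_) (hb ?_) <;> rw [act_act, mul_one, mul_one, mul_one]
      | mono c k l t =>
        by_cases hk : i + n = k
        · subst hk
          have e2 : act T q 1 1 (p T q n i j) (c • (e T q (i + n) * x T q l ^ t)) =
              act T q 1 (c • 1) (act T q 1 1 (p T q n i j) (x T q l ^ t)) 1 := by
            rw [act_smul_right, (fix_p T q n i j).act_e_right, act_act, mul_one, mul_one,
              mul_one, act_smul_left]
          rw [e2, hD]
          exact act_left_mem_one T q (h i j l t hj) _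
        · rw [act_smul_right, (fix_p T q n i j).act_of_ne T q hk, map_zero]
          exact zero_mem _
  induction hy using AddSubgroup.closure_induction with
  | mem z hz =>
    obtain ⟨l, a, r, ha, rfl⟩ := hz
    rw [hD]
    exact leftFiltration_anti T q (Nat.succ_le_succ ha) (act_left_mem T q (one r) l a)
  | zero => rw [map_zero]; exact zero_mem _
  | add z w _ _ hz hw => rw [map_add]; exact add_mem hz hw
  | neg z _ hz => rw [map_neg]; exact neg_mem hz

end Left

theorem defect_act_scalar {n : ℕ} {i : ZMod 4} {j : ℤ} {c : K} {b : Alg T q}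
    (h : defect T q n (act T q 1 1 (pz T q (n + 1) i j) b) ∈ leftFiltration T q (R T q (n + 1)) 1) :
    defect T q n (act T q c 1 (pz T q (n + 1) i j) b) ∈ leftFiltration T q (R T q (n + 1)) 1 := by
  have h1 := act_right_mem T q h c 1
  rw [defect] at h1 ⊢
  rw [act_sub, act_sub, ← homotopy_act_left, ← map_act, ← map_act, ← homotopy_act_left,
    act_act, mul_one, one_mul, mul_one] at h1
  exact h1

/-- A socle power in a letter whose case does not include it is first rewritten, up to a scalar, in
the other letter. -/
theorem defect_generator (hq : ∀ i, q i ≠ 0) (n : ℕ) (i : ZMod 4) (j : ℤ) (l : ZMod 2) (t : ℕ) :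
    defect T q n (act T q 1 1 (pz T q (n + 1) i j) (x T q l ^ t)) ∈
      leftFiltration T q (R T q (n + 1)) 1 := by
  obtain ⟨k, hk⟩ : ∃ k, par (i + n) = k := ⟨_, rfl⟩
  rcases t with _ | t
  · rw [pow_zero]
    exact defect_one T q hq hk
  rcases lt_or_ge (4 * T + 1) t with ht | ht
  · rw [x_pow_eq_zero T q hq l (by omega), act_zero_right, defect, map_zero, map_zero, map_zero,
      map_zero, sub_zero, sub_zero]
    exact zero_mem _
  rcases eq_or_eq_add_one k l with rfl | rfl
  · by_cases h : t ≤ 4 * T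
    · rcases lt_or_ge (2 * j) (n + 1) with hj | hj
      · exact defect_far_left T q hq hk hj h
      · exact defect_far T q hq hk hj (Or.inl h)
    · obtain rfl : t = 4 * T + 1 := by omega
      rcases le_or_gt (2 * j) (n + 1) with hj | hj
      · have e1 := act_pz_socle T q (n := n + 1) (i := i) (j := j) (par_succ hk) 1
        rw [add_one_add_one] at e1
        rw [e1]
        exact defect_act_scalar T q (defect_near_left T q hq hk hj le_rfl)
      · exact defect_far T q hq hk hj.le (Or.inr ⟨rfl, hj⟩)
  · rcases le_or_gt (2 * j) (n + 1) with hj | hj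
    · exact defect_near_left T q hq hk hj ht
    · by_cases h : t ≤ 4 * T
      · exact defect_near_right T q hq hk hj h
      · obtain rfl : t = 4 * T + 1 := by omega
        have e1 := act_pz_socle' T q (n := n + 1) (i := i) (j := j) hq (par_succ hk) 1
        rw [add_one_add_one] at e1
        rw [e1]
        exact defect_act_scalar T q (defect_far T q hq hk hj.le (Or.inr ⟨rfl, hj⟩))

theorem exact_d_succ (hq : ∀ i, q i ≠ 0) (n : ℕ) :
    Function.Exact (d T q (n + 1)) (d T q n) := by
  refine exact_of_filtered_homotopy (d T q (n + 1)).toAddMonoidHom (d T q n).toAddMonoidHom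
    (homotopy T q (n + 1)) (homotopy T q n) (d_d T q hq n)
    (leftFiltration T q (R T q (n + 1))) (leftFiltration_zero T q _) (4 * T + 3)
    (leftFiltration_eq_bot T q _ hq) fun k y hy => ?_
  refine mem_leftFiltration_succ T q
    (AddMonoidHom.id _ - (d T q (n + 1)).toAddMonoidHom.comp (homotopy T q (n + 1))
      - (homotopy T q n).comp (d T q n).toAddMonoidHom) (fun a r => ?_) (fun i j l t _ => ?_) hy
  · change act T q 1 a r 1 - d T q (n + 1) (homotopy T q (n + 1) (act T q 1 a r 1))
      - homotopy T q n (d T q n (act T q 1 a r 1)) =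
      act T q 1 a (r - d T q (n + 1) (homotopy T q (n + 1) r) - homotopy T q n (d T q n r)) 1
    rw [map_act, homotopy_act_left, homotopy_act_left, map_act, act_sub, act_sub]
  · rw [← pz_natCast]
    exact defect_generator T q hq n i j l t

/-- The section `v ↦ ∑ v 𝔭^0_k` of the multiplication map. -/
def augSection : Alg T q →+ R T q 0 where
  toFun v := ∑ k, act T q 1 v (p T q 0 k 0) 1
  map_zero' := by simp [act_zero_left]
  map_add' v w := by simp only [act_add_left, Finset.sum_add_distrib]

theorem augSection_act (a v : Alg T q) :
    augSection T q (a * v) = act T q 1 a (augSection T q v) 1 := by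
  change ∑ k, act T q 1 (a * v) (p T q 0 k 0) 1 =
    act T q 1 a (∑ k, act T q 1 v (p T q 0 k 0) 1) 1
  simp only [act_sum, act_act, mul_one]

theorem augSection_e (i : ZMod 4) : augSection T q (e T q i) = p T q 0 i 0 := by
  change ∑ k, act T q 1 (e T q i) (p T q 0 k 0) 1 = _
  have h : ∀ k, act T q 1 (e T q i) (p T q 0 k 0) 1 = if i = k then p T q 0 k 0 else 0 := by
    intro k
    rw [← (fix_p T q 0 k 0).act_e_left, e_mul_e]
    split_ifs with h
    · subst h
      have := (fix_p T q 0 i 0).act_e_left 1 1 1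
      rw [one_mul] at this
      rw [this, act_one]
    · rw [act_zero_left]
  simp only [h, Finset.sum_ite_eq, Finset.mem_univ, if_true]

theorem aug_p (i : ZMod 4) : aug T q (p T q 0 i 0) = e T q i := by
  rw [p, dif_pos (by omega), Bim.gen, aug_tmul T q (i, ⟨0, by omega⟩)]
  change e T q i * e T q (i + (0 : ℕ)) = _
  rw [Nat.cast_zero, add_zero, e_mul_self]

theorem act_alg (c : K) (a b v : Alg T q) : act T q c a v b = c • (a * (v * b)) := by
  rw [act_eq_smul_left, act, one_smul, env_smul_def, smul_mul_assoc]

theorem aug_act (c : K) (a b : Alg T q) (i : ZMod 4) :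
    aug T q (act T q c a (p T q 0 i 0) b) = c • (a * (e T q i * b)) := by
  rw [map_act, aug_p, act_alg]

theorem aug_augSection (v : Alg T q) : aug T q (augSection T q v) = v := by
  change aug T q (∑ k, act T q 1 v (p T q 0 k 0) 1) = v
  simp only [map_sum, aug_act, one_smul, mul_one, ← Finset.mul_sum, sum_e]

theorem aug_surjective : Function.Surjective (aug T q) := fun v => ⟨_, aug_augSection T q v⟩

theorem aug_d (r : R T q 1) : aug T q (d T q 0 r) = 0 := by
  induction r using R.induction with
  | zero => simp
  | add r s hr hs => rw [map_add, map_add, hr, hs, add_zero]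
  | gen a b i j hj =>
    have hx : ∀ l, e T q i * x T q l = x T q l * e T q (i + 1) := fun l => by
      simpa using e_mul_x_pow T q i l 1
    rw [map_act, map_act, d_p T q 0 i j hj]
    have h : aug T q (dGen T q 0 i j) = 0 := by
      rcases Nat.eq_zero_or_pos j with rfl | hj0
      · simp [dGen, aug_act, hx]
      · obtain rfl : j = 1 := by omega
        simp [dGen, aug_act, hx]
    rw [h, act_zero]

end CyclicAlg

namespace CyclicAlg

/-! ### Exactness in degree zero -/

variable {K : Type u} [Field K] (T : ℕ) (q : ZMod 4 → K)

/-- The deviation of `homotopy` from a contracting homotopy in degree zero. -/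
def defectZero : R T q 0 →+ R T q 0 :=
  AddMonoidHom.id _ - (d T q 0).toAddMonoidHom.comp (homotopy T q 0)
    - (augSection T q).comp (aug T q).toAddMonoidHom

theorem defectZero_apply (y : R T q 0) :
    defectZero T q y = y - d T q 0 (homotopy T q 0 y) - augSection T q (aug T q y) := rfl

theorem defectZero_act_left (a : Alg T q) (r : R T q 0) :
    defectZero T q (act T q 1 a r 1) = act T q 1 a (defectZero T q r) 1 := by
  rw [defectZero_apply, defectZero_apply, homotopy_act_left, map_act, map_act, act_alg, mul_one,
    one_smul, augSection_act, act_sub, act_sub]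

theorem augSection_mem (i : ZMod 4) (l : ZMod 2) (t : ℕ) :
    augSection T q (aug T q (act T q 1 1 (pz T q 0 i 0) (x T q l ^ (t + 1)))) ∈
      leftFiltration T q (R T q 0) 1 := by
  have h := pz_natCast T q 0 i 0
  rw [Nat.cast_zero] at h
  rw [h, aug_act, one_smul, one_mul, e_mul_x_pow, augSection_act]
  exact act_mem_leftFiltration T q 1 l (by omega) _ _

theorem defectZero_generator (hq : ∀ i, q i ≠ 0) (i : ZMod 4) (l : ZMod 2) (t : ℕ) :
    defectZero T q (act T q 1 1 (p T q 0 i 0) (x T q l ^ t)) ∈ leftFiltration T q (R T q 0) 1 := by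
  obtain ⟨k, hk⟩ : ∃ k, par (i + (0 : ℕ)) = k := ⟨_, rfl⟩
  have hp := pz_natCast T q 0 i 0
  rw [Nat.cast_zero] at hp
  rw [← hp]
  rcases t with _ | t
  · rw [pow_zero, defectZero_apply, homotopy_one, map_zero, hp, aug_act, one_smul, mul_one, one_mul,
      augSection_e, act_one, sub_zero, sub_self]
    exact zero_mem _
  rcases lt_or_ge (4 * T + 1) t with ht | ht
  · rw [x_pow_eq_zero T q hq l (by omega), act_zero_right, map_zero]
    exact zero_mem _
  have near : ∀ t ≤ 4 * T + 1,
      defectZero T q (act T q 1 1 (pz T q 0 i 0) (x T q k ^ (t + 1))) ∈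
        leftFiltration T q (R T q 0) 1 := by
    intro t ht
    have h := d_sub_mem T q hk (j := 0) (a := 4 * T + 1) (b := 1)
      (Or.inl ⟨by norm_num, rfl, rfl⟩) 1 (x T q k ^ t)
    rw [pz_of_neg T q 0 i (j := 0 - 1) (by omega), act_zero, ← pow_add, add_comm 1 t] at h
    rw [defectZero_apply, homotopy_near T q hq hk (by norm_num) 1 ht]
    refine sub_mem ?_ (augSection_mem T q i k t)
    convert neg_mem h using 1
    abel
  rcases eq_or_eq_add_one k l with rfl | rfl
  · exact near t ht
  by_cases h : t ≤ 4 * T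
  · have h' := d_sub_mem T q hk (j := 0 + 1) (a := 1) (b := 4 * T + 1)
      (Or.inr (Or.inr ⟨by norm_num, rfl, rfl⟩)) 1 (x T q (k + 1) ^ t)
    have e1 := homotopy_far T q hq hk (j := 0) (by norm_num) 1 (Or.inl h)
    have e2 : (((0 : ℕ) : ℤ) + 1 - (0 + 1)).toNat = 0 := rfl
    have e3 : (((0 : ℕ) : ℤ) - 0).toNat = 0 := rfl
    rw [pz_of_gt T q (n := 0) i (j := 0 + 1) (by norm_num), act_zero, ← pow_add, add_comm 1 t,
      e2, S_zero, one_mul, add_sub_cancel_right] at h'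
    rw [e3, S_zero, inv_one, one_mul] at e1
    rw [defectZero_apply, e1]
    refine sub_mem ?_ (augSection_mem T q i (k + 1) t)
    convert neg_mem h' using 1
    abel
  -- In degree zero `2j = n`, so the socle is handled through the near letter.
  · obtain rfl : t = 4 * T + 1 := by omega
    rw [act_pz_socle T q hk]
    have e1 : ∀ c : K, act T q c 1 (pz T q 0 i 0) (x T q k ^ (4 * T + 2)) =
        act T q 1 (c • 1) (act T q 1 1 (pz T q 0 i 0) (x T q k ^ (4 * T + 2))) 1 := by
      intro c
      rw [act_act, act_eq_smul_left c, mul_one, mul_one, mul_one]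
    rw [e1, defectZero_act_left]
    exact act_left_mem_one T q (near _ le_rfl) _

theorem exact_d_aug (hq : ∀ i, q i ≠ 0) : Function.Exact (d T q 0) (aug T q) := by
  refine exact_of_filtered_homotopy (d T q 0).toAddMonoidHom (aug T q).toAddMonoidHom
    (homotopy T q 0) (augSection T q) (aug_d T q)
    (leftFiltration T q (R T q 0)) (leftFiltration_zero T q _) (4 * T + 3)
    (leftFiltration_eq_bot T q _ hq) fun k y hy => ?_
  refine mem_leftFiltration_succ T q (defectZero T q) (defectZero_act_left T q)
    (fun i j l t hj => ?_) hy
  obtain rfl : j = 0 := by omega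
  exact defectZero_generator T q hq i l t

/-! ### Projectivity -/

/-- This exhibits `A e_i ⊗ e_k A` as a direct summand of the enveloping algebra, the retraction
being the action on `e_i ⊗ e_k`. -/
theorem incl_smul_gen (i k : ZMod 4) (z : Bim T q i k) :
    Bim.incl T q i k z • Bim.gen T q i k = z := by
  have hfix : Fix T q i k (Bim.gen T q i k) := by
    rw [Fix, Bim.gen, Bim.smul_tmul]
    congr 1
    · exact Subtype.ext (e_mul_self T q i)
    · exact Subtype.ext (e_mul_self T q k)
  induction z using Bim.induction with
  | zero => rw [map_zero]; exact zero_smul (Env T q) (Bim.gen T q i k)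
  | add z w hz hw => rw [map_add, add_smul, hz, hw]
  | gen a b =>
    rw [incl_act_gen, ← one_smul K (_ ⊗ₜ[K] _)]
    exact hfix.act_e 1 a b

instance (i k : ZMod 4) : Module.Projective (Env T q) (Bim T q i k) :=
  Module.Projective.of_split (Bim.incl T q i k)
    (LinearMap.toSpanSingleton (Env T q) _ (Bim.gen T q i k))
    (LinearMap.ext (incl_smul_gen T q i k))

theorem projective_R (n : ℕ) : Module.Projective (Env T q) (R T q n) := inferInstance

/-! ### Minimality -/

section Radical

variable (M : Type u) [AddCommGroup M] [Module (Env T q) M]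

/-- The filtration of a bimodule by the elements `a z b` with `a` and `b` monomials of total
degree at least `k`. -/
def degreeFiltration (k : ℕ) : AddSubgroup M :=
  AddSubgroup.closure {y | ∃ (l l' : ZMod 2) (s t : ℕ) (z : M), k ≤ s + t ∧
    y = act T q 1 (x T q l ^ s) z (x T q l' ^ t)}

/-- Since `8T+5 = 2(4T+2)+1`, one of the two exponents is at least `4T+3`. -/
theorem degreeFiltration_eq_bot (hq : ∀ i, q i ≠ 0) :
    degreeFiltration T q M (8 * T + 5) = ⊥ := by
  rw [degreeFiltration, AddSubgroup.closure_eq_bot_iff]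
  rintro y ⟨l, l', s, t, z, h, rfl⟩
  rcases lt_or_ge s (4 * T + 3) with hs | hs
  · rw [x_pow_eq_zero T q hq l' (t := t) (by omega), act_zero_right]
    rfl
  · rw [x_pow_eq_zero T q hq l hs, act_zero_left]
    rfl

variable {M}

theorem act_mem_degreeFiltration (c : K) (l l' : ZMod 2) {k s t : ℕ} (h : k ≤ s + t) (z : M) :
    act T q c (x T q l ^ s) z (x T q l' ^ t) ∈ degreeFiltration T q M k := by
  refine AddSubgroup.subset_closure ⟨l, l', s, t, act T q c 1 z 1, h, ?_⟩
  rw [act_act, mul_one, one_mul, one_mul]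

theorem act_right_mem_degreeFiltration (c : K) (l : ZMod 2) {t : ℕ} (h : 1 ≤ t) (z : M) :
    act T q c 1 z (x T q l ^ t) ∈ degreeFiltration T q M 1 := by
  simpa using act_mem_degreeFiltration T q c 0 l (s := 0) (by omega) z

theorem act_degreeFiltration {k s t : ℕ} {l l' : ZMod 2} {y : M}
    (hy : y ∈ degreeFiltration T q M k) :
    act T q 1 (x T q l ^ s) y (x T q l' ^ t) ∈ degreeFiltration T q M (k + (s + t)) := by
  have pow : ∀ (l l' : ZMod 2) (s t : ℕ), x T q l ^ s * x T q l' ^ t = 0 ∨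
      ∃ m, x T q l ^ s * x T q l' ^ t = x T q m ^ (s + t) := by
    intro l l' s t
    by_cases h : l = l'
    · subst h
      exact Or.inr ⟨l, (pow_add _ _ _).symm⟩
    rcases Nat.eq_zero_or_pos s with rfl | hs
    · exact Or.inr ⟨l', by simp⟩
    rcases Nat.eq_zero_or_pos t with rfl | ht
    · exact Or.inr ⟨l, by simp⟩
    exact Or.inl (x_pow_mul_x_pow T q h hs.ne' ht.ne')
  induction hy using AddSubgroup.closure_induction with
  | mem y hy =>
    obtain ⟨m, m', s', t', z, h, rfl⟩ := hy
    rw [act_act]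
    rcases pow l m s s' with h1 | ⟨n, h1⟩
    · rw [h1, act_zero_left]; exact zero_mem _
    rcases pow m' l' t' t with h2 | ⟨n', h2⟩
    · rw [h2, act_zero_right]; exact zero_mem _
    rw [h1, h2]
    exact act_mem_degreeFiltration T q _ _ _ (by omega) _
  | zero => rw [act_zero]; exact zero_mem _
  | add z w _ _ hz hw => rw [act_add]; exact add_mem hz hw
  | neg z _ hz => rw [act_neg]; exact neg_mem hz

/-- Nakayama's lemma for the degree filtration. -/
theorem isSuperfluous_of_le (hq : ∀ i, q i ≠ 0) {N : Submodule (Env T q) M}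
    (hN : ∀ y ∈ N, y ∈ degreeFiltration T q M 1) : N.IsSuperfluous := by
  intro L hL
  have one : ∀ y : M, ∃ u ∈ L, y - u ∈ degreeFiltration T q M 1 := by
    intro y
    obtain ⟨u, hu, v, hv, rfl⟩ := Submodule.mem_sup.mp (hL ▸ Submodule.mem_top : y ∈ L ⊔ N)
    exact ⟨u, hu, by rw [add_sub_cancel_left]; exact hN v hv⟩
  -- Approximate the inner `z` of `x^s z x^t` by an element of `L` modulo degree one, then multiply
  -- by the outer powers.
  have step : ∀ k, ∀ y ∈ degreeFiltration T q M k,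
      ∃ u ∈ L, y - u ∈ degreeFiltration T q M (k + 1) := by
    intro k y hy
    induction hy using AddSubgroup.closure_induction with
    | mem y hy =>
      obtain ⟨l, l', s, t, z, h, rfl⟩ := hy
      obtain ⟨u, hu, hz⟩ := one z
      refine ⟨act T q 1 (x T q l ^ s) u (x T q l' ^ t), L.smul_mem _ hu, ?_⟩
      rw [← act_sub]
      have h1 := act_degreeFiltration T q (l := l) (l' := l') (s := s) (t := t) hz
      refine AddSubgroup.closure_mono ?_ h1
      rintro _ ⟨m, m', s', t', w, h', rfl⟩
      exact ⟨m, m', s', t', w, by omega, rfl⟩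
    | zero => exact ⟨0, L.zero_mem, by rw [sub_zero]; exact zero_mem _⟩
    | add y w _ _ hy hw =>
      obtain ⟨u, hu, hu'⟩ := hy
      obtain ⟨v, hv, hv'⟩ := hw
      exact ⟨u + v, L.add_mem hu hv, by rw [add_sub_add_comm]; exact add_mem hu' hv'⟩
    | neg y _ hy =>
      obtain ⟨u, hu, hu'⟩ := hy
      exact ⟨-u, L.neg_mem hu, by rw [neg_sub_neg, ← neg_sub]; exact neg_mem hu'⟩
  have all : ∀ k, ∀ y : M, ∃ u ∈ L, y - u ∈ degreeFiltration T q M (k + 1) := by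
    intro k y
    induction k with
    | zero => exact one y
    | succ k ih =>
      obtain ⟨u, hu, hu'⟩ := ih
      obtain ⟨v, hv, hv'⟩ := step _ _ hu'
      exact ⟨u + v, L.add_mem hu hv, by rwa [← sub_sub]⟩
  refine eq_top_iff.mpr fun y _ => ?_
  obtain ⟨u, hu, hu'⟩ := all (8 * T + 4) y
  rw [degreeFiltration_eq_bot T q M hq, AddSubgroup.mem_bot, sub_eq_zero] at hu'
  exact hu' ▸ hu

/-- Powers of a letter act without lowering the degree, and idempotents pass through such powers
with a shifted index; the monomials span `A`. -/
theorem act_mem_degreeFiltration_one {y : M} (hy : y ∈ degreeFiltration T q M 1)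
    (a b : Alg T q) : act T q 1 a y b ∈ degreeFiltration T q M 1 := by
  have mono : ∀ (c c' : K) (k k' : ZMod 4) (l l' : ZMod 2) (s t : ℕ),
      act T q 1 (c • (e T q k * x T q l ^ s)) y (c' • (e T q k' * x T q l' ^ t)) ∈
        degreeFiltration T q M 1 := by
    intro c c' k k' l l' s t
    have h : act T q 1 (c • (e T q k * x T q l ^ s)) y (c' • (e T q k' * x T q l' ^ t)) =
        act T q 1 (x T q l ^ s) (act T q (c * c') (e T q (k + s)) y (e T q k')) (x T q l' ^ t) := by
      rw [act_act, ← e_mul_x_pow, act_smul_left, act_smul_right, one_mul, one_mul]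
    have h' : act T q (c * c') (e T q (k + s)) y (e T q k') ∈ degreeFiltration T q M 1 := by
      generalize c * c' = c, k + s = k
      clear h
      induction hy using AddSubgroup.closure_induction with
      | mem y hy =>
        obtain ⟨m, m', s, t, z, h, rfl⟩ := hy
        have e1 := e_mul_x_pow T q (k' - t) m' t
        rw [sub_add_cancel] at e1
        rw [act_act, e_mul_x_pow, ← e1]
        have h1 := act_mem_degreeFiltration T q 1 m m' h
          (act T q c (e T q (k + s)) z (e T q (k' - t)))
        rwa [act_act, one_mul, ← mul_one c] at h1
      | zero => rw [act_zero]; exact zero_mem _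
      | add z w _ _ hz hw => rw [act_add]; exact add_mem hz hw
      | neg z _ hz => rw [act_neg]; exact neg_mem hz
    rw [h]
    have h2 := act_degreeFiltration T q (l := l) (l' := l') (s := s) (t := t) h'
    refine AddSubgroup.closure_mono ?_ h2
    rintro _ ⟨m, m', s', t', w, h', rfl⟩
    exact ⟨m, m', s', t', w, by omega, rfl⟩
  induction a using Alg.induction with
  | zero => rw [act_zero_left]; exact zero_mem _
  | add a a' h h' => rw [act_add_left]; exact add_mem h h'
  | mono c k l s =>
    induction b using Alg.induction with
    | zero => rw [act_zero_right]; exact zero_mem _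
    | add a a' h h' => rw [act_add_right]; exact add_mem h h'
    | mono c' k' l' t => exact mono c c' k k' l l' s t

end Radical

theorem d_mem_degreeFiltration (n : ℕ) (r : R T q (n + 1)) :
    d T q n r ∈ degreeFiltration T q (R T q n) 1 := by
  induction r using R.induction with
  | zero => rw [map_zero]; exact zero_mem _
  | add r s hr hs => rw [map_add]; exact add_mem hr hs
  | gen a b i j hj =>
    rw [map_act, ← pz_natCast]
    refine act_mem_degreeFiltration_one T q ?_ a b
    have h := d_sub_mem T q (n := n) (i := i) rfl (j := j)
      (a := if 2 * j ≤ n + 1 then 4 * T + 1 else 1) (b := if 2 * j < n + 1 then 1 else 4 * T + 1) (by split_ifs <;> omega) 1 1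
    rw [act_one, mul_one, mul_one] at h
    have hle : leftFiltration T q (R T q n) 1 ≤ degreeFiltration T q (R T q n) 1 := by
      refine AddSubgroup.closure_mono ?_
      rintro _ ⟨l, s, z, hs, rfl⟩
      exact ⟨l, 0, s, 0, z, by omega, by rw [pow_zero]⟩
    rw [← sub_add_cancel (d T q n _)]
    refine add_mem (hle h) (add_mem ?_ ?_)
    · exact act_right_mem_degreeFiltration T q _ _ (by split_ifs <;> omega) _
    · exact act_right_mem_degreeFiltration T q _ _ (by split_ifs <;> omega) _

/-- By exactness each kernel is the image of the next differential, hence lies in positive degree.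
-/
theorem isMinimalProjectiveResolution (hq : ∀ i, q i ≠ 0) :
    IsMinimalProjectiveResolution (S := Env T q) (M := Alg T q) (R T q) (aug T q) (d T q) where
  projective := projective_R T q
  surjective := aug_surjective T q
  exact_zero := exact_d_aug T q hq
  exact_succ := exact_d_succ T q hq
  minimal_zero := isSuperfluous_of_le T q hq fun y hy => by
    obtain ⟨r, rfl⟩ := (exact_d_aug T q hq y).mp hy
    exact d_mem_degreeFiltration T q 0 r
  minimal_succ n := isSuperfluous_of_le T q hq fun y hy => by
    obtain ⟨r, rfl⟩ := (exact_d_succ T q hq n y).mp hy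
    exact d_mem_degreeFiltration T q (n + 1) r

end CyclicAlg

namespace CyclicAlg

/-! ### The elements `g^n_{i,j}` -/

variable {K : Type u} [Field K]

theorem cons_injective (l : ZMod 2) (a b : ZMod 4) :
    Function.Injective fun r : Quiver.Path a b => r.cons (Arrow.a l b : b ⟶ b + 1) :=
  fun _ _ h => eq_of_heq (Quiver.Path.heq_of_cons_eq_cons h)

/-- The linear map of `KΓ` that removes a final arrow `a_{l,m}` from a path and kills all other
paths. -/
def dropLast (l : ZMod 2) : KΓ K →ₗ[K] KΓ K where
  toFun f := fun a b => Finsupp.lcomapDomain _ (cons_injective l a b) (f a (b + 1))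
  map_add' f g := PathAlgebra.ext fun a b =>
    map_add (Finsupp.lcomapDomain _ (cons_injective l a b)) (f a (b + 1)) (g a (b + 1))
  map_smul' c f := PathAlgebra.ext fun a b =>
    map_smul (Finsupp.lcomapDomain _ (cons_injective l a b)) c (f a (b + 1))

theorem dropLast_apply (l : ZMod 2) (f : KΓ K) {a b : ZMod 4} (r : Quiver.Path a b) :
    dropLast l f a b r = f a (b + 1) (r.cons (Arrow.a l b)) := rfl

theorem dropLast_mul_xPath (l l' : ZMod 2) (f : KΓ K) :
    dropLast l (f * xPath K l') = if l = l' then f else 0 := by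
  classical
  induction f using PathAlgebra.induction_ofPath with
  | zero => simp
  | add f g hf hg =>
    rw [add_mul, map_add, hf, hg]
    split_ifs <;> simp
  | path c a b r =>
    rw [smul_mul_assoc, map_smul, ofPath_mul_xPath]
    have h : dropLast l (PathAlgebra.ofPath (r.cons (Arrow.a l' b)) : KΓ K) =
        if l = l' then PathAlgebra.ofPath r else 0 := by
      refine PathAlgebra.ext fun a' b' => Finsupp.ext fun s => ?_
      rw [dropLast_apply]
      by_cases ha : a' = a
      · subst ha
        by_cases hb : b' = b
        · subst hb
          by_cases hl : l = l'
          · subst hl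
            rw [if_pos rfl]
            simp only [PathAlgebra.ofPath, Pi.single_eq_same]
            rw [Finsupp.single_apply, Finsupp.single_apply]
            exact if_congr (cons_injective l a' b').eq_iff rfl rfl
          · rw [if_neg hl]
            simp only [PathAlgebra.ofPath, Pi.single_eq_same]
            rw [Finsupp.single_apply, if_neg]
            · rfl
            · intro h
              have := eq_of_heq (Quiver.Path.hom_heq_of_cons_eq_cons h)
              exact hl (by injection this with h1; exact h1.symm)
        · have hb' : b' + 1 ≠ b + 1 := fun h => hb (add_right_cancel h)
          split_ifs <;> simp [PathAlgebra.ofPath, Pi.single_eq_of_ne hb, Pi.single_eq_of_ne hb',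
            PathAlgebra.zero_apply]
      · split_ifs <;> simp [PathAlgebra.ofPath, Pi.single_eq_of_ne ha, PathAlgebra.zero_apply]
    rw [h]
    split_ifs <;> simp

theorem dropLast_mul_pow (l : ZMod 2) (f : KΓ K) (t : ℕ) :
    dropLast l (f * xPath K l ^ (t + 1)) = f * xPath K l ^ t := by
  rw [pow_succ, ← mul_assoc, dropLast_mul_xPath, if_pos rfl]

theorem dropLast_mul_pow_of_ne {l l' : ZMod 2} (h : l ≠ l') (f : KΓ K) {t : ℕ} (ht : t ≠ 0) :
    dropLast l (f * xPath K l' ^ t) = 0 := by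
  obtain ⟨t, rfl⟩ := Nat.exists_eq_succ_of_ne_zero ht
  rw [pow_succ, ← mul_assoc, dropLast_mul_xPath, if_neg h]

/-- Removing a final letter is a left inverse of right multiplication by it. -/
theorem mul_pow_cancel {l : ZMod 2} {f g : KΓ K} {t : ℕ}
    (h : f * xPath K l ^ t = g * xPath K l ^ t) : f = g := by
  induction t with
  | zero => simpa using h
  | succ t ih => exact ih (by rw [← dropLast_mul_pow, h, dropLast_mul_pow])

theorem xPath_pow_mul_vertex (i : ZMod 4) (l : ZMod 2) (t : ℕ) :
    xPath K l ^ t * vertex K (i + t) = vertex K i * xPath K l ^ t := by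
  induction t generalizing i with
  | zero => simp
  | succ t ih =>
    rw [Nat.cast_succ, ← add_assoc, pow_succ, mul_assoc, xPath_mul_vertex, ← vertex_mul_xPath,
      ← mul_assoc, ih, mul_assoc]

variable (T : ℕ) (q : ZMod 4 → K)

/-- The elements `g^n_{i,j}` with the convention that they vanish unless `0 ≤ j ≤ n`. -/
def gz (n : ℕ) (i : ZMod 4) (j : ℤ) : KΓ K := if 0 ≤ j ∧ j ≤ n then g T q n i j.toNat else 0

theorem gz_natCast {n j : ℕ} (h : j ≤ n) (i : ZMod 4) : gz T q n i j = g T q n i j := by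
  rw [gz, if_pos (by omega), Int.toNat_natCast]

theorem gz_eq_zero {n : ℕ} {j : ℤ} (h : j < 0 ∨ n < j) (i : ZMod 4) : gz T q n i j = 0 :=
  if_neg (by omega)

/-- One recursion for all cases. For nonvanishing and distinctness only `c ≠ 0` matters; where the
term with `c` is zero, `c = 1` is a filler. -/
theorem gz_succ (hq : ∀ i, q i ≠ 0) {n : ℕ} {i : ZMod 4} {j : ℤ} {a b : ℕ} {k : ZMod 2}
    (hk : par (i + n) = k)
    (hab : (2 * j < n + 1 ∧ a = 4 * T + 1 ∧ b = 1) ∨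
      (2 * j = n + 1 ∧ a = 4 * T + 1 ∧ b = 4 * T + 1) ∨ (n + 1 < 2 * j ∧ a = 1 ∧ b = 4 * T + 1)) :
    ∃ c : K, c ≠ 0 ∧ gz T q (n + 1) i j =
      c • (gz T q n i (j - 1) * xPath K (k + 1) ^ a) + gz T q n i j * xPath K k ^ b := by
  by_cases hj : j < 0 ∨ (n + 1 : ℕ) < j
  · refine ⟨1, one_ne_zero, ?_⟩
    rw [gz_eq_zero T q hj, gz_eq_zero T q (j := j - 1) (by omega),
      gz_eq_zero T q (j := j) (by omega)]
    simp
  obtain ⟨j, rfl⟩ : ∃ m : ℕ, j = m := ⟨j.toNat, by omega⟩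
  rw [gz_natCast T q (by omega)]
  have h1 : j ≠ 0 → gz T q n i ((j : ℤ) - 1) = g T q n i (j - 1) := fun h => by
    rw [← gz_natCast T q (by omega)]
    congr 1
    omega
  rw [g]
  by_cases hn : n % 2 = 0
  · obtain ⟨m, hm⟩ : ∃ m, n = 2 * m := ⟨n / 2, by omega⟩
    have hm' : n / 2 = m := by omega
    have hki : par i = k := by rw [← hk, hm, par_add_even]
    simp only [hn, if_true, hm', hki, par_add_one]
    split_ifs with h2 h3 h4
    · subst h2
      obtain rfl : b = 1 := by omega
      refine ⟨1, one_ne_zero, ?_⟩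
      rw [gz_eq_zero T q (by omega), gz_natCast T q (by omega), pow_one]
      simp
    · obtain ⟨rfl, rfl⟩ : a = 4 * T + 1 ∧ b = 1 := by omega
      exact ⟨_, S_ne_zero hq _ _, by rw [h1 h2, gz_natCast T q (by omega), pow_one]⟩
    · obtain ⟨rfl, rfl⟩ : a = 1 ∧ b = 4 * T + 1 := by omega
      exact ⟨_, S_ne_zero hq _ _, by rw [h1 h2, gz_natCast T q (by omega), pow_one]⟩
    · obtain rfl : a = 1 := by omega
      refine ⟨1, one_ne_zero, ?_⟩
      rw [h1 h2, gz_eq_zero T q (j := j) (by omega), pow_one, zero_mul, add_zero, one_smul,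
        show j - 1 = 2 * m by omega]
  · obtain ⟨m, hm⟩ : ∃ m, n = 2 * m + 1 := ⟨n / 2, by omega⟩
    have hm' : (n + 1) / 2 = m + 1 := by omega
    have hki : par i = k + 1 := by rw [← hk, hm, par_add_odd, add_one_add_one]
    simp only [hn, if_false, hm', hki, par_add_one, add_one_add_one]
    split_ifs with h2 h3 h4 h5
    · subst h2
      obtain rfl : b = 1 := by omega
      refine ⟨1, one_ne_zero, ?_⟩
      rw [gz_eq_zero T q (by omega), gz_natCast T q (by omega), pow_one]
      simp
    · obtain ⟨rfl, rfl⟩ : a = 4 * T + 1 ∧ b = 1 := by omega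
      exact ⟨_, S_ne_zero hq _ _, by rw [h1 h2, gz_natCast T q (by omega), pow_one]⟩
    · obtain ⟨rfl, rfl⟩ : a = 4 * T + 1 ∧ b = 4 * T + 1 := by omega
      exact ⟨_, S_ne_zero hq _ _, by rw [h1 h2, gz_natCast T q (by omega), h4]⟩
    · obtain ⟨rfl, rfl⟩ : a = 1 ∧ b = 4 * T + 1 := by omega
      exact ⟨_, S_ne_zero hq _ _, by rw [h1 h2, gz_natCast T q (by omega), pow_one]⟩
    · obtain rfl : a = 1 := by omega
      refine ⟨1, one_ne_zero, ?_⟩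
      rw [h1 h2, gz_eq_zero T q (j := j) (by omega), pow_one, zero_mul, add_zero, one_smul,
        show j - 1 = 2 * (m + 1) - 1 by omega]

/-- The exponents in the recursion for `g^{n+1}_{i,j}`. -/
theorem exists_exponents (n : ℕ) (j : ℤ) : ∃ a b : ℕ,
    (2 * j < n + 1 ∧ a = 4 * T + 1 ∧ b = 1) ∨
      (2 * j = n + 1 ∧ a = 4 * T + 1 ∧ b = 4 * T + 1) ∨ (n + 1 < 2 * j ∧ a = 1 ∧ b = 4 * T + 1) :=
  ⟨if 2 * j ≤ n + 1 then 4 * T + 1 else 1, if 2 * j < n + 1 then 1 else 4 * T + 1,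
    by split_ifs <;> omega⟩

theorem vertex_mul_gz (hq : ∀ i, q i ≠ 0) (n : ℕ) (i : ZMod 4) (j : ℤ) :
    vertex K i * gz T q n i j = gz T q n i j := by
  induction n generalizing j with
  | zero =>
    rw [gz]
    split_ifs
    · rw [g, vertex_mul_vertex, if_pos rfl]
    · simp
  | succ n ih =>
    obtain ⟨a, b, hab⟩ := exists_exponents T n j
    obtain ⟨c, -, h⟩ := gz_succ T q hq (i := i) rfl hab
    rw [h, mul_add, mul_smul_comm, ← mul_assoc, ← mul_assoc, ih, ih]

theorem gz_mul_vertex (hq : ∀ i, q i ≠ 0) (n : ℕ) (i : ZMod 4) (j : ℤ) :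
    gz T q n i j * vertex K (i + n) = gz T q n i j := by
  induction n generalizing j with
  | zero =>
    rw [gz]
    split_ifs
    · rw [g, vertex_mul_vertex, Nat.cast_zero, add_zero, if_pos rfl]
    · simp
  | succ n ih =>
    obtain ⟨a, b, hab⟩ := exists_exponents T n j
    obtain ⟨c, -, h⟩ := gz_succ T q hq (i := i) rfl hab
    have hN : ((4 * T + 1 : ℕ) : ZMod 4) = 1 := by rw [Nat.cast_succ, cast_four_mul, zero_add]
    have ha : (a : ZMod 4) = 1 := by
      rcases hab with ⟨-, rfl, -⟩ | ⟨-, rfl, -⟩ | ⟨-, rfl, -⟩ <;> simp [hN]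
    have hb : (b : ZMod 4) = 1 := by
      rcases hab with ⟨-, -, rfl⟩ | ⟨-, -, rfl⟩ | ⟨-, -, rfl⟩ <;> simp [hN]
    have key : ∀ (l : ZMod 2) (t : ℕ) (j : ℤ), (t : ZMod 4) = 1 →
        gz T q n i j * xPath K l ^ t * vertex K (i + (n + 1 : ℕ)) =
          gz T q n i j * xPath K l ^ t := by
      intro l t j ht
      have := xPath_pow_mul_vertex (K := K) (i + n) l t
      rw [ht] at this
      rw [Nat.cast_succ, ← add_assoc, mul_assoc, this, ← mul_assoc, ih]
    rw [h, add_mul, smul_mul_assoc, key _ _ _ ha, key _ _ _ hb]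

theorem dropLast_gz (hq : ∀ i, q i ≠ 0) (n : ℕ) (i : ZMod 4) (j : ℤ) :
    dropLast (par (i + n)) (gz T q (n + 1) i j) =
      gz T q n i j * xPath K (par (i + n)) ^ (if 2 * j < n + 1 then 0 else 4 * T) := by
  obtain ⟨a, b, hab⟩ := exists_exponents T n j
  obtain ⟨c, -, h⟩ := gz_succ T q hq (i := i) rfl hab
  have hb : b = (if 2 * j < n + 1 then 0 else 4 * T) + 1 := by split_ifs <;> omega
  rw [h, map_add, map_smul, dropLast_mul_pow_of_ne (add_one_ne _).symm _ (by omega), smul_zero,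
    zero_add, hb, dropLast_mul_pow]

theorem gz_ne_zero (hq : ∀ i, q i ≠ 0) {n : ℕ} (i : ZMod 4) {j : ℤ} (h0 : 0 ≤ j) (hj : j ≤ n) :
    gz T q n i j ≠ 0 := by
  induction n generalizing j with
  | zero =>
    rw [gz, if_pos ⟨h0, hj⟩, g, vertex]
    intro h
    have := congrArg (fun f : KΓ K => f i i Quiver.Path.nil) h
    simp [PathAlgebra.ofPath, PathAlgebra.zero_apply] at this
  | succ n ih =>
    intro h
    -- At `j = n+1` the recursion has only its first term; otherwise dropping the letter of `i+n`
    -- isolates the second one.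
    rcases lt_or_ge (n : ℤ) j with hn | hn
    · obtain ⟨a, b, hab⟩ := exists_exponents T n j
      obtain ⟨c, hc, h'⟩ := gz_succ T q hq (i := i) rfl hab
      rw [h, gz_eq_zero T q (j := j) (Or.inr hn), zero_mul, add_zero] at h'
      have h2 := (smul_eq_zero.mp h'.symm).resolve_left hc
      rw [← zero_mul (xPath K (par (i + n) + 1) ^ a)] at h2
      exact ih (by omega) (by push_cast at hj; omega) (mul_pow_cancel h2)
    · have h' := dropLast_gz T q hq n i j
      rw [h, map_zero, ← zero_mul (xPath K (par (i + n)) ^ _)] at h'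
      exact ih h0 hn (mul_pow_cancel h').symm

/-- Dropping the letter of `i+n` from both elements leaves multiples of `g^n_{i,j}` and `g^n_{i,j'}`
by powers of this letter. Equal powers cancel and induction applies. -/
theorem gz_ne_of_lt (hq : ∀ i, q i ≠ 0) {n : ℕ} (i : ZMod 4) {j j' : ℤ} (h0 : 0 ≤ j) (hj : j < j')
    (hj' : j' ≤ n) : gz T q n i j ≠ gz T q n i j' := by
  induction n generalizing j j' with
  | zero => omega
  | succ n ih =>
    intro h
    have h' := congrArg (dropLast (par (i + n))) h
    rw [dropLast_gz T q hq, dropLast_gz T q hq] at h'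
    rcases lt_or_ge (n : ℤ) j' with hn | hn
    · rw [gz_eq_zero T q (Or.inr hn), zero_mul, ← zero_mul (xPath K (par (i + n)) ^ _)] at h'
      exact gz_ne_zero T q hq i h0 (by push_cast at hj'; omega) (mul_pow_cancel h')
    by_cases hT : T = 0 ∨ (2 * j < n + 1 ↔ 2 * j' < n + 1)
    · have e1 : (if 2 * j < (n : ℤ) + 1 then 0 else 4 * T) =
          if 2 * j' < (n : ℤ) + 1 then 0 else 4 * T := by split_ifs <;> omega
      rw [e1] at h'
      exact ih h0 hj hn (mul_pow_cancel h')
    -- Now `T > 0` and `g^n_{i,j}` would equal `g^n_{i,j'}` times a positive power of the letter of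
    -- `i+n`. Dropping the other letter kills the right side but not the left one, since `j < j' ≤
    -- n`.
    · rw [if_pos (by omega), if_neg (by omega), pow_zero, mul_one] at h'
      obtain ⟨n, rfl⟩ : ∃ m, n = m + 1 := ⟨n - 1, by omega⟩
      have h2 := congrArg (dropLast (par (i + n))) h'
      have hne : par (i + n) ≠ par (i + (n + 1 : ℕ)) := by
        rw [par_succ rfl]
        exact (add_one_ne _).symm
      rw [dropLast_mul_pow_of_ne hne _ (by omega), dropLast_gz T q hq,
        ← zero_mul (xPath K (par (i + n)) ^ _)] at h2
      exact gz_ne_zero T q hq i h0 (by push_cast at hn; omega) (mul_pow_cancel h2)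

theorem g_ne_zero (hq : ∀ i, q i ≠ 0) {n j : ℕ} (hj : j ≤ n) (i : ZMod 4) : g T q n i j ≠ 0 := by
  rw [← gz_natCast T q hj]
  exact gz_ne_zero T q hq i (by omega) (by omega)

theorem vertex_mul_g (hq : ∀ i, q i ≠ 0) {n j : ℕ} (hj : j ≤ n) (i : ZMod 4) :
    vertex K i * g T q n i j = g T q n i j := by
  rw [← gz_natCast T q hj, vertex_mul_gz T q hq]

theorem g_mul_vertex (hq : ∀ i, q i ≠ 0) {n j : ℕ} (hj : j ≤ n) (i : ZMod 4) :
    g T q n i j * vertex K (i + n) = g T q n i j := by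
  rw [← gz_natCast T q hj, gz_mul_vertex T q hq]

theorem g_injective (hq : ∀ i, q i ≠ 0) (n : ℕ) :
    Function.Injective fun ij : ZMod 4 × Fin (n + 1) => g T q n ij.1 ij.2 := by
  rintro ⟨i, j, hj⟩ ⟨i', j', hj'⟩ h
  change g T q n i j = g T q n i' j' at h
  -- Different origins are separated by multiplying with a vertex on the left.
  obtain rfl : i = i' := by
    by_contra hne
    refine g_ne_zero T q hq (Nat.le_of_lt_succ hj) i ?_
    rw [← vertex_mul_g T q hq (Nat.le_of_lt_succ hj), h,
      ← vertex_mul_g T q hq (Nat.le_of_lt_succ hj') i', ← mul_assoc, vertex_mul_vertex,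
      if_neg hne, zero_mul]
  rw [← gz_natCast T q (Nat.le_of_lt_succ hj), ← gz_natCast T q (Nat.le_of_lt_succ hj')] at h
  have hjj : j = j' := by
    rcases lt_trichotomy j j' with hlt | heq | hlt
    · exact absurd h (gz_ne_of_lt T q hq i (by omega) (by omega) (by omega))
    · exact heq
    · exact absurd h.symm (gz_ne_of_lt T q hq i (by omega) (by omega) (by omega))
  subst hjj
  rfl

end CyclicAlg
end

/-! ### The theorem -/

theorem theorem2p4 {K : Type*} [Field K] [IsAlgClosed K] (T : ℕ) (q : ZMod 4 → K)
    (hq : ∀ i, q i ≠ 0) :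
    -- the elements `g^n_{i,j}` are pairwise distinct, nonzero, and uniform with origin `e_i` and
    -- terminus `e_{i+n}`, so that `R^n` is the direct sum of the `A 𝔬(g) ⊗ 𝔱(g) A`, `g ∈ 𝒢^n`
    (∀ n : ℕ,
      (∀ (i : ZMod 4) (j : Fin (n + 1)), CyclicAlg.g T q n i j ≠ 0 ∧
        CyclicAlg.vertex K i * CyclicAlg.g T q n i j * CyclicAlg.vertex K (i + n) =
          CyclicAlg.g T q n i j) ∧
      Function.Injective fun ij : ZMod 4 × Fin (n + 1) => CyclicAlg.g T q n ij.1 ij.2) ∧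
    IsMinimalProjectiveResolution (S := CyclicAlg.Env T q) (M := CyclicAlg.Alg T q)
      (CyclicAlg.R T q) (CyclicAlg.aug T q) (CyclicAlg.d T q) := by
  refine ⟨fun n => ⟨fun i j => ?_, CyclicAlg.g_injective T q hq n⟩,
    CyclicAlg.isMinimalProjectiveResolution T q hq⟩
  have hj : (j : ℕ) ≤ n := Nat.le_of_lt_succ j.2
  refine ⟨CyclicAlg.g_ne_zero T q hq hj i, ?_⟩
  rw [CyclicAlg.vertex_mul_g T q hq hj, CyclicAlg.g_mul_vertex T q hq hj]
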